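/- **Setting.** Let $V=\{1,\dots,N\}$ with $N\ge 1$, let $\omega_{\{x,y\}}\in[0,\infty)$ be symmetric conductances with $\omega_{\{x,x\}}=0$ for which the graph on $V$ with edges $\{x,y\}$, $\omega_{\{x,y\}}\neq 0$, is connected, let $\alpha_x\in\{1,2,\dots\}$ for $x\in V$, and let $\omega_L,\omega_R\ge 0$ with $\max(\omega_L,\omega_R)>0$ and $\alpha_L,\alpha_R>0$. These data are the *underlying geometry*. Let $\sigma\in\{-1,0,1\}$ and let $\theta_L,\theta_R\in\varTheta$, where $\varTheta=[0,1]$ if $\sigma=-1$ and $\varTheta=[0,\infty)$ otherwise. Let $\mathcal X=\prod_{x\in V}\{0,\dots,\alpha_x\}$ if $\sigma=-1$ and $\mathcal X=\mathbb N_0^V$ otherwise. The boundary driven particle system is the continuous-time Markov chain $\{\eta_t\}$ on $\mathcal X$ in which - a particle moves from $x$ to $y$ at rate $\omega_{\{x,y\}}\,\eta(x)(\alpha_y+\sigma\eta(y))$, for all $x,y\in V$; - at site $1$ a particle is removed at rate $\omega_L\,\eta(1)(\alpha_L+\sigma\alpha_L\theta_L)$ and added at rate $\omega_L\,\alpha_L\theta_L(\alpha_1+\sigma\eta(1))$;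 - at site $N$ a particle is removed at rate $\omega_R\,\eta(N)(\alpha_R+\sigma\alpha_R\theta_R)$ and added at rate $\omega_R\,\alpha_R\theta_R(\alpha_N+\sigma\eta(N))$. Let $\mu_{\theta_L,\theta_R}$ be the stationary probability measure of this chain, and put $\bar\theta_x=\mathbb E_{\mu_{\theta_L,\theta_R}}[\eta(x)/\alpha_x]$. The dual system is the continuous-time Markov chain $\{\xi_t\}$ on $\widehat{\mathcal X}=\mathcal X\times\mathbb N_0^{\{L,R\}}$ with the same jumps and rates between sites of $V$, in which moreover a particle moves from $1$ to $L$ at rate $\omega_L\alpha_L\,\xi(1)$ and from $N$ to $R$ at rate $\omega_R\alpha_R\,\xi(N)$; particles at $L$ and $R$ never move. Write $|\xi|$ for the total number of particles of $\xi\in\widehat{\mathcal X}$, $\zeta\le\xi$ for the sitewise order, $\widehat{\mathbb P}_\xi$ for the law of the dual system started from $\xi$, and $\widehat{\mathbb P}^{\mathrm{IRW}}_\xi$ for this law when $\sigma=0$ (independent walkers). Let $\xi_\infty$ be distributed according to $\widehat p_\infty(\xi,\xi')=\lim_{t\to\infty}\widehat{\mathbb P}_\xi(\xi_t=\xi')$.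 **Theorem (stationary correlation functions).** The limits $\widehat p_\infty(\xi,\xi')$ exist. For all $n\in\mathbb N_0$ and all pairwise distinct $x_1,\dots,x_n\in V$, with $\xi=\delta_{x_1}+\dots+\delta_{x_n}$, the random variables below are integrable and $$\mathbb E_{\mu_{\theta_L,\theta_R}}\left[\prod_{i=1}^n\left(\frac{\eta(x_i)}{\alpha_{x_i}}-\bar\theta_{x_i}\right)\right]=(\theta_L-\theta_R)^n\,\psi(\xi),$$ where $$\psi(\xi)=\sum_{\zeta\le\xi}(-1)^{|\xi|-|\zeta|}\;\widehat{\mathbb P}^{\mathrm{IRW}}_{\xi-\zeta}\big((\xi-\zeta)_\infty(L)=|\xi-\zeta|\big)\;\widehat{\mathbb P}_\zeta\big(\zeta_\infty(L)=|\zeta|\big).$$ In particular, $\psi(\xi)$ is a real number that does not depend on $\theta_L$ or $\theta_R$, but only on $\sigma$ and the underlying geometry. -/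

import Mathlib

open MeasureTheory Filter Topology
open scoped ENNReal

noncomputable section

namespace BoundaryDriven

/-! ## Continuous-time Markov chains on a countable state space -/

section MarkovChain

variable {S : Type*}

/-- Rate of the jump from `x` to `y` (for `x ≠ y`) of the chain with generator `L`:
the value at `x` of `L` applied to the indicator function of `y`. -/
def jumpRate (L : (S → ℝ) → S → ℝ) (x y : S) : ℝ :=
  L (Set.indicator {y} 1) x

/-- Total rate at which the chain with generator `L` leaves `x`. -/
def exitRate (L : (S → ℝ) → S → ℝ) (x : S) : ℝ :=
  -L (Set.indicator {x} 1) x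

open Classical in
/-- Probability that the chain with generator `L` started from `x` is at `y` at time `t` after
exactly `n` jumps: it stays an exponential time of parameter `exitRate L x` at `x`, then jumps
to `z` at a rate proportional to `jumpRate L x z`, and starts afresh from there. -/
def jumpTransProb (L : (S → ℝ) → S → ℝ) : ℕ → ℝ → S → S → ℝ≥0∞
  | 0, t, x, y => if x = y then ENNReal.ofReal (Real.exp (-(exitRate L x * t))) else 0
  | n + 1, t, x, y =>
      ∫⁻ s in Set.Icc 0 t, ENNReal.ofReal (Real.exp (-(exitRate L x * s))) *
        ∑' z, if z = x then 0
          else ENNReal.ofReal (jumpRate L x z) * jumpTransProb L n (t - s) z y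

/-- Transition probabilities `p_t(x, y)` (for `t ≥ 0`) of the (minimal) continuous-time Markov
chain with generator `L`. -/
def transProb (L : (S → ℝ) → S → ℝ) (t : ℝ) (x y : S) : ℝ≥0∞ :=
  ∑' n, jumpTransProb L n t x y

/-- `μ` is stationary for the Markov chain with generator `L`: if the initial law is `μ`, so is
the law at every time `t ≥ 0`. -/
def IsStationaryLaw [MeasurableSpace S] (L : (S → ℝ) → S → ℝ) (μ : Measure S) : Prop :=
  ∀ t : ℝ, 0 ≤ t → ∀ y : S, ∑' x, μ {x} * transProb L t x y = μ {y}

/-- Limiting transition probabilities `p_∞(x, y) = lim_{t → ∞} p_t(x, y)`. -/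
def limitProb (L : (S → ℝ) → S → ℝ) (x y : S) : ℝ≥0∞ :=
  limUnder atTop (fun t : ℝ => transProb L t x y)

end MarkovChain

/-! ## The underlying geometry -/

/-- The underlying geometry: bulk sites `Fin N` with symmetric conductances `ω x y` that make the
bulk a connected graph, positive integer site parameters `α x`, and the conductances `ωL`, `ωR`
and parameters `αL`, `αR` of the two reservoirs. -/
structure Geometry (N : ℕ) where
  ω : Fin N → Fin N → ℝ
  ω_nonneg : ∀ x y, 0 ≤ ω x y
  ω_symm : ∀ x y, ω x y = ω y x
  ω_self : ∀ x, ω x x = 0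
  connected : (SimpleGraph.fromRel fun x y => ω x y ≠ 0).Connected
  α : Fin N → ℕ
  α_pos : ∀ x, 0 < α x
  ωL : ℝ
  ωR : ℝ
  ωL_nonneg : 0 ≤ ωL
  ωR_nonneg : 0 ≤ ωR
  αL : ℝ
  αR : ℝ
  αL_pos : 0 < αL
  αR_pos : 0 < αR

variable {N : ℕ}

/-- The bulk site in contact with the left reservoir. -/
def firstSite (N : ℕ) [NeZero N] : Fin N := ⟨0, Nat.pos_of_neZero N⟩

/-- The bulk site in contact with the right reservoir. -/
def lastSite (N : ℕ) [NeZero N] : Fin N := ⟨N - 1, Nat.sub_lt (Nat.pos_of_neZero N) one_pos⟩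

/-- Admissible scale parameters: `[0, 1]` for exclusion, `[0, ∞)` otherwise. -/
def scaleRange (σ : SignType) : Set ℝ :=
  if σ = -1 then Set.Icc 0 1 else Set.Ici 0

/-! ## Configurations -/

/-- Particle configurations: at most `α x` particles at `x` for exclusion (`σ = -1`), no
restriction for independent walkers (`σ = 0`) and inclusion (`σ = 1`). -/
abbrev Config (G : Geometry N) (σ : SignType) : Type :=
  {η : Fin N → ℕ // σ = -1 → ∀ x, η x ≤ G.α x}

namespace Config

variable {G : Geometry N} {σ : SignType}

open Classical in
/-- The configuration with occupation numbers `f`, if these are admissible, and `η` otherwise. -/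
def orElse (η : Config G σ) (f : Fin N → ℕ) : Config G σ :=
  if h : σ = -1 → ∀ x, f x ≤ G.α x then ⟨f, h⟩ else η

/-- Move a particle from `x` to `y`; nothing happens where this is impossible (there, the rate of
the move vanishes). -/
def hop (η : Config G σ) (x y : Fin N) : Config G σ :=
  if η.1 x = 0 then η else η.orElse (η.1 - Pi.single x 1 + Pi.single y 1)

/-- Remove a particle (if any) from `x`. -/
def remove (η : Config G σ) (x : Fin N) : Config G σ :=
  η.orElse (η.1 - Pi.single x 1)

/-- Add a particle at `x`; nothing happens where this is impossible (there, the rate vanishes). -/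
def add (η : Config G σ) (x : Fin N) : Config G σ :=
  η.orElse (η.1 + Pi.single x 1)

end Config

/-! ## The boundary driven particle system -/

/-- Generator of the bulk dynamics. The sum over ordered pairs `(x, y)` collects the two directions
of each bond `{x, y}`. -/
def bulkGenerator (G : Geometry N) (σ : SignType) (f : Config G σ → ℝ) (η : Config G σ) : ℝ :=
  ∑ x, ∑ y, G.ω x y * ((η.1 x : ℝ) * ((G.α y : ℝ) + (σ : ℝ) * (η.1 y : ℝ)) *
    (f (η.hop x y) - f η))

/-- Generator of the exchange between site `x` and a reservoir with parameter `a` and scale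
parameter `θ`. -/
def reservoirGenerator (G : Geometry N) (σ : SignType) (x : Fin N) (a θ : ℝ)
    (f : Config G σ → ℝ) (η : Config G σ) : ℝ :=
  (η.1 x : ℝ) * (a + (σ : ℝ) * a * θ) * (f (η.remove x) - f η) +
    a * θ * ((G.α x : ℝ) + (σ : ℝ) * (η.1 x : ℝ)) * (f (η.add x) - f η)

/-- Generator of the boundary driven particle system. -/
def generator [NeZero N] (G : Geometry N) (σ : SignType) (θL θR : ℝ)
    (f : Config G σ → ℝ) (η : Config G σ) : ℝ :=
  bulkGenerator G σ f η +
    (G.ωL * reservoirGenerator G σ (firstSite N) G.αL θL f η +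
      G.ωR * reservoirGenerator G σ (lastSite N) G.αR θR f η)

/-- Stationary profile `θ̄_x`: the mean of `η(x) / α_x` under `μ`. -/
def meanProfile {G : Geometry N} {σ : SignType} (μ : Measure (Config G σ)) (x : Fin N) : ℝ :=
  ∫ η, (η.1 x : ℝ) / (G.α x : ℝ) ∂μ

/-! ## The dual particle system with absorbing sites `L` and `R` -/

/-- Dual configurations `ξ`: the bulk part `ξ.1`, the number `ξ.2.1` of particles at `L` and the
number `ξ.2.2` of particles at `R`. The order on them is the sitewise one. -/
abbrev DualConfig (G : Geometry N) (σ : SignType) : Type :=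
  Config G σ × ℕ × ℕ

/-- Total number of particles `|ξ|`. -/
def totalCard {G : Geometry N} {σ : SignType} (ξ : DualConfig G σ) : ℕ :=
  ξ.2.1 + ξ.2.2 + ∑ x, ξ.1.1 x

/-- Generator of the dual system. -/
def dualGenerator [NeZero N] (G : Geometry N) (σ : SignType)
    (f : DualConfig G σ → ℝ) (ξ : DualConfig G σ) : ℝ :=
  bulkGenerator G σ (fun ζ => f (ζ, ξ.2)) ξ.1 +
    (G.ωL * G.αL * (ξ.1.1 (firstSite N) : ℝ) *
        (f (ξ.1.remove (firstSite N), ξ.2.1 + 1, ξ.2.2) - f ξ) +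
      G.ωR * G.αR * (ξ.1.1 (lastSite N) : ℝ) *
        (f (ξ.1.remove (lastSite N), ξ.2.1, ξ.2.2 + 1) - f ξ))

open Classical in
/-- The probability that all particles of the dual system started from `ξ` are eventually absorbed
at `L`, i.e. the mass that the limiting law `p̂_∞(ξ, ·)` gives to `{ξ' : ξ'(L) = |ξ|}`. -/
def absorbedAtL [NeZero N] (G : Geometry N) (σ : SignType) (ξ : DualConfig G σ) : ℝ :=
  (∑' ξ' : DualConfig G σ,
    if ξ'.2.1 = totalCard ξ then limitProb (dualGenerator G σ) ξ ξ' else 0).toReal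

/-- The difference `ξ - ζ`, as a configuration of independent dual walkers. -/
def diffIRW {G : Geometry N} {σ : SignType} (ξ ζ : DualConfig G σ) : DualConfig G 0 :=
  (⟨ξ.1.1 - ζ.1.1, fun h => absurd h (by decide)⟩, ξ.2.1 - ζ.2.1, ξ.2.2 - ζ.2.2)

theorem finite_Iic {G : Geometry N} {σ : SignType} (ξ : DualConfig G σ) :
    (Set.Iic ξ).Finite := by
  have h1 : (Set.Iic ξ.1).Finite :=
    Set.Finite.of_finite_image (f := Subtype.val)
      ((Set.finite_Iic ξ.1.1).subset (by rintro _ ⟨η, hη, rfl⟩; exact hη))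
      Subtype.val_injective.injOn
  have h2 : (Set.Iic ξ.2).Finite := Set.finite_Iic ξ.2
  exact (h1.prod h2).subset fun ζ hζ => ⟨hζ.1, hζ.2⟩

/-- The coefficient
`ψ(ξ) = ∑_{ζ ≤ ξ} (-1)^{|ξ| - |ζ|} P̂^IRW_{ξ-ζ}((ξ-ζ)_∞(L) = |ξ-ζ|) P̂_ζ(ζ_∞(L) = |ζ|)`. -/
def psi [NeZero N] (G : Geometry N) (σ : SignType) (ξ : DualConfig G σ) : ℝ :=
  ∑ ζ ∈ (finite_Iic ξ).toFinset,
    (-1) ^ (totalCard ξ - totalCard ζ) * absorbedAtL G 0 (diffIRW ξ ζ) * absorbedAtL G σ ζ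

/-- The dual configuration `δ_{x_1} + ⋯ + δ_{x_n}` for distinct bulk sites `x_1, …, x_n`. -/
def pointConfig (G : Geometry N) (σ : SignType) {n : ℕ} (x : Fin n → Fin N)
    (hx : Function.Injective x) : DualConfig G σ :=
  (⟨∑ i, Pi.single (x i) 1, fun _ y => by
      have h : (∑ i, (Pi.single (x i) 1 : Fin N → ℕ)) y ≤ 1 := by
        rw [Finset.sum_apply]
        by_cases hy : ∃ j, x j = y
        · obtain ⟨j, rfl⟩ := hy
          rw [Finset.sum_eq_single j]
          · simp
          · intro i _ hij
            simp [hx.ne hij.symm]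
          · simp
        · push Not at hy
          rw [Finset.sum_eq_zero]
          · simp
          · intro i _
            simp [(hy i).symm]
      exact h.trans (G.α_pos y)⟩, 0, 0)

end BoundaryDriven

end

open BoundaryDriven

namespace BoundaryDriven

section MoveGenerator

variable {S ι : Type*} [Fintype ι]

/-- The generator of a jump process which performs the move `T i` at rate `r i`. -/
def moveGenerator (r : ι → S → ℝ) (T : ι → S → S) (f : S → ℝ) (x : S) : ℝ :=
  ∑ i, r i x * (f (T i x) - f x)

variable {r : ι → S → ℝ} {T : ι → S → S}

open Classical in
theorem moveGenerator_eq_sum (F : Finset S) (g : S → ℝ) (x : S) (hx : x ∉ F → g x = 0)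
    (hT : ∀ i, T i x ∉ F → g (T i x) = 0) :
    moveGenerator r T g x = ∑ y ∈ F, g y * moveGenerator r T (Set.indicator {y} 1) x := by
  have key : ∀ z, (z ∉ F → g z = 0) → g z = ∑ y ∈ F, g y * Set.indicator {y} (1 : S → ℝ) z := by
    intro z hz
    simp only [Set.indicator_apply, Set.mem_singleton_iff, Pi.one_apply, mul_ite, mul_one,
      mul_zero, Finset.sum_ite_eq]
    split_ifs with h
    · rfl
    · exact hz h
  simp only [moveGenerator, Finset.mul_sum]
  rw [Finset.sum_comm]
  refine Finset.sum_congr rfl fun i _ => ?_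
  conv_lhs => rw [key _ (hT i), key _ hx]
  rw [← Finset.sum_sub_distrib, Finset.mul_sum]
  exact Finset.sum_congr rfl fun y _ => by ring

open Classical in
theorem exitRate_moveGenerator (x : S) :
    exitRate (moveGenerator r T) x = ∑ i, if T i x = x then 0 else r i x := by
  simp only [exitRate, moveGenerator, ← Finset.sum_neg_distrib]
  refine Finset.sum_congr rfl fun i _ => ?_
  by_cases h : T i x = x <;> simp [h]

theorem exitRate_nonneg (hr : ∀ i x, 0 ≤ r i x) (x : S) :
    0 ≤ exitRate (moveGenerator r T) x := by
  classical
  rw [exitRate_moveGenerator]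
  exact Finset.sum_nonneg fun i _ => by split_ifs <;> simp [hr]

open Classical in
theorem jumpRate_moveGenerator {x y : S} (h : y ≠ x) :
    jumpRate (moveGenerator r T) x y = ∑ i, if T i x = y then r i x else 0 := by
  simp only [jumpRate, moveGenerator]
  refine Finset.sum_congr rfl fun i _ => ?_
  by_cases h' : T i x = y <;> simp [h', h.symm]

theorem jumpRate_nonneg (hr : ∀ i x, 0 ≤ r i x) {x y : S} (h : y ≠ x) :
    0 ≤ jumpRate (moveGenerator r T) x y := by
  classical
  rw [jumpRate_moveGenerator h]
  exact Finset.sum_nonneg fun i _ => by split_ifs <;> simp [hr]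

open Classical in
theorem tsum_jumpRate_mul (hr : ∀ i x, 0 ≤ r i x) (x : S) (φ : S → ℝ≥0∞) :
    (∑' z, if z = x then 0 else ENNReal.ofReal (jumpRate (moveGenerator r T) x z) * φ z) =
      ∑ i, if T i x = x then 0 else ENNReal.ofReal (r i x) * φ (T i x) := by
  have : ∀ z, (if z = x then 0 else ENNReal.ofReal (jumpRate (moveGenerator r T) x z) * φ z) =
      ∑ i, if z = T i x then (if T i x = x then 0 else ENNReal.ofReal (r i x) * φ (T i x))
        else 0 := by
    intro z
    by_cases hz : z = x
    · subst hz
      rw [if_pos rfl]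
      refine (Finset.sum_eq_zero fun i _ => ?_).symm
      by_cases h : z = T i z
      · rw [if_pos h, if_pos h.symm]
      · rw [if_neg h]
    · rw [if_neg hz, jumpRate_moveGenerator hz, ENNReal.ofReal_sum_of_nonneg
        (fun i _ => by split_ifs <;> simp [hr]), Finset.sum_mul]
      refine Finset.sum_congr rfl fun i _ => ?_
      by_cases h : z = T i x
      · subst h
        simp [hz]
      · simp [h, Ne.symm h]
  rw [tsum_congr this, Summable.tsum_finsetSum (fun _ _ => ENNReal.summable)]
  exact Finset.sum_congr rfl fun i _ => tsum_ite_eq _ _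

/-! ### Consequences of stationarity -/

theorem ofReal_exp_le_transProb (L : (S → ℝ) → S → ℝ) (t : ℝ) (y : S) :
    ENNReal.ofReal (Real.exp (-(exitRate L y * t))) ≤ transProb L t y y := by
  refine le_trans ?_ (ENNReal.le_tsum 0)
  simp [jumpTransProb]

theorem ofReal_mul_jumpRate_le_transProb {L : (S → ℝ) → S → ℝ} {t : ℝ} (ht : 0 ≤ t) {x y : S}
    (hxy : y ≠ x) (hq : ∀ z, 0 ≤ exitRate L z) (hj : 0 ≤ jumpRate L x y) :
    ENNReal.ofReal (t * (Real.exp (-((exitRate L x + exitRate L y) * t)) * jumpRate L x y)) ≤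
      transProb L t x y := by
  classical
  refine le_trans ?_ (ENNReal.le_tsum 1)
  simp only [jumpTransProb]
  calc _ = ∫⁻ _ in Set.Icc 0 t, ENNReal.ofReal
        (Real.exp (-((exitRate L x + exitRate L y) * t)) * jumpRate L x y) := by
        rw [setLIntegral_const, Real.volume_Icc, sub_zero, mul_comm, ENNReal.ofReal_mul' ht]
    _ ≤ _ := by
        refine setLIntegral_mono' measurableSet_Icc fun s hs => ?_
        refine le_trans ?_ (mul_le_mul_right (ENNReal.le_tsum y) _)
        rw [if_neg hxy, if_pos rfl, ← ENNReal.ofReal_mul hj,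
          ← ENNReal.ofReal_mul (Real.exp_nonneg _)]
        refine ENNReal.ofReal_le_ofReal ?_
        rw [mul_left_comm, mul_comm (Real.exp (-((exitRate L x + exitRate L y) * t))),
          ← Real.exp_add]
        refine mul_le_mul_of_nonneg_left (Real.exp_le_exp.2 ?_) hj
        nlinarith [hq x, hq y, hs.1, hs.2, mul_nonneg (hq x) (sub_nonneg.2 hs.2),
          mul_nonneg (hq y) hs.1]

theorem IsStationaryLaw.sum_le [MeasurableSpace S] {μ : Measure S} [IsProbabilityMeasure μ]
    {L : (S → ℝ) → S → ℝ} (hμ : IsStationaryLaw L μ) (hq : ∀ z, 0 ≤ exitRate L z)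
    (hj : ∀ x y, y ≠ x → 0 ≤ jumpRate L x y) (F : Finset S) (y : S) (hy : y ∈ F) :
    ∑ x ∈ F, μ.real {x} * L (Set.indicator {y} 1) x ≤ 0 := by
  classical
  have h1 : ∀ t : ℝ, 0 ≤ t → (∑ x ∈ F.erase y, μ.real {x} *
      (t * (Real.exp (-((exitRate L x + exitRate L y) * t)) * jumpRate L x y))) +
      μ.real {y} * Real.exp (-(exitRate L y * t)) ≤ μ.real {y} := by
    intro t ht
    have hnn : ∀ x ∈ F.erase y, 0 ≤ μ.real {x} *
      (t * (Real.exp (-((exitRate L x + exitRate L y) * t)) * jumpRate L x y)) := fun x hx =>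
      mul_nonneg measureReal_nonneg (mul_nonneg ht (mul_nonneg (Real.exp_nonneg _)
        (hj x y (Finset.ne_of_mem_erase hx).symm)))
    have hconv : ∀ (x : S) (a : ℝ), ENNReal.ofReal (μ.real {x} * a) =
        μ {x} * ENNReal.ofReal a := by
      intro x a
      rw [ENNReal.ofReal_mul measureReal_nonneg, ofReal_measureReal]
    refine (ENNReal.ofReal_le_ofReal_iff measureReal_nonneg).1 ?_
    rw [ofReal_measureReal, ← hμ t ht y, ENNReal.ofReal_add (Finset.sum_nonneg hnn)
      (mul_nonneg measureReal_nonneg (Real.exp_nonneg _)), ENNReal.ofReal_sum_of_nonneg hnn]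
    refine le_trans ?_ (ENNReal.sum_le_tsum F)
    rw [← Finset.sum_erase_add _ _ hy]
    refine add_le_add (Finset.sum_le_sum fun x hx => ?_) ?_
    · rw [hconv]
      have hne := (Finset.ne_of_mem_erase hx).symm
      exact mul_le_mul_right (ofReal_mul_jumpRate_le_transProb ht hne hq (hj x y hne)) _
    · rw [hconv]
      exact mul_le_mul_right (ofReal_exp_le_transProb L t y) _
  have h2 : ∀ t : ℝ, 0 < t → (∑ x ∈ F.erase y, μ.real {x} *
      (Real.exp (-((exitRate L x + exitRate L y) * t)) * jumpRate L x y)) ≤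
      μ.real {y} * exitRate L y := by
    intro t ht
    have h := h1 t ht.le
    have h3 : μ.real {y} * (1 - exitRate L y * t) ≤
        μ.real {y} * Real.exp (-(exitRate L y * t)) :=
      mul_le_mul_of_nonneg_left (by linarith [Real.add_one_le_exp (-(exitRate L y * t))])
        measureReal_nonneg
    have h4 : (∑ x ∈ F.erase y, μ.real {x} *
      (t * (Real.exp (-((exitRate L x + exitRate L y) * t)) * jumpRate L x y))) = t *
      ∑ x ∈ F.erase y, μ.real {x} *
      (Real.exp (-((exitRate L x + exitRate L y) * t)) * jumpRate L x y) := by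
      rw [Finset.mul_sum]
      exact Finset.sum_congr rfl fun x _ => by ring
    rw [h4] at h
    refine le_of_mul_le_mul_left ?_ ht
    nlinarith
  have h5 : Tendsto (fun t : ℝ => ∑ x ∈ F.erase y, μ.real {x} *
      (Real.exp (-((exitRate L x + exitRate L y) * t)) * jumpRate L x y)) (𝓝[>] 0)
      (𝓝 (∑ x ∈ F.erase y, μ.real {x} * jumpRate L x y)) := by
    refine tendsto_nhdsWithin_of_tendsto_nhds ?_
    have : Continuous (fun t : ℝ => ∑ x ∈ F.erase y, μ.real {x} *
      (Real.exp (-((exitRate L x + exitRate L y) * t)) * jumpRate L x y)) := by fun_prop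
    simpa using this.tendsto 0
  have h6 := le_of_tendsto h5 (eventually_nhdsWithin_of_forall h2)
  rw [← Finset.sum_erase_add _ _ hy]
  have h7 : L (Set.indicator {y} 1) y = -exitRate L y := by simp [exitRate]
  rw [h7]
  change ∑ x ∈ F.erase y, μ.real {x} * jumpRate L x y + _ ≤ 0
  linarith

variable [MeasurableSpace S] {μ : Measure S} [IsProbabilityMeasure μ]

theorem IsStationaryLaw.sum_moveGenerator_le (hr : ∀ i x, 0 ≤ r i x)
    (hμ : IsStationaryLaw (moveGenerator r T) μ) (F : Finset S) (g : S → ℝ)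
    (hg : ∀ x, 0 ≤ g x) (hgF : ∀ x, x ∉ F → g x = 0) :
    ∑ x ∈ F, μ.real {x} * moveGenerator r T g x ≤ 0 := by
  have : ∑ x ∈ F, μ.real {x} * moveGenerator r T g x =
      ∑ y ∈ F, g y * ∑ x ∈ F, μ.real {x} * moveGenerator r T (Set.indicator {y} 1) x := by
    simp only [Finset.mul_sum]
    rw [Finset.sum_comm]
    refine Finset.sum_congr rfl fun x _ => ?_
    rw [moveGenerator_eq_sum F g x (hgF x) (fun i => hgF _), Finset.mul_sum]
    exact Finset.sum_congr rfl fun y _ => by ring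
  rw [this]
  exact Finset.sum_nonpos fun y hy => mul_nonpos_of_nonneg_of_nonpos (hg y)
    (hμ.sum_le (exitRate_nonneg hr) (fun _ _ => jumpRate_nonneg hr) F y hy)

/-- Moment bound for a stationary law from a Foster–Lyapunov function. -/
theorem IsStationaryLaw.integrable_of_drift [Countable S] [MeasurableSingletonClass S]
    (hr : ∀ i x, 0 ≤ r i x) (hμ : IsStationaryLaw (moveGenerator r T) μ)
    (V R : S → ℝ) (C : ℝ) (hV : ∀ M : ℝ, {x | V x < M}.Finite) (hR : ∀ x, 0 ≤ R x)
    (hd : ∀ x, moveGenerator r T V x ≤ C - R x) : Integrable R μ := by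
  classical
  refine ⟨Measurable.of_discrete.aestronglyMeasurable, ?_⟩
  rw [hasFiniteIntegral_iff_ofReal (Eventually.of_forall hR), lintegral_countable']
  refine lt_of_le_of_lt (b := ENNReal.ofReal (max C 0)) ?_ ENNReal.ofReal_lt_top
  rw [ENNReal.tsum_eq_iSup_sum]
  refine iSup_le fun A => ?_
  obtain ⟨M, hM⟩ : ∃ M : ℝ, ∀ x ∈ A, V x < M := by
    obtain ⟨M, hM⟩ := (A.image V).finite_toSet.bddAbove
    exact ⟨M + 1, fun x hx => lt_of_le_of_lt
      (hM (Finset.mem_coe.2 (Finset.mem_image_of_mem V hx))) (lt_add_one M)⟩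
  set F := (hV M).toFinset with hF
  have hAF : A ⊆ F := fun x hx => by simpa [hF] using hM x hx
  have key := hμ.sum_moveGenerator_le hr F (fun x => max (M - V x) 0) (fun x => le_max_right _ _)
    (fun x hx => max_eq_right (by simpa [hF] using hx))
  have h1 : ∀ x ∈ F, R x - C ≤ moveGenerator r T (fun x => max (M - V x) 0) x := by
    intro x hx
    have hx' : V x < M := by simpa [hF] using hx
    refine le_trans (by linarith [hd x] : R x - C ≤ -moveGenerator r T V x) ?_
    rw [moveGenerator, ← Finset.sum_neg_distrib]
    refine Finset.sum_le_sum fun i _ => ?_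
    rw [← mul_neg]
    refine mul_le_mul_of_nonneg_left ?_ (hr i x)
    beta_reduce
    rw [max_eq_left (sub_nonneg.2 hx'.le)]
    linarith [le_max_left (M - V (T i x)) 0]
  have h2 : ∑ x ∈ F, μ.real {x} * (R x - C) ≤ 0 :=
    (Finset.sum_le_sum fun x hx =>
      mul_le_mul_of_nonneg_left (h1 x hx) measureReal_nonneg).trans key
  have h3 : ∑ x ∈ F, μ.real {x} ≤ 1 := by
    rw [sum_measureReal_singleton]
    exact measureReal_le_one
  have h4 : ∑ x ∈ F, μ.real {x} * R x ≤ max C 0 := by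
    have : ∑ x ∈ F, μ.real {x} * (R x - C) =
        ∑ x ∈ F, μ.real {x} * R x - C * ∑ x ∈ F, μ.real {x} := by
      rw [Finset.mul_sum, ← Finset.sum_sub_distrib]
      exact Finset.sum_congr rfl fun x _ => by ring
    have h5 : 0 ≤ ∑ x ∈ F, μ.real {x} := Finset.sum_nonneg fun _ _ => measureReal_nonneg
    nlinarith [le_max_left C 0, le_max_right C 0]
  calc ∑ x ∈ A, ENNReal.ofReal (R x) * μ {x} = ENNReal.ofReal (∑ x ∈ A, μ.real {x} * R x) := by
        rw [ENNReal.ofReal_sum_of_nonneg fun x _ => mul_nonneg measureReal_nonneg (hR x)]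
        refine Finset.sum_congr rfl fun x _ => ?_
        rw [ENNReal.ofReal_mul measureReal_nonneg, ofReal_measureReal, mul_comm]
    _ ≤ _ := ENNReal.ofReal_le_ofReal (le_trans (Finset.sum_le_sum_of_subset_of_nonneg hAF
        fun x _ _ => mul_nonneg measureReal_nonneg (hR x)) h4)

end MoveGenerator

section StationaryEquation

variable {S ι : Type*} [Fintype ι] {r : ι → S → ℝ} {T : ι → S → S}

theorem abs_moveGenerator_le (hr : ∀ i x, 0 ≤ r i x) (f : S → ℝ) (x : S) :
    |moveGenerator r T f x| ≤ ∑ i, r i x * (|f (T i x)| + |f x|) := by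
  refine (Finset.abs_sum_le_sum_abs _ _).trans (Finset.sum_le_sum fun i _ => ?_)
  rw [abs_mul, abs_of_nonneg (hr i x)]
  exact mul_le_mul_of_nonneg_left (abs_sub _ _) (hr i x)

theorem sum_abs_indicator_le (hr : ∀ i x, 0 ≤ r i x) (f : S → ℝ) (A : Set S) (x : S) :
    ∑ i, r i x * (|A.indicator f (T i x)| + |A.indicator f x|) ≤
      ∑ i, r i x * (|f (T i x)| + |f x|) := by
  have h : ∀ z, |A.indicator f z| ≤ |f z| := fun z => by
    by_cases hz : z ∈ A <;> simp [hz]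
  exact Finset.sum_le_sum fun i _ => mul_le_mul_of_nonneg_left (add_le_add (h _) (h _)) (hr i x)

variable [MeasurableSpace S] [Countable S] [MeasurableSingletonClass S] {μ : Measure S}

theorem integrable_moveGenerator (hr : ∀ i x, 0 ≤ r i x) {f : S → ℝ}
    (hf : Integrable (fun x => ∑ i, r i x * (|f (T i x)| + |f x|)) μ) :
    Integrable (moveGenerator r T f) μ :=
  hf.mono' Measurable.of_discrete.aestronglyMeasurable
    (Eventually.of_forall fun x => abs_moveGenerator_le hr f x)

theorem integrable_sum_abs_indicator (hr : ∀ i x, 0 ≤ r i x) {f : S → ℝ}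
    (hf : Integrable (fun x => ∑ i, r i x * (|f (T i x)| + |f x|)) μ) (A : Set S) :
    Integrable (fun x => ∑ i, r i x * (|A.indicator f (T i x)| + |A.indicator f x|)) μ := by
  refine hf.mono' Measurable.of_discrete.aestronglyMeasurable (Eventually.of_forall fun x => ?_)
  rw [Real.norm_of_nonneg (Finset.sum_nonneg fun i _ => mul_nonneg (hr i x) (by positivity))]
  exact sum_abs_indicator_le hr f A x

theorem tendsto_integral_moveGenerator_indicator (hr : ∀ i x, 0 ≤ r i x) (V : S → ℝ) {f : S → ℝ}
    (hf : Integrable (fun x => ∑ i, r i x * (|f (T i x)| + |f x|)) μ) :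
    Tendsto (fun k : ℕ => ∫ x, moveGenerator r T ({x | V x < k}.indicator f) x ∂μ) atTop
      (𝓝 (∫ x, moveGenerator r T f x ∂μ)) := by
  refine tendsto_integral_of_dominated_convergence _
    (fun _ => Measurable.of_discrete.aestronglyMeasurable) hf
    (fun k => Eventually.of_forall fun x =>
      (abs_moveGenerator_le hr _ x).trans (sum_abs_indicator_le hr f _ x))
    (Eventually.of_forall fun x => ?_)
  refine tendsto_const_nhds.congr' ?_
  have h : ∀ z, ∀ᶠ k : ℕ in atTop, {x | V x < k}.indicator f z = f z := fun z => by
    obtain ⟨m, hm⟩ := exists_nat_gt (V z)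
    filter_upwards [eventually_ge_atTop m] with k hk
    exact Set.indicator_of_mem (s := {x | V x < k}) (hm.trans_le (Nat.cast_le.2 hk)) f
  filter_upwards [h x, eventually_all.2 fun i => h (T i x)] with k h1 h2
  simp only [moveGenerator, h1, h2]

variable [IsProbabilityMeasure μ]

theorem IsStationaryLaw.integral_nonpos_of_finite (hr : ∀ i x, 0 ≤ r i x)
    (hμ : IsStationaryLaw (moveGenerator r T) μ) {V : S → ℝ} (hV : ∀ M : ℝ, {x | V x < M}.Finite)
    {g : S → ℝ} (hg : ∀ x, 0 ≤ g x) {M : ℝ} (hgM : ∀ x, M ≤ V x → g x = 0)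
    (hf : Integrable (moveGenerator r T g) μ) :
    ∫ x, moveGenerator r T g x ∂μ ≤ 0 := by
  have h1 : Tendsto (fun k : ℕ => ∫ x in {x | V x < k}, moveGenerator r T g x ∂μ) atTop
      (𝓝 (∫ x in ⋃ k : ℕ, {x | V x < k}, moveGenerator r T g x ∂μ)) :=
    tendsto_setIntegral_of_monotone (fun k => Set.Countable.measurableSet (Set.to_countable _))
      (fun a b hab x (hx : V x < a) => lt_of_lt_of_le hx (Nat.cast_le.2 hab)) hf.integrableOn
  have h2 : ⋃ k : ℕ, {x | V x < k} = Set.univ :=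
    Set.eq_univ_of_forall fun x => Set.mem_iUnion.2 (exists_nat_gt (V x))
  rw [h2, setIntegral_univ] at h1
  obtain ⟨m, hm⟩ := exists_nat_gt M
  refine le_of_tendsto h1 ?_
  filter_upwards [eventually_ge_atTop m] with k hk
  have h3 := setIntegral_finset (μ := μ) (s := (hV k).toFinset) (f := moveGenerator r T g)
    hf.integrableOn
  rw [Set.Finite.coe_toFinset] at h3
  rw [h3]
  refine hμ.sum_moveGenerator_le hr _ g hg fun x hx => hgM x ?_
  have : (k : ℝ) ≤ V x := by simpa using hx
  have : (m : ℝ) ≤ k := Nat.cast_le.2 hk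
  linarith

theorem IsStationaryLaw.integral_nonpos (hr : ∀ i x, 0 ≤ r i x)
    (hμ : IsStationaryLaw (moveGenerator r T) μ) {V : S → ℝ} (hV : ∀ M : ℝ, {x | V x < M}.Finite)
    {f : S → ℝ} (hf0 : ∀ x, 0 ≤ f x)
    (hf : Integrable (fun x => ∑ i, r i x * (|f (T i x)| + |f x|)) μ) :
    ∫ x, moveGenerator r T f x ∂μ ≤ 0 := by
  refine le_of_tendsto' (tendsto_integral_moveGenerator_indicator hr V hf) fun k => ?_
  refine hμ.integral_nonpos_of_finite hr hV (Set.indicator_nonneg fun x _ => hf0 x) (M := k)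
    (fun x hx => Set.indicator_of_notMem (by simpa using hx) f)
    (integrable_moveGenerator hr (integrable_sum_abs_indicator hr hf _))

theorem IsStationaryLaw.integral_eq_zero_of_bounded (hr : ∀ i x, 0 ≤ r i x)
    (hμ : IsStationaryLaw (moveGenerator r T) μ) {V : S → ℝ} (hV : ∀ M : ℝ, {x | V x < M}.Finite)
    (hri : ∀ i, Integrable (r i) μ) {f : S → ℝ} {C : ℝ} (hf : ∀ x, |f x| ≤ C) :
    ∫ x, moveGenerator r T f x ∂μ = 0 := by
  have hint : ∀ g : S → ℝ, (∀ x, |g x| ≤ 2 * C) →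
      Integrable (fun x => ∑ i, r i x * (|g (T i x)| + |g x|)) μ := by
    intro g hg
    refine Integrable.mono' (g := fun x => ∑ i, r i x * (2 * C + 2 * C))
      (integrable_finsetSum _ fun i _ => (hri i).mul_const _)
      Measurable.of_discrete.aestronglyMeasurable (Eventually.of_forall fun x => ?_)
    rw [Real.norm_of_nonneg (Finset.sum_nonneg fun i _ => mul_nonneg (hr i x) (by positivity))]
    exact Finset.sum_le_sum fun i _ => mul_le_mul_of_nonneg_left (add_le_add (hg _) (hg _)) (hr i x)
  have hb := fun x => abs_le.1 (hf x)
  have h1 : ∫ x, moveGenerator r T (fun x => C + f x) x ∂μ ≤ 0 :=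
    hμ.integral_nonpos hr hV (fun x => by linarith [(hb x).1])
      (hint (fun x => C + f x) fun x => abs_le.2 ⟨by linarith [(hb x).1, (hb x).2], by linarith [(hb x).1, (hb x).2]⟩)
  have h2 : ∫ x, moveGenerator r T (fun x => C - f x) x ∂μ ≤ 0 :=
    hμ.integral_nonpos hr hV (fun x => by linarith [(hb x).2])
      (hint (fun x => C - f x) fun x => abs_le.2 ⟨by linarith [(hb x).1, (hb x).2], by linarith [(hb x).1, (hb x).2]⟩)
  have e1 : moveGenerator r T (fun x => C + f x) = moveGenerator r T f := by
    ext x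
    simp [moveGenerator]
  have e2 : moveGenerator r T (fun x => C - f x) = fun x => -moveGenerator r T f x := by
    ext x
    simp only [moveGenerator, ← Finset.sum_neg_distrib]
    exact Finset.sum_congr rfl fun i _ => by ring
  rw [e1] at h1
  rw [e2, integral_neg] at h2
  linarith

/-- The stationary equation `∫ L f dμ = 0`, for functions `f` which are integrable against the
jump rates. -/
theorem IsStationaryLaw.integral_moveGenerator_eq_zero (hr : ∀ i x, 0 ≤ r i x)
    (hμ : IsStationaryLaw (moveGenerator r T) μ) {V : S → ℝ} (hV : ∀ M : ℝ, {x | V x < M}.Finite)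
    (hri : ∀ i, Integrable (r i) μ) {f : S → ℝ}
    (hf : Integrable (fun x => ∑ i, r i x * (|f (T i x)| + |f x|)) μ) :
    ∫ x, moveGenerator r T f x ∂μ = 0 := by
  refine tendsto_nhds_unique (tendsto_integral_moveGenerator_indicator hr V hf) ?_
  refine tendsto_const_nhds.congr fun k => Eq.symm ?_
  obtain ⟨C, hC⟩ := ((hV k).image fun x => |f x|).bddAbove
  refine hμ.integral_eq_zero_of_bounded hr hV hri (C := max C 0) fun x => ?_
  by_cases hx : V x < k
  · rw [Set.indicator_of_mem (by exact hx)]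
    exact (hC ⟨x, hx, rfl⟩).trans (le_max_left _ _)
  · rw [Set.indicator_of_notMem (by exact hx)]
    simp

end StationaryEquation

section LongTimeLimit

variable {S ι : Type*} [Fintype ι] {r : ι → S → ℝ} {T : ι → S → S}

open Classical in
theorem jumpTransProb_succ (hr : ∀ i x, 0 ≤ r i x) (n : ℕ) (t : ℝ) (x y : S) :
    jumpTransProb (moveGenerator r T) (n + 1) t x y = ∫⁻ s in Set.Icc 0 t,
      ENNReal.ofReal (Real.exp (-(exitRate (moveGenerator r T) x * s))) *
        ∑ i, if T i x = x then 0
          else ENNReal.ofReal (r i x) * jumpTransProb (moveGenerator r T) n (t - s) (T i x) y := by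
  simp only [jumpTransProb]
  refine lintegral_congr fun s => ?_
  rw [← tsum_jumpRate_mul hr x fun z => jumpTransProb (moveGenerator r T) n (t - s) z y]

theorem sum_lintegral_le {α κ : Type*} [MeasurableSpace α] (ν : Measure α) (A : Finset κ)
    (f : κ → α → ℝ≥0∞) : ∑ k ∈ A, ∫⁻ a, f k a ∂ν ≤ ∫⁻ a, ∑ k ∈ A, f k a ∂ν := by
  classical
  induction A using Finset.induction_on with
  | empty => simp
  | insert k A hk ih =>
    simp only [Finset.sum_insert hk]
    exact (add_le_add le_rfl ih).trans (le_lintegral_add _ _)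

theorem lintegral_exp_mul_exp (q c h t : ℝ) (ht : 0 ≤ t) (h0 : 0 ≤ (q - c) * h) :
    ∫⁻ s in Set.Icc 0 t, ENNReal.ofReal
      (Real.exp (-(q * s)) * (Real.exp (-(c * (t - s))) * ((q - c) * h))) =
      ENNReal.ofReal (h * Real.exp (-(c * t)) - h * Real.exp (-(q * t))) := by
  have hc : Continuous fun s : ℝ =>
      Real.exp (-(q * s)) * (Real.exp (-(c * (t - s))) * ((q - c) * h)) := by fun_prop
  rw [← ofReal_integral_eq_lintegral_ofReal (hc.integrableOn_Icc)
    (Eventually.of_forall fun s => by positivity), integral_Icc_eq_integral_Ioc,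
    ← intervalIntegral.integral_of_le ht]
  congr 1
  have hd : ∀ s : ℝ, HasDerivAt (fun s => -h * Real.exp (-(q * s) + -(c * (t - s))))
      (Real.exp (-(q * s)) * (Real.exp (-(c * (t - s))) * ((q - c) * h))) s := by
    intro s
    have h1 : HasDerivAt (fun s : ℝ => -(q * s) + -(c * (t - s))) (-q + c) s := by
      exact ((((hasDerivAt_id s).const_mul q).neg).add
        ((((hasDerivAt_id s).const_sub t).const_mul c).neg)).congr_deriv (by ring)
    refine (h1.exp.const_mul (-h)).congr_deriv ?_
    rw [Real.exp_add]
    ring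
  rw [intervalIntegral.integral_eq_sub_of_hasDerivAt (fun s _ => hd s)
    (hc.intervalIntegrable _ _)]
  simp
  ring

theorem sum_jumpTransProb_mul_le (hr : ∀ i x, 0 ≤ r i x) {h : S → ℝ} (h0 : ∀ x, 0 ≤ h x) {c : ℝ}
    (hL : ∀ x, moveGenerator r T h x ≤ -(c * h x)) (A : Finset S) (n : ℕ) :
    ∀ (t : ℝ) (_ : 0 ≤ t) (x : S), ∑ k ∈ Finset.range n, ∑ y ∈ A,
      jumpTransProb (moveGenerator r T) k t x y * ENNReal.ofReal (h y) ≤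
      ENNReal.ofReal (Real.exp (-(c * t)) * h x) := by
  classical
  induction n with
  | zero => simp
  | succ n ih =>
    intro t ht x
    set q := exitRate (moveGenerator r T) x with hq
    have hsum : ∑ i, (if T i x = x then 0 else r i x * h (T i x)) ≤ (q - c) * h x := by
      have : moveGenerator r T h x =
          ∑ i, (if T i x = x then 0 else r i x * h (T i x)) - q * h x := by
        rw [hq, exitRate_moveGenerator, Finset.sum_mul, ← Finset.sum_sub_distrib]
        refine Finset.sum_congr rfl fun i _ => ?_
        split_ifs with hi
        · simp [hi]
        · ring
      linarith [hL x]
    have hsum0 : 0 ≤ ∑ i, (if T i x = x then 0 else r i x * h (T i x)) :=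
      Finset.sum_nonneg fun i _ => by
        split_ifs
        · exact le_rfl
        · exact mul_nonneg (hr i x) (h0 _)
    rw [Finset.sum_range_succ']
    have hzero : ∑ y ∈ A, jumpTransProb (moveGenerator r T) 0 t x y * ENNReal.ofReal (h y) ≤
        ENNReal.ofReal (h x * Real.exp (-(q * t))) := by
      simp only [jumpTransProb, ite_mul, zero_mul, Finset.sum_ite_eq]
      split_ifs
      · rw [mul_comm, ENNReal.ofReal_mul (h0 x)]
      · exact zero_le
    have hsucc : ∑ k ∈ Finset.range n, ∑ y ∈ A,
        jumpTransProb (moveGenerator r T) (k + 1) t x y * ENNReal.ofReal (h y) ≤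
        ENNReal.ofReal (h x * Real.exp (-(c * t)) - h x * Real.exp (-(q * t))) := by
      rw [← lintegral_exp_mul_exp q c (h x) t ht (hsum0.trans hsum)]
      simp only [jumpTransProb_succ hr, ← lintegral_mul_const' _ _ ENNReal.ofReal_ne_top]
      refine (Finset.sum_le_sum fun k _ => sum_lintegral_le _ _ _).trans
        ((sum_lintegral_le _ _ _).trans (setLIntegral_mono' measurableSet_Icc fun s hs => ?_))
      have hs' : 0 ≤ t - s := sub_nonneg.2 hs.2
      rw [ENNReal.ofReal_mul (Real.exp_nonneg _)]
      simp only [mul_assoc, ← Finset.mul_sum]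
      refine mul_le_mul_right ?_ _
      calc _ = ∑ i, (if T i x = x then 0 else ENNReal.ofReal (r i x) *
            ∑ k ∈ Finset.range n, ∑ y ∈ A,
              jumpTransProb (moveGenerator r T) k (t - s) (T i x) y * ENNReal.ofReal (h y)) := by
            simp only [Finset.sum_mul]
            rw [Finset.sum_congr rfl fun k _ => Finset.sum_comm, Finset.sum_comm]
            refine Finset.sum_congr rfl fun i _ => ?_
            split_ifs with hi
            · simp
            · simp only [Finset.mul_sum, mul_assoc]
        _ ≤ ∑ i, (if T i x = x then 0 else ENNReal.ofReal (r i x) *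
            ENNReal.ofReal (Real.exp (-(c * (t - s))) * h (T i x))) := by
            refine Finset.sum_le_sum fun i _ => ?_
            split_ifs
            · exact le_rfl
            · exact mul_le_mul_right (ih _ hs' _) _
        _ = ENNReal.ofReal (Real.exp (-(c * (t - s))) *
            ∑ i, (if T i x = x then 0 else r i x * h (T i x))) := by
            rw [Finset.mul_sum, ENNReal.ofReal_sum_of_nonneg]
            · refine Finset.sum_congr rfl fun i _ => ?_
              split_ifs
              · simp
              · rw [← ENNReal.ofReal_mul (hr i x)]
                congr 1
                ring
            · intro i _
              split_ifs
              · simp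
              · exact mul_nonneg (Real.exp_nonneg _) (mul_nonneg (hr i x) (h0 _))
        _ ≤ _ := ENNReal.ofReal_le_ofReal (mul_le_mul_of_nonneg_left hsum (Real.exp_nonneg _))
    have hexp : h x * Real.exp (-(q * t)) ≤ h x * Real.exp (-(c * t)) := by
      rcases (h0 x).eq_or_lt with h1 | h1
      · simp [← h1]
      · refine mul_le_mul_of_nonneg_left (Real.exp_le_exp.2 ?_) h1.le
        have : 0 ≤ q - c := nonneg_of_mul_nonneg_left (hsum0.trans hsum) h1
        nlinarith
    refine (add_le_add hsucc hzero).trans ?_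
    rw [← ENNReal.ofReal_add (sub_nonneg.2 hexp) (mul_nonneg (h0 x) (Real.exp_nonneg _))]
    exact ENNReal.ofReal_le_ofReal (by linarith)

/-- A supersolution of the backward equation dominates the transition semigroup. -/
theorem transProb_mul_le (hr : ∀ i x, 0 ≤ r i x) {h : S → ℝ} (h0 : ∀ x, 0 ≤ h x) {c : ℝ}
    (hL : ∀ x, moveGenerator r T h x ≤ -(c * h x)) {t : ℝ} (ht : 0 ≤ t) (x y : S) :
    transProb (moveGenerator r T) t x y * ENNReal.ofReal (h y) ≤
      ENNReal.ofReal (Real.exp (-(c * t)) * h x) := by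
  rw [transProb, ← ENNReal.tsum_mul_right, ENNReal.tsum_eq_iSup_nat]
  refine iSup_le fun n => ?_
  simpa using sum_jumpTransProb_mul_le hr h0 hL {y} n t ht x

theorem transProb_le_one (hr : ∀ i x, 0 ≤ r i x) {t : ℝ} (ht : 0 ≤ t) (x y : S) :
    transProb (moveGenerator r T) t x y ≤ 1 := by
  simpa using transProb_mul_le hr (h := fun _ => 1) (c := 0) (fun _ => zero_le_one)
    (fun x => by simp [moveGenerator]) ht x y

theorem tendsto_transProb_zero (hr : ∀ i x, 0 ≤ r i x) {h : S → ℝ} (h0 : ∀ x, 0 ≤ h x) {c : ℝ}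
    (hc : 0 < c) (hL : ∀ x, moveGenerator r T h x ≤ -(c * h x)) (x : S) {y : S} (hy : 0 < h y) :
    Tendsto (fun t => transProb (moveGenerator r T) t x y) atTop (𝓝 0) := by
  have h1 : Tendsto (fun t : ℝ => ENNReal.ofReal (Real.exp (-(c * t)) * (h x / h y))) atTop
      (𝓝 0) := by
    rw [← ENNReal.ofReal_zero]
    refine ENNReal.tendsto_ofReal ?_
    have := (Real.tendsto_exp_neg_atTop_nhds_zero.comp
      (tendsto_id.const_mul_atTop hc)).mul_const (h x / h y)
    simpa using this
  refine tendsto_of_tendsto_of_tendsto_of_le_of_le' tendsto_const_nhds h1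
    (Eventually.of_forall fun _ => zero_le) ?_
  filter_upwards [eventually_ge_atTop 0] with t ht
  rw [← mul_div_assoc, ENNReal.ofReal_div_of_pos hy,
    ENNReal.le_div_iff_mul_le (Or.inl (by simpa using hy)) (Or.inl ENNReal.ofReal_ne_top)]
  exact transProb_mul_le hr h0 hL ht x y

theorem jumpTransProb_mono (hr : ∀ i x, 0 ≤ r i x) {y : S}
    (hy : exitRate (moveGenerator r T) y = 0) (n : ℕ) :
    ∀ x, Monotone fun t => jumpTransProb (moveGenerator r T) n t x y := by
  classical
  induction n with
  | zero =>
    intro x a b _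
    simp only [jumpTransProb]
    split_ifs with h
    · subst h
      simp [hy]
    · exact le_rfl
  | succ n ih =>
    intro x a b hab
    simp only [jumpTransProb_succ hr]
    refine (lintegral_mono_set (Set.Icc_subset_Icc_right hab)).trans (lintegral_mono fun s => ?_)
    refine mul_le_mul_right (Finset.sum_le_sum fun i _ => ?_) _
    split_ifs
    · exact le_rfl
    · exact mul_le_mul_right (ih _ (sub_le_sub_right hab s)) _

theorem transProb_mono (hr : ∀ i x, 0 ≤ r i x) {y : S}
    (hy : exitRate (moveGenerator r T) y = 0) (x : S) :
    Monotone fun t => transProb (moveGenerator r T) t x y :=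
  fun _ _ hab => ENNReal.tsum_le_tsum fun n => jumpTransProb_mono hr hy n x hab

theorem tendsto_limitProb_of_exitRate_eq_zero (hr : ∀ i x, 0 ≤ r i x) {y : S}
    (hy : exitRate (moveGenerator r T) y = 0) (x : S) :
    Tendsto (fun t => transProb (moveGenerator r T) t x y) atTop
      (𝓝 (limitProb (moveGenerator r T) x y)) :=
  tendsto_nhds_limUnder ⟨_, tendsto_atTop_iSup (transProb_mono hr hy x)⟩

theorem limitProb_le_one (hr : ∀ i x, 0 ≤ r i x) {y : S}
    (hy : exitRate (moveGenerator r T) y = 0) (x : S) :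
    limitProb (moveGenerator r T) x y ≤ 1 :=
  le_of_tendsto (tendsto_limitProb_of_exitRate_eq_zero hr hy x)
    ((eventually_ge_atTop 0).mono fun _ ht => transProb_le_one hr ht x y)

open Classical in
theorem transProb_eq_add_lintegral (hr : ∀ i x, 0 ≤ r i x) {y : S}
    (hy : exitRate (moveGenerator r T) y = 0) (t : ℝ) (x : S) :
    transProb (moveGenerator r T) t x y = (if x = y then 1 else 0) + ∫⁻ s in Set.Icc 0 t,
      ENNReal.ofReal (Real.exp (-(exitRate (moveGenerator r T) x * s))) *
        ∑ i, if T i x = x then 0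
          else ENNReal.ofReal (r i x) * transProb (moveGenerator r T) (t - s) (T i x) y := by
  have hm : ∀ n x, Measurable fun s => jumpTransProb (moveGenerator r T) n (t - s) x y :=
    fun n x => (jumpTransProb_mono hr hy n x).measurable.comp (by fun_prop)
  rw [transProb, tsum_eq_zero_add' ENNReal.summable]
  congr 1
  · simp only [jumpTransProb]
    split_ifs with h
    · simp [h, hy]
    · rfl
  · simp only [jumpTransProb_succ hr]
    rw [← lintegral_tsum]
    · refine lintegral_congr fun s => ?_
      rw [ENNReal.tsum_mul_left, Summable.tsum_finsetSum fun _ _ => ENNReal.summable]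
      congr 1
      refine Finset.sum_congr rfl fun i _ => ?_
      split_ifs with h
      · simp
      · rw [ENNReal.tsum_mul_left, transProb]
    · intro n
      refine Measurable.aemeasurable ?_
      refine Measurable.mul (by fun_prop) (Finset.measurable_sum _ fun i _ => ?_)
      split_ifs with h
      · exact measurable_const
      · exact (hm n _).const_mul _

theorem rate_eq_zero_of_exitRate_eq_zero (hr : ∀ i x, 0 ≤ r i x) {x : S}
    (hx : exitRate (moveGenerator r T) x = 0) {i : ι} (hi : T i x ≠ x) : r i x = 0 := by
  classical
  rw [exitRate_moveGenerator, Finset.sum_eq_zero_iff_of_nonneg] at hx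
  · simpa [hi] using hx i (Finset.mem_univ i)
  · intro i _
    split_ifs <;> simp [hr]

theorem transProb_of_exitRate_eq_zero (hr : ∀ i x, 0 ≤ r i x) {x : S}
    (hx : exitRate (moveGenerator r T) x = 0) (t : ℝ) (y : S) [Decidable (x = y)] :
    transProb (moveGenerator r T) t x y = if x = y then 1 else 0 := by
  classical
  rw [transProb, tsum_eq_single 0]
  · simp [jumpTransProb, hx]
  · intro n hn
    obtain ⟨n, rfl⟩ := Nat.exists_eq_succ_of_ne_zero hn
    rw [Nat.succ_eq_add_one, jumpTransProb_succ hr]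
    have : ∀ s, (∑ i, if T i x = x then 0 else ENNReal.ofReal (r i x) *
        jumpTransProb (moveGenerator r T) n (t - s) (T i x) y) = 0 := fun s =>
      Finset.sum_eq_zero fun i _ => by
        split_ifs with h
        · rfl
        · simp [rate_eq_zero_of_exitRate_eq_zero hr hx h]
    simp [this]

theorem limitProb_of_exitRate_eq_zero (hr : ∀ i x, 0 ≤ r i x) {x : S}
    (hx : exitRate (moveGenerator r T) x = 0) (y : S) [Decidable (x = y)] :
    limitProb (moveGenerator r T) x y = if x = y then 1 else 0 := by
  refine Tendsto.limUnder_eq ?_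
  simp only [transProb_of_exitRate_eq_zero hr hx]
  exact tendsto_const_nhds

/-- Limiting transition probabilities into an absorbing state are harmonic. -/
theorem moveGenerator_limitProb (hr : ∀ i x, 0 ≤ r i x) {y : S}
    (hy : exitRate (moveGenerator r T) y = 0) (x : S) :
    moveGenerator r T (fun x => (limitProb (moveGenerator r T) x y).toReal) x = 0 := by
  classical
  set a : S → ℝ := fun x => (limitProb (moveGenerator r T) x y).toReal with ha
  set q := exitRate (moveGenerator r T) x with hq
  have hqsum : q = ∑ i, if T i x = x then 0 else r i x := exitRate_moveGenerator x
  have hgen : moveGenerator r T a x =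
      ∑ i, (if T i x = x then 0 else r i x * a (T i x)) - q * a x := by
    rw [hqsum, Finset.sum_mul, ← Finset.sum_sub_distrib]
    refine Finset.sum_congr rfl fun i _ => ?_
    split_ifs with hi
    · simp [hi]
    · ring
  have hle := fun z => limitProb_le_one hr hy z
  have hfin : ∀ z, limitProb (moveGenerator r T) z y ≠ ⊤ := fun z =>
    ne_top_of_le_ne_top ENNReal.one_ne_top (hle z)
  have hq0 : 0 ≤ q := exitRate_nonneg hr x
  rcases hq0.eq_or_lt with h0 | hpos
  · refine Finset.sum_eq_zero fun i _ => ?_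
    by_cases h : T i x = x
    · simp [h]
    · simp [rate_eq_zero_of_exitRate_eq_zero hr h0.symm h]
  have hxy : x ≠ y := fun h => hpos.ne' (by rw [hq, h, hy])
  set Q : ℝ≥0∞ := ∑ i, if T i x = x then 0
    else ENNReal.ofReal (r i x) * limitProb (moveGenerator r T) (T i x) y with hQ
  have hQfin : Q ≠ ⊤ := by
    refine ENNReal.sum_ne_top.2 fun i _ => ?_
    split_ifs
    · simp
    · exact ENNReal.mul_ne_top ENNReal.ofReal_ne_top (hfin _)
  set f : ℕ → ℝ → ℝ≥0∞ := fun n => (Set.Icc (0 : ℝ) n).indicator fun s =>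
    ENNReal.ofReal (Real.exp (-(q * s))) * ∑ i, if T i x = x then 0
      else ENNReal.ofReal (r i x) * transProb (moveGenerator r T) (n - s) (T i x) y with hf
  have h1 : Tendsto (fun n : ℕ => ∫⁻ s, f n s) atTop
      (𝓝 (∫⁻ s, (Set.Ici (0 : ℝ)).indicator
        (fun s => ENNReal.ofReal (Real.exp (-(q * s))) * Q) s)) := by
    refine lintegral_tendsto_of_tendsto_of_monotone (fun n => ?_)
      (Eventually.of_forall fun s => ?_) (Eventually.of_forall fun s => ?_)
    · refine (Measurable.indicator ?_ measurableSet_Icc).aemeasurable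
      refine Measurable.mul (by fun_prop) (Finset.measurable_sum _ fun i _ => ?_)
      split_ifs with h
      · exact measurable_const
      · exact ((transProb_mono hr hy _).measurable.comp (by fun_prop)).const_mul _
    · intro m n hmn
      have hmn' : (m : ℝ) ≤ n := Nat.cast_le.2 hmn
      simp only [hf]
      refine (Set.indicator_le_indicator_of_subset (Set.Icc_subset_Icc_right hmn')
        (fun _ => zero_le) s).trans (Set.indicator_le_indicator ?_)
      refine mul_le_mul_right (Finset.sum_le_sum fun i _ => ?_) _
      split_ifs
      · exact le_rfl
      · exact mul_le_mul_right (transProb_mono hr hy _ (sub_le_sub_right hmn' s)) _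
    · by_cases hs : 0 ≤ s
      · have h2 : ∀ᶠ n : ℕ in atTop, f n s = ENNReal.ofReal (Real.exp (-(q * s))) *
            ∑ i, if T i x = x then 0
              else ENNReal.ofReal (r i x) * transProb (moveGenerator r T) (n - s) (T i x) y := by
          obtain ⟨m, hm⟩ := exists_nat_ge s
          filter_upwards [eventually_ge_atTop m] with n hn
          have hsn : s ∈ Set.Icc (0 : ℝ) n := ⟨hs, hm.trans (Nat.cast_le.2 hn)⟩
          exact Set.indicator_of_mem hsn _
        rw [Set.indicator_of_mem (by exact hs)]
        refine Tendsto.congr' (EventuallyEq.symm h2) ?_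
        refine ENNReal.Tendsto.const_mul (tendsto_finsetSum _ fun i _ => ?_)
          (Or.inr ENNReal.ofReal_ne_top)
        split_ifs
        · exact tendsto_const_nhds
        · refine ENNReal.Tendsto.const_mul ?_ (Or.inr ENNReal.ofReal_ne_top)
          exact (tendsto_limitProb_of_exitRate_eq_zero hr hy _).comp
            (tendsto_atTop_add_const_right _ (-s) tendsto_natCast_atTop_atTop)
      · rw [Set.indicator_of_notMem (by exact hs)]
        refine tendsto_const_nhds.congr fun n => ?_
        exact (Set.indicator_of_notMem (fun h => hs h.1) _).symm
  have h2 : ∀ n : ℕ, ∫⁻ s, f n s = transProb (moveGenerator r T) n x y := by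
    intro n
    rw [transProb_eq_add_lintegral hr hy, if_neg hxy, zero_add, ← lintegral_indicator
      measurableSet_Icc]
  have h3 : ∫⁻ s, (Set.Ici (0 : ℝ)).indicator
      (fun s => ENNReal.ofReal (Real.exp (-(q * s))) * Q) s = ENNReal.ofReal (1 / q) * Q := by
    rw [lintegral_indicator measurableSet_Ici, lintegral_mul_const' _ _ hQfin]
    congr 1
    have hint : IntegrableOn (fun s : ℝ => Real.exp (-(q * s))) (Set.Ioi 0) := by
      simpa using integrableOn_exp_mul_Ioi (neg_lt_zero.2 hpos) 0
    rw [setLIntegral_congr Ioi_ae_eq_Ici.symm, ← ofReal_integral_eq_lintegral_ofReal hint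
      (Eventually.of_forall fun s => Real.exp_nonneg _)]
    have := integral_exp_mul_Ioi (neg_lt_zero.2 hpos) 0
    simp only [neg_mul] at this
    rw [this]
    simp
  have h4 : limitProb (moveGenerator r T) x y = ENNReal.ofReal (1 / q) * Q := by
    rw [← h3]
    refine tendsto_nhds_unique ?_ h1
    simp only [h2]
    exact (tendsto_limitProb_of_exitRate_eq_zero hr hy x).comp tendsto_natCast_atTop_atTop
  have h5 : Q.toReal = ∑ i, (if T i x = x then 0 else r i x * a (T i x)) := by
    rw [hQ, ENNReal.toReal_sum]
    · refine Finset.sum_congr rfl fun i _ => ?_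
      split_ifs
      · rfl
      · rw [ENNReal.toReal_mul, ENNReal.toReal_ofReal (hr i x)]
    · intro i _
      split_ifs
      · simp
      · exact ENNReal.mul_ne_top ENNReal.ofReal_ne_top (hfin _)
  have h6 : a x = 1 / q * Q.toReal := by
    simp only [ha]
    rw [h4, ENNReal.toReal_mul, ENNReal.toReal_ofReal (by positivity)]
  rw [hgen, ← h5, h6]
  field_simp
  ring

/-- Uniqueness in the Dirichlet problem, for a process with finite conserved sectors. -/
theorem eq_zero_of_harmonic (hr : ∀ i x, 0 ≤ r i x) {h : S → ℝ} (h0 : ∀ x, 0 ≤ h x) {c : ℝ}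
    (hc : 0 < c) (hL : ∀ x, moveGenerator r T h x ≤ -(c * h x)) {κ : S → ℕ}
    (hκ : ∀ i x, r i x ≠ 0 → κ (T i x) = κ x) (hfin : ∀ n, {x | κ x = n}.Finite) {u : S → ℝ}
    (hu : ∀ x, moveGenerator r T u x = 0) (hu0 : ∀ x, h x = 0 → u x = 0) (x : S) : u x = 0 := by
  have key : ∀ u : S → ℝ, (∀ x, moveGenerator r T u x = 0) → (∀ x, h x = 0 → u x = 0) →
      ∀ x, u x ≤ 0 := by
    intro u hu hu0 x
    by_contra! hx
    have hhx : 0 < h x := (h0 x).lt_of_ne fun h' => hx.ne' (hu0 x h'.symm)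
    obtain ⟨z, ⟨hz1, hz2⟩, hz3⟩ := Set.exists_max_image {z | κ z = κ x ∧ 0 < h z}
      (fun z => u z / h z) ((hfin (κ x)).subset fun z hz => hz.1) ⟨x, rfl, hhx⟩
    have hm : 0 < u z / h z := (div_pos hx hhx).trans_le (hz3 x ⟨rfl, hhx⟩)
    have hle : ∀ w, κ w = κ x → u w ≤ u z / h z * h w := by
      intro w hw
      rcases (h0 w).eq_or_lt with h' | h'
      · rw [hu0 w h'.symm, ← h', mul_zero]
      · exact (div_le_iff₀ h').1 (hz3 w ⟨hw, h'⟩)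
    have h1 : moveGenerator r T u z ≤ u z / h z * moveGenerator r T h z := by
      rw [moveGenerator, moveGenerator, Finset.mul_sum]
      refine Finset.sum_le_sum fun i _ => ?_
      by_cases hi : r i z = 0
      · simp [hi]
      · have h2 := hle (T i z) ((hκ i z hi).trans hz1)
        have h3 : u z = u z / h z * h z := (div_mul_cancel₀ _ hz2.ne').symm
        calc r i z * (u (T i z) - u z) ≤ r i z * (u z / h z * h (T i z) - u z / h z * h z) :=
              mul_le_mul_of_nonneg_left (by linarith) (hr i z)
          _ = _ := by ring
    rw [hu z] at h1
    have h2 := hL z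
    have h3 : 0 < c * h z := mul_pos hc hz2
    nlinarith
  refine le_antisymm (key u hu hu0 x) ?_
  have := key (fun x => -u x) (fun x => ?_) (fun x hx => by simp [hu0 x hx]) x
  · simpa using this
  · rw [← neg_eq_zero, ← hu x, moveGenerator, moveGenerator, ← Finset.sum_neg_distrib]
    exact Finset.sum_congr rfl fun i _ => by ring

end LongTimeLimit

section Moves

variable {N : ℕ} {G : Geometry N} {σ : SignType}

theorem Config.orElse_val (η : Config G σ) {f : Fin N → ℕ} (h : σ = -1 → ∀ x, f x ≤ G.α x) :
    (η.orElse f).1 = f := by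
  rw [Config.orElse, dif_pos h]

theorem Config.lt_of_ne_zero (η : Config G σ) (y : Fin N)
    (h : (G.α y : ℝ) + (σ : ℝ) * (η.1 y : ℝ) ≠ 0) (hσ : σ = -1) : η.1 y < G.α y := by
  refine lt_of_le_of_ne (η.2 hσ y) fun h' => h ?_
  subst hσ
  simp [h']

theorem Config.nonneg_add (η : Config G σ) (y : Fin N) :
    0 ≤ (G.α y : ℝ) + (σ : ℝ) * (η.1 y : ℝ) := by
  rcases σ with _ | _ | _
  · change 0 ≤ (G.α y : ℝ) + ((0 : SignType) : ℝ) * (η.1 y : ℝ)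
    simp
  · change 0 ≤ (G.α y : ℝ) + ((-1 : SignType) : ℝ) * (η.1 y : ℝ)
    have : (η.1 y : ℝ) ≤ G.α y := Nat.cast_le.2 (η.2 rfl y)
    simp [this]
  · change 0 ≤ (G.α y : ℝ) + ((1 : SignType) : ℝ) * (η.1 y : ℝ)
    simp only [SignType.coe_one, one_mul]
    positivity

theorem Config.add_le (η : Config G σ) (y : Fin N) :
    (G.α y : ℝ) + (σ : ℝ) * (η.1 y : ℝ) ≤ G.α y + η.1 y := by
  have h : (0 : ℝ) ≤ η.1 y := Nat.cast_nonneg _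
  rcases σ with _ | _ | _
  · change (G.α y : ℝ) + ((0 : SignType) : ℝ) * (η.1 y : ℝ) ≤ _
    simp
  · change (G.α y : ℝ) + ((-1 : SignType) : ℝ) * (η.1 y : ℝ) ≤ _
    simp only [SignType.coe_neg, SignType.coe_one]
    linarith
  · change (G.α y : ℝ) + ((1 : SignType) : ℝ) * (η.1 y : ℝ) ≤ _
    simp

theorem Config.hop_val (η : Config G σ) {x y : Fin N} (hx : η.1 x ≠ 0)
    (hy : (G.α y : ℝ) + (σ : ℝ) * (η.1 y : ℝ) ≠ 0) :
    (η.hop x y).1 = η.1 - Pi.single x 1 + Pi.single y 1 := by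
  rw [Config.hop, if_neg hx, Config.orElse_val]
  intro hσ z
  have h1 := η.2 hσ z
  have h2 := η.lt_of_ne_zero y hy hσ
  by_cases hz : z = y
  · subst hz
    simp only [Pi.add_apply, Pi.sub_apply, Pi.single_eq_same]
    omega
  · simp only [Pi.add_apply, Pi.sub_apply, Pi.single_eq_of_ne hz]
    omega

theorem Config.remove_val (η : Config G σ) (x : Fin N) :
    (η.remove x).1 = η.1 - Pi.single x 1 := by
  rw [Config.remove, Config.orElse_val]
  intro hσ z
  exact (Nat.sub_le _ _).trans (η.2 hσ z)

theorem Config.add_val (η : Config G σ) {x : Fin N}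
    (hx : (G.α x : ℝ) + (σ : ℝ) * (η.1 x : ℝ) ≠ 0) :
    (η.add x).1 = η.1 + Pi.single x 1 := by
  rw [Config.add, Config.orElse_val]
  intro hσ z
  have h1 := η.2 hσ z
  have h2 := η.lt_of_ne_zero x hx hσ
  by_cases hz : z = x
  · subst hz
    simp only [Pi.add_apply, Pi.single_eq_same]
    omega
  · simp only [Pi.add_apply, Pi.single_eq_of_ne hz]
    omega

theorem Config.mul_hop (η : Config G σ) (x y : Fin N) (φ : (Fin N → ℕ) → ℝ) :
    (η.1 x : ℝ) * ((G.α y : ℝ) + (σ : ℝ) * (η.1 y : ℝ)) * φ (η.hop x y).1 =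
      (η.1 x : ℝ) * ((G.α y : ℝ) + (σ : ℝ) * (η.1 y : ℝ)) *
        φ (η.1 - Pi.single x 1 + Pi.single y 1) := by
  by_cases hx : η.1 x = 0
  · simp [hx]
  by_cases hy : (G.α y : ℝ) + (σ : ℝ) * (η.1 y : ℝ) = 0
  · simp [hy]
  rw [η.hop_val hx hy]

theorem Config.mul_add (η : Config G σ) (x : Fin N) (φ : (Fin N → ℕ) → ℝ) :
    ((G.α x : ℝ) + (σ : ℝ) * (η.1 x : ℝ)) * φ (η.add x).1 =
      ((G.α x : ℝ) + (σ : ℝ) * (η.1 x : ℝ)) * φ (η.1 + Pi.single x 1) := by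
  by_cases hy : (G.α x : ℝ) + (σ : ℝ) * (η.1 x : ℝ) = 0
  · simp [hy]
  rw [η.add_val hy]

/-- The linear functional `∑ x, v x * f x` of occupation numbers. -/
def linearStat (v : Fin N → ℝ) (f : Fin N → ℕ) : ℝ :=
  ∑ x, v x * (f x : ℝ)

theorem linearStat_add_single (v : Fin N → ℝ) (f : Fin N → ℕ) (x : Fin N) :
    linearStat v (f + Pi.single x 1) = linearStat v f + v x := by
  simp only [linearStat, Pi.add_apply, Nat.cast_add, _root_.mul_add, Finset.sum_add_distrib]
  rw [Finset.sum_eq_single (a := x) (f := fun i => v i * ((Pi.single x 1 : Fin N → ℕ) i : ℝ))]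
  · simp
  · intro z _ hz
    simp [hz]
  · simp

theorem linearStat_sub_single (v : Fin N → ℝ) {f : Fin N → ℕ} {x : Fin N} (hx : f x ≠ 0) :
    linearStat v (f - Pi.single x 1) = linearStat v f - v x := by
  have h : f - Pi.single x 1 + Pi.single x 1 = f := by
    ext z
    by_cases hz : z = x
    · subst hz
      simp only [Pi.add_apply, Pi.sub_apply, Pi.single_eq_same]
      omega
    · simp [hz]
  conv_rhs => rw [← h, linearStat_add_single]
  ring

theorem Config.mul_hop_linearStat (η : Config G σ) (x y : Fin N) (v : Fin N → ℝ) (Φ : ℝ → ℝ) :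
    (η.1 x : ℝ) * ((G.α y : ℝ) + (σ : ℝ) * (η.1 y : ℝ)) * Φ (linearStat v (η.hop x y).1) =
      (η.1 x : ℝ) * ((G.α y : ℝ) + (σ : ℝ) * (η.1 y : ℝ)) *
        Φ (linearStat v η.1 + (v y - v x)) := by
  rw [η.mul_hop x y fun f => Φ (linearStat v f)]
  by_cases hx : η.1 x = 0
  · simp [hx]
  rw [linearStat_add_single, linearStat_sub_single v hx]
  congr 2
  ring

theorem Config.mul_remove_linearStat (η : Config G σ) (x : Fin N) (v : Fin N → ℝ) (Φ : ℝ → ℝ) :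
    (η.1 x : ℝ) * Φ (linearStat v (η.remove x).1) =
      (η.1 x : ℝ) * Φ (linearStat v η.1 + -v x) := by
  by_cases hx : η.1 x = 0
  · simp [hx]
  rw [η.remove_val, linearStat_sub_single v hx, sub_eq_add_neg]

theorem Config.mul_add_linearStat (η : Config G σ) (x : Fin N) (v : Fin N → ℝ) (Φ : ℝ → ℝ) :
    ((G.α x : ℝ) + (σ : ℝ) * (η.1 x : ℝ)) * Φ (linearStat v (η.add x).1) =
      ((G.α x : ℝ) + (σ : ℝ) * (η.1 x : ℝ)) * Φ (linearStat v η.1 + v x) := by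
  rw [η.mul_add x fun f => Φ (linearStat v f), linearStat_add_single]

/-! ### The generators as generators of jump processes -/

/-- Rates of the bulk jumps. -/
def bulkRate (G : Geometry N) (σ : SignType) (p : Fin N × Fin N) (η : Config G σ) : ℝ :=
  G.ω p.1 p.2 * ((η.1 p.1 : ℝ) * ((G.α p.2 : ℝ) + (σ : ℝ) * (η.1 p.2 : ℝ)))

theorem bulkRate_nonneg (p : Fin N × Fin N) (η : Config G σ) : 0 ≤ bulkRate G σ p η :=
  mul_nonneg (G.ω_nonneg _ _) (mul_nonneg (Nat.cast_nonneg _) (η.nonneg_add _))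

theorem bulkGenerator_eq (f : Config G σ → ℝ) (η : Config G σ) :
    bulkGenerator G σ f η = ∑ p, bulkRate G σ p η * (f (η.hop p.1 p.2) - f η) := by
  rw [bulkGenerator, Fintype.sum_prod_type]
  simp only [bulkRate]
  exact Finset.sum_congr rfl fun x _ => Finset.sum_congr rfl fun y _ => by ring

variable [NeZero N]

/-- Rates of the moves of the boundary driven particle system. -/
def particleRate (G : Geometry N) (σ : SignType) (θL θR : ℝ) :
    (Fin N × Fin N) ⊕ Fin 4 → Config G σ → ℝ :=
  Sum.elim (bulkRate G σ)
    ![fun η => G.ωL * ((η.1 (firstSite N) : ℝ) * (G.αL + (σ : ℝ) * G.αL * θL)),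
      fun η => G.ωL * (G.αL * θL *
        ((G.α (firstSite N) : ℝ) + (σ : ℝ) * (η.1 (firstSite N) : ℝ))),
      fun η => G.ωR * ((η.1 (lastSite N) : ℝ) * (G.αR + (σ : ℝ) * G.αR * θR)),
      fun η => G.ωR * (G.αR * θR *
        ((G.α (lastSite N) : ℝ) + (σ : ℝ) * (η.1 (lastSite N) : ℝ)))]

/-- Moves of the boundary driven particle system. -/
def particleMove (G : Geometry N) (σ : SignType) :
    (Fin N × Fin N) ⊕ Fin 4 → Config G σ → Config G σ :=
  Sum.elim (fun p η => η.hop p.1 p.2)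
    ![fun η => η.remove (firstSite N), fun η => η.add (firstSite N),
      fun η => η.remove (lastSite N), fun η => η.add (lastSite N)]

theorem generator_eq_moveGenerator (θL θR : ℝ) :
    generator G σ θL θR = moveGenerator (particleRate G σ θL θR) (particleMove G σ) := by
  ext f η
  simp only [generator, bulkGenerator_eq, reservoirGenerator, moveGenerator,
    Fintype.sum_sum_type, Fin.sum_univ_four, particleRate, particleMove, Sum.elim_inl,
    Sum.elim_inr, Matrix.cons_val]
  ring

theorem scaleRange_nonneg {θ : ℝ} (h : θ ∈ scaleRange σ) : 0 ≤ θ := by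
  unfold scaleRange at h
  split_ifs at h
  · exact h.1
  · exact h

theorem one_add_sign_mul_nonneg {θ : ℝ} (h : θ ∈ scaleRange σ) : 0 ≤ 1 + (σ : ℝ) * θ := by
  have h0 := scaleRange_nonneg h
  rcases σ with _ | _ | _
  · change 0 ≤ 1 + ((0 : SignType) : ℝ) * θ
    simp
  · change 0 ≤ 1 + ((-1 : SignType) : ℝ) * θ
    have h1 : θ ∈ Set.Icc (0 : ℝ) 1 := by
      unfold scaleRange at h
      rwa [if_pos (by rfl)] at h
    simpa using h1.2
  · change 0 ≤ 1 + ((1 : SignType) : ℝ) * θ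
    simp only [SignType.coe_one]
    linarith

theorem particleRate_nonneg {θL θR : ℝ} (hθL : θL ∈ scaleRange σ) (hθR : θR ∈ scaleRange σ)
    (i : (Fin N × Fin N) ⊕ Fin 4) (η : Config G σ) : 0 ≤ particleRate G σ θL θR i η := by
  have h1 : ∀ a θ : ℝ, 0 < a → θ ∈ scaleRange σ → 0 ≤ a + (σ : ℝ) * a * θ := fun a θ ha hθ => by
    have := mul_nonneg ha.le (one_add_sign_mul_nonneg hθ)
    linarith
  rcases i with p | i
  · exact bulkRate_nonneg p η
  · fin_cases i
    · exact mul_nonneg G.ωL_nonneg (mul_nonneg (Nat.cast_nonneg _) (h1 _ _ G.αL_pos hθL))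
    · exact mul_nonneg G.ωL_nonneg (mul_nonneg (mul_nonneg G.αL_pos.le (scaleRange_nonneg hθL))
        (η.nonneg_add _))
    · exact mul_nonneg G.ωR_nonneg (mul_nonneg (Nat.cast_nonneg _) (h1 _ _ G.αR_pos hθR))
    · exact mul_nonneg G.ωR_nonneg (mul_nonneg (mul_nonneg G.αR_pos.le (scaleRange_nonneg hθR))
        (η.nonneg_add _))

/-- Rates of the moves of the dual system. -/
def dualRate (G : Geometry N) (σ : SignType) :
    (Fin N × Fin N) ⊕ Fin 2 → DualConfig G σ → ℝ :=
  Sum.elim (fun p ξ => bulkRate G σ p ξ.1)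
    ![fun ξ => G.ωL * G.αL * (ξ.1.1 (firstSite N) : ℝ),
      fun ξ => G.ωR * G.αR * (ξ.1.1 (lastSite N) : ℝ)]

/-- Moves of the dual system. -/
def dualMove (G : Geometry N) (σ : SignType) :
    (Fin N × Fin N) ⊕ Fin 2 → DualConfig G σ → DualConfig G σ :=
  Sum.elim (fun p ξ => (ξ.1.hop p.1 p.2, ξ.2))
    ![fun ξ => (ξ.1.remove (firstSite N), ξ.2.1 + 1, ξ.2.2),
      fun ξ => (ξ.1.remove (lastSite N), ξ.2.1, ξ.2.2 + 1)]

theorem dualGenerator_eq_moveGenerator :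
    dualGenerator G σ = moveGenerator (dualRate G σ) (dualMove G σ) := by
  ext f ξ
  simp only [dualGenerator, bulkGenerator_eq, moveGenerator,
    Fintype.sum_sum_type, Fin.sum_univ_two, dualRate, dualMove, Sum.elim_inl,
    Sum.elim_inr, Matrix.cons_val]

theorem dualRate_nonneg (i : (Fin N × Fin N) ⊕ Fin 2) (ξ : DualConfig G σ) :
    0 ≤ dualRate G σ i ξ := by
  rcases i with p | i
  · exact bulkRate_nonneg p ξ.1
  · fin_cases i
    · exact mul_nonneg (mul_nonneg G.ωL_nonneg G.αL_pos.le) (Nat.cast_nonneg _)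
    · exact mul_nonneg (mul_nonneg G.ωR_nonneg G.αR_pos.le) (Nat.cast_nonneg _)

/-! ### Drift of linear functionals -/

omit [NeZero N] in
theorem bulkGenerator_linearStat (v : Fin N → ℝ) (η : Config G σ) :
    bulkGenerator G σ (fun η => linearStat v η.1) η =
      ∑ x, (η.1 x : ℝ) * ∑ y, G.ω x y * (G.α y : ℝ) * (v y - v x) := by
  have h1 : bulkGenerator G σ (fun η => linearStat v η.1) η =
      ∑ x, ∑ y, G.ω x y * ((η.1 x : ℝ) * ((G.α y : ℝ) + (σ : ℝ) * (η.1 y : ℝ)) *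
        (v y - v x)) := by
    refine Finset.sum_congr rfl fun x _ => Finset.sum_congr rfl fun y _ => ?_
    have := η.mul_hop_linearStat x y v id
    simp only [id] at this
    linear_combination G.ω x y * this
  have h2 : ∑ x, ∑ y, G.ω x y * ((η.1 x : ℝ) * ((σ : ℝ) * (η.1 y : ℝ)) * (v y - v x)) = 0 := by
    have h3 : ∑ x, ∑ y, G.ω x y * ((η.1 x : ℝ) * ((σ : ℝ) * (η.1 y : ℝ)) * (v y - v x)) =
        -∑ x, ∑ y, G.ω x y * ((η.1 x : ℝ) * ((σ : ℝ) * (η.1 y : ℝ)) * (v y - v x)) := by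
      conv_lhs => rw [Finset.sum_comm]
      simp only [← Finset.sum_neg_distrib]
      refine Finset.sum_congr rfl fun x _ => Finset.sum_congr rfl fun y _ => ?_
      rw [G.ω_symm y x]
      ring
    linarith
  rw [h1, ← sub_zero (∑ x, ∑ y, _), ← h2, ← Finset.sum_sub_distrib]
  refine Finset.sum_congr rfl fun x _ => ?_
  rw [← Finset.sum_sub_distrib, Finset.mul_sum]
  exact Finset.sum_congr rfl fun y _ => by ring

/-- Rate at which a dual particle at `x` is absorbed. -/
def killRate (G : Geometry N) (x : Fin N) : ℝ :=
  (if x = firstSite N then G.ωL * G.αL else 0) + if x = lastSite N then G.ωR * G.αR else 0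

theorem killRate_nonneg (x : Fin N) : 0 ≤ killRate G x := by
  have h1 := mul_nonneg G.ωL_nonneg G.αL_pos.le
  have h2 := mul_nonneg G.ωR_nonneg G.αR_pos.le
  unfold killRate
  split_ifs <;> linarith

theorem sum_mul_killRate (f : Fin N → ℝ) :
    ∑ x, f x * killRate G x = f (firstSite N) * (G.ωL * G.αL) + f (lastSite N) * (G.ωR * G.αR) := by
  simp [killRate, _root_.mul_add, Finset.sum_add_distrib]

theorem exists_killRate_pos (hres : 0 < max G.ωL G.ωR) : ∃ x, 0 < killRate G x := by
  have h1 := mul_nonneg G.ωL_nonneg G.αL_pos.le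
  have h2 := mul_nonneg G.ωR_nonneg G.αR_pos.le
  rcases lt_max_iff.1 hres with h | h
  · refine ⟨firstSite N, ?_⟩
    have := mul_pos h G.αL_pos
    unfold killRate
    split_ifs <;> first | linarith | contradiction
  · refine ⟨lastSite N, ?_⟩
    have := mul_pos h G.αR_pos
    unfold killRate
    split_ifs <;> first | linarith | contradiction

theorem dualGenerator_linearStat (v : Fin N → ℝ) (ξ : DualConfig G σ) :
    dualGenerator G σ (fun ξ => linearStat v ξ.1.1) ξ =
      ∑ x, (ξ.1.1 x : ℝ) * (∑ y, G.ω x y * (G.α y : ℝ) * (v y - v x) - killRate G x * v x) := by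
  simp only [_root_.mul_sub, Finset.sum_sub_distrib]
  have h := sum_mul_killRate (G := G) fun x => (ξ.1.1 x : ℝ) * v x
  have h' : ∑ x, (ξ.1.1 x : ℝ) * (killRate G x * v x) =
      ∑ x, (ξ.1.1 x : ℝ) * v x * killRate G x := Finset.sum_congr rfl fun x _ => by ring
  have h3 := ξ.1.mul_remove_linearStat (firstSite N) v id
  have h4 := ξ.1.mul_remove_linearStat (lastSite N) v id
  simp only [id] at h3 h4
  simp only [dualGenerator]
  rw [bulkGenerator_linearStat, h', h]
  simp only [_root_.mul_sub, Finset.sum_sub_distrib]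
  linear_combination G.ωL * G.αL * h3 + G.ωR * G.αR * h4

end Moves

section Lyapunov

variable {N : ℕ} [NeZero N] {G : Geometry N} {σ : SignType}

/-- Generator of a single dual particle killed at the reservoirs. -/
def killedGenerator (G : Geometry N) : (Fin N → ℝ) →ₗ[ℝ] (Fin N → ℝ) where
  toFun v x := ∑ y, G.ω x y * (G.α y : ℝ) * (v y - v x) - killRate G x * v x
  map_add' v w := by
    ext x
    simp only [Pi.add_apply]
    rw [show ∑ y, G.ω x y * (G.α y : ℝ) * (v y + w y - (v x + w x)) =
      ∑ y, G.ω x y * (G.α y : ℝ) * (v y - v x) + ∑ y, G.ω x y * (G.α y : ℝ) * (w y - w x) by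
        rw [← Finset.sum_add_distrib]
        exact Finset.sum_congr rfl fun y _ => by ring]
    ring
  map_smul' c v := by
    ext x
    simp only [Pi.smul_apply, smul_eq_mul, RingHom.id_apply, _root_.mul_sub, Finset.mul_sum]
    congr 1
    · exact Finset.sum_congr rfl fun y _ => by ring
    · ring

theorem killedGenerator_apply (v : Fin N → ℝ) (x : Fin N) : killedGenerator G v x =
    ∑ y, G.ω x y * (G.α y : ℝ) * (v y - v x) - killRate G x * v x := rfl

theorem killedGenerator_energy (u : Fin N → ℝ) :
    2 * ∑ x, (G.α x : ℝ) * u x * killedGenerator G u x =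
      -(∑ x, ∑ y, G.ω x y * (G.α x : ℝ) * (G.α y : ℝ) * (u y - u x) ^ 2 +
        2 * ∑ x, (G.α x : ℝ) * killRate G x * u x ^ 2) := by
  have h1 : ∑ x, (G.α x : ℝ) * u x * killedGenerator G u x =
      ∑ x, ∑ y, G.ω x y * (G.α x : ℝ) * (G.α y : ℝ) * (u x * (u y - u x)) -
        ∑ x, (G.α x : ℝ) * killRate G x * u x ^ 2 := by
    rw [← Finset.sum_sub_distrib]
    refine Finset.sum_congr rfl fun x _ => ?_
    rw [killedGenerator_apply, _root_.mul_sub, Finset.mul_sum]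
    congr 1
    · exact Finset.sum_congr rfl fun y _ => by ring
    · ring
  have h2 : ∑ x, ∑ y, G.ω x y * (G.α x : ℝ) * (G.α y : ℝ) * (u x * (u y - u x)) =
      ∑ x, ∑ y, G.ω x y * (G.α x : ℝ) * (G.α y : ℝ) * (u y * (u x - u y)) := by
    rw [Finset.sum_comm]
    refine Finset.sum_congr rfl fun x _ => Finset.sum_congr rfl fun y _ => ?_
    rw [G.ω_symm y x]
    ring
  have h3 : ∑ x, ∑ y, G.ω x y * (G.α x : ℝ) * (G.α y : ℝ) * (u y - u x) ^ 2 =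
      -(∑ x, ∑ y, G.ω x y * (G.α x : ℝ) * (G.α y : ℝ) * (u x * (u y - u x)) +
        ∑ x, ∑ y, G.ω x y * (G.α x : ℝ) * (G.α y : ℝ) * (u y * (u x - u y))) := by
    simp only [← Finset.sum_add_distrib, ← Finset.sum_neg_distrib]
    exact Finset.sum_congr rfl fun x _ => Finset.sum_congr rfl fun y _ => by ring
  rw [h1, h3, ← h2]
  ring

theorem killedGenerator_injective (hres : 0 < max G.ωL G.ωR) :
    Function.Injective (killedGenerator G) := by
  refine (injective_iff_map_eq_zero _).2 fun u hu => ?_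
  have hα : ∀ x, (0 : ℝ) < G.α x := fun x => Nat.cast_pos.2 (G.α_pos x)
  have he := killedGenerator_energy (G := G) u
  simp only [hu, Pi.zero_apply, mul_zero, Finset.sum_const_zero] at he
  have t1 : ∀ x y, 0 ≤ G.ω x y * (G.α x : ℝ) * (G.α y : ℝ) * (u y - u x) ^ 2 := fun x y =>
    mul_nonneg (mul_nonneg (mul_nonneg (G.ω_nonneg x y) (hα x).le) (hα y).le) (sq_nonneg _)
  have t2 : ∀ x, 0 ≤ (G.α x : ℝ) * killRate G x * u x ^ 2 := fun x =>
    mul_nonneg (mul_nonneg (hα x).le (killRate_nonneg x)) (sq_nonneg _)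
  have s1 : 0 ≤ ∑ x, ∑ y, G.ω x y * (G.α x : ℝ) * (G.α y : ℝ) * (u y - u x) ^ 2 :=
    Finset.sum_nonneg fun x _ => Finset.sum_nonneg fun y _ => t1 x y
  have s2 : 0 ≤ ∑ x, (G.α x : ℝ) * killRate G x * u x ^ 2 := Finset.sum_nonneg fun x _ => t2 x
  have z1 : ∑ x, ∑ y, G.ω x y * (G.α x : ℝ) * (G.α y : ℝ) * (u y - u x) ^ 2 = 0 := by linarith
  have z2 : ∑ x, (G.α x : ℝ) * killRate G x * u x ^ 2 = 0 := by linarith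
  have e1 : ∀ x y, G.ω x y ≠ 0 → u y = u x := by
    intro x y hxy
    have h1 := (Finset.sum_eq_zero_iff_of_nonneg
      (fun x _ => Finset.sum_nonneg fun y _ => t1 x y)).1 z1 x (Finset.mem_univ x)
    have h2 := (Finset.sum_eq_zero_iff_of_nonneg (fun y _ => t1 x y)).1 h1 y (Finset.mem_univ y)
    have h3 : (u y - u x) ^ 2 = 0 := by
      simpa [hxy, (hα x).ne', (hα y).ne', -pow_eq_zero_iff,
        (G.α_pos x).ne', (G.α_pos y).ne'] using h2
    exact sub_eq_zero.1 (pow_eq_zero_iff two_ne_zero |>.1 h3)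
  obtain ⟨x₀, hx₀⟩ := exists_killRate_pos hres
  have e2 : u x₀ = 0 := by
    have h2 := (Finset.sum_eq_zero_iff_of_nonneg (fun y _ => t2 y)).1 z2 x₀ (Finset.mem_univ x₀)
    have h3 : 0 < (G.α x₀ : ℝ) * killRate G x₀ := mul_pos (hα x₀) hx₀
    exact pow_eq_zero_iff two_ne_zero |>.1 ((mul_eq_zero.1 h2).resolve_left h3.ne')
  ext x
  have hreach := G.connected.preconnected x₀ x
  rw [SimpleGraph.reachable_iff_reflTransGen] at hreach
  change u x = 0
  induction hreach with
  | refl => exact e2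
  | tail _ hadj ih =>
    rcases hadj.2 with h | h
    · rw [e1 _ _ h, ih]
    · rw [← e1 _ _ h, ih]

/-- A strictly superharmonic function which is almost constant. -/
theorem exists_slow_superharmonic (hres : 0 < max G.ωL G.ωR) :
    ∃ B : ℝ, 0 ≤ B ∧ ∀ ε : ℝ, 0 < ε → ε * B ≤ 1 → ∃ v : Fin N → ℝ, (∀ x, 1 ≤ v x) ∧
      (∀ x, v x ≤ 3) ∧ (∀ x y, (v y - v x) ^ 2 ≤ 4 * (ε * B) ^ 2) ∧
      ∀ x, killedGenerator G v x ≤ -ε := by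
  obtain ⟨u, hu⟩ := LinearMap.injective_iff_surjective.1 (killedGenerator_injective hres)
    (fun _ => -1)
  have hB : ∀ x, |u x| ≤ ∑ z, |u z| := fun x =>
    Finset.single_le_sum (f := fun z => |u z|) (fun z _ => abs_nonneg _) (Finset.mem_univ x)
  refine ⟨∑ z, |u z|, Finset.sum_nonneg fun _ _ => abs_nonneg _, fun ε hε hεB =>
    ⟨fun x => 2 + ε * u x, fun x => ?_, fun x => ?_, fun x y => ?_, fun x => ?_⟩⟩
  · have := mul_le_mul_of_nonneg_left ((neg_abs_le (u x)).trans' (neg_le_neg (hB x))) hε.le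
    linarith
  · have := mul_le_mul_of_nonneg_left ((le_abs_self (u x)).trans (hB x)) hε.le
    linarith
  · have h1 : |u y - u x| ≤ 2 * ∑ z, |u z| := by
      linarith [abs_sub (u y) (u x), hB x, hB y]
    have h2 : (u y - u x) ^ 2 ≤ (2 * ∑ z, |u z|) ^ 2 := sq_le_sq' (by linarith [(abs_le.1 h1).1])
      (abs_le.1 h1).2
    nlinarith [mul_le_mul_of_nonneg_left h2 (sq_nonneg ε)]
  · have h1 := congrFun hu x
    rw [killedGenerator_apply] at h1 ⊢
    have h2 : ∑ y, G.ω x y * (G.α y : ℝ) * (2 + ε * u y - (2 + ε * u x)) =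
        ε * ∑ y, G.ω x y * (G.α y : ℝ) * (u y - u x) := by
      rw [Finset.mul_sum]
      exact Finset.sum_congr rfl fun y _ => by ring
    rw [h2]
    have := killRate_nonneg (G := G) x
    nlinarith

theorem exists_pow_add_le (n : ℕ) : ∃ C : ℝ, 0 ≤ C ∧ ∀ W δ : ℝ, |δ| ≤ W →
    (W + δ) ^ (n + 2) ≤ W ^ (n + 2) + (n + 2) * δ * W ^ (n + 1) + C * δ ^ 2 * W ^ n := by
  induction n with
  | zero =>
    refine ⟨1, zero_le_one, fun W δ _ => le_of_eq ?_⟩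
    simp
    ring
  | succ n ih =>
    obtain ⟨C, hC, h⟩ := ih
    refine ⟨2 * C + n + 2, by positivity, fun W δ hδ => ?_⟩
    have hW : 0 ≤ W := (abs_nonneg δ).trans hδ
    have h1 := (abs_le.1 hδ)
    have h2 := mul_le_mul_of_nonneg_right (h W δ hδ) (by linarith : 0 ≤ W + δ)
    have h3 : 0 ≤ C * δ ^ 2 * W ^ n * (W - δ) :=
      mul_nonneg (by positivity) (by linarith)
    calc (W + δ) ^ (n + 1 + 2) = (W + δ) ^ (n + 2) * (W + δ) := by ring
      _ ≤ _ := h2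
      _ ≤ _ := by
        push_cast
        linear_combination h3

/-- Total number of particles. -/
def mass (η : Config G σ) : ℝ := ∑ x, (η.1 x : ℝ)

omit [NeZero N] in
theorem mass_nonneg (η : Config G σ) : 0 ≤ mass η := Finset.sum_nonneg fun _ _ => Nat.cast_nonneg _

omit [NeZero N] in
theorem le_mass (η : Config G σ) (x : Fin N) : (η.1 x : ℝ) ≤ mass η :=
  Finset.single_le_sum (f := fun x => (η.1 x : ℝ)) (fun _ _ => Nat.cast_nonneg _)
    (Finset.mem_univ x)

omit [NeZero N] in
theorem finite_mass_lt (M : ℝ) : {η : Config G σ | mass η < M}.Finite := by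
  refine Set.Finite.of_finite_image (f := Subtype.val)
    ((Set.finite_Iic (fun _ => ⌈M⌉₊ : Fin N → ℕ)).subset ?_) Subtype.val_injective.injOn
  rintro _ ⟨η, hη, rfl⟩ x
  exact Nat.cast_le.1 (((le_mass η x).trans (le_of_lt hη)).trans (Nat.le_ceil M))

/-- Change of `linearStat v` in each move of the particle system. -/
def moveIncrement (v : Fin N → ℝ) : (Fin N × Fin N) ⊕ Fin 4 → ℝ :=
  Sum.elim (fun p => v p.2 - v p.1)
    ![-v (firstSite N), v (firstSite N), -v (lastSite N), v (lastSite N)]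

theorem particleRate_mul_linearStat (θL θR : ℝ) (v : Fin N → ℝ) (Φ : ℝ → ℝ)
    (i : (Fin N × Fin N) ⊕ Fin 4) (η : Config G σ) :
    particleRate G σ θL θR i η * Φ (linearStat v (particleMove G σ i η).1) =
      particleRate G σ θL θR i η * Φ (linearStat v η.1 + moveIncrement v i) := by
  rcases i with p | i
  · have := η.mul_hop_linearStat p.1 p.2 v Φ
    simp only [particleRate, particleMove, moveIncrement, Sum.elim_inl, bulkRate]
    linear_combination G.ω p.1 p.2 * this
  · fin_cases i
    · have := η.mul_remove_linearStat (firstSite N) v Φ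
      simp only [particleRate, particleMove, moveIncrement, Sum.elim_inr, Fin.zero_eta,
        Matrix.cons_val]
      linear_combination G.ωL * (G.αL + (σ : ℝ) * G.αL * θL) * this
    · have := η.mul_add_linearStat (firstSite N) v Φ
      simp only [particleRate, particleMove, moveIncrement, Sum.elim_inr, Fin.mk_one,
        Matrix.cons_val]
      linear_combination G.ωL * (G.αL * θL) * this
    · have := η.mul_remove_linearStat (lastSite N) v Φ
      simp only [particleRate, particleMove, moveIncrement, Sum.elim_inr, Fin.reduceFinMk,
        Matrix.cons_val]
      linear_combination G.ωR * (G.αR + (σ : ℝ) * G.αR * θR) * this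
    · have := η.mul_add_linearStat (lastSite N) v Φ
      simp only [particleRate, particleMove, moveIncrement, Sum.elim_inr, Fin.reduceFinMk,
        Matrix.cons_val]
      linear_combination G.ωR * (G.αR * θR) * this

theorem sum_particleRate_mul_increment (θL θR : ℝ) (v : Fin N → ℝ) (η : Config G σ) :
    ∑ i, particleRate G σ θL θR i η * moveIncrement v i =
      ∑ x, (η.1 x : ℝ) * killedGenerator G v x +
        (G.ωL * G.αL * θL * G.α (firstSite N) * v (firstSite N) +
          G.ωR * G.αR * θR * G.α (lastSite N) * v (lastSite N)) := by
  have h1 := bulkGenerator_linearStat v η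
  rw [bulkGenerator_eq] at h1
  have h2 : ∀ p : Fin N × Fin N, bulkRate G σ p η *
      (linearStat v (η.hop p.1 p.2).1 - linearStat v η.1) =
      bulkRate G σ p η * (v p.2 - v p.1) := by
    intro p
    have := η.mul_hop_linearStat p.1 p.2 v id
    simp only [id] at this
    simp only [bulkRate]
    linear_combination G.ω p.1 p.2 * this
  simp only [h2] at h1
  have h3 : ∑ x, (η.1 x : ℝ) * (killRate G x * v x) =
      ∑ x, (η.1 x : ℝ) * v x * killRate G x := Finset.sum_congr rfl fun x _ => by ring
  simp only [killedGenerator_apply, _root_.mul_sub (_ : ℝ) (Finset.sum _ _), Finset.sum_sub_distrib]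
  rw [h3, sum_mul_killRate (G := G) fun x => (η.1 x : ℝ) * v x, ← h1]
  simp only [Fintype.sum_sum_type, Fin.sum_univ_four, particleRate, moveIncrement, Sum.elim_inl,
    Sum.elim_inr, Matrix.cons_val]
  ring

theorem exists_boundaryRate_le {θL θR : ℝ} (hθL : θL ∈ scaleRange σ) (hθR : θR ∈ scaleRange σ) :
    ∃ K : ℝ, 0 ≤ K ∧ ∀ (i : Fin 4) (η : Config G σ),
      particleRate G σ θL θR (Sum.inr i) η ≤ K * (1 + mass η) := by
  have hL := scaleRange_nonneg hθL
  have hR := scaleRange_nonneg hθR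
  have hσ : (σ : ℝ) ≤ 1 := by rcases σ with _ | _ | _ <;> norm_num [SignType.cast]
  have key : ∀ (ω a θ : ℝ) (x : Fin N), 0 ≤ ω → 0 < a → 0 ≤ θ → ∀ η : Config G σ,
      ω * ((η.1 x : ℝ) * (a + (σ : ℝ) * a * θ)) ≤ ω * a * (1 + θ) * (1 + G.α x) * (1 + mass η) ∧
      ω * (a * θ * ((G.α x : ℝ) + (σ : ℝ) * (η.1 x : ℝ))) ≤
        ω * a * (1 + θ) * (1 + G.α x) * (1 + mass η) := by
    intro ω a θ x hω ha hθ η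
    have h1 := le_mass η x
    have h2 := mass_nonneg η
    have h3 : (0 : ℝ) ≤ η.1 x := Nat.cast_nonneg _
    have h4 : (0 : ℝ) ≤ G.α x := Nat.cast_nonneg _
    have hωa := mul_nonneg hω ha.le
    constructor
    · calc ω * ((η.1 x : ℝ) * (a + (σ : ℝ) * a * θ)) =
            ω * a * ((1 + (σ : ℝ) * θ) * (η.1 x : ℝ)) := by ring
        _ ≤ ω * a * ((1 + 1 * θ) * ((1 + G.α x) * (1 + mass η))) := by
            gcongr
            nlinarith [mul_nonneg h4 h2]
        _ = _ := by ring
    · calc ω * (a * θ * ((G.α x : ℝ) + (σ : ℝ) * (η.1 x : ℝ))) =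
            ω * a * (θ * ((G.α x : ℝ) + (σ : ℝ) * (η.1 x : ℝ))) := by ring
        _ ≤ ω * a * ((1 + θ) * ((1 + G.α x) * (1 + mass η))) := by
            gcongr ω * a * (?_)
            refine mul_le_mul (by linarith) ?_ (η.nonneg_add x) (by positivity)
            nlinarith [mul_nonneg h4 h2, η.add_le x]
        _ = _ := by ring
  have nn : ∀ (ω a θ : ℝ) (x : Fin N), 0 ≤ ω → 0 < a → 0 ≤ θ →
      0 ≤ ω * a * (1 + θ) * (1 + G.α x) := fun ω a θ x hω ha hθ => by positivity
  have n1 := nn G.ωL G.αL θL (firstSite N) G.ωL_nonneg G.αL_pos hL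
  have n2 := nn G.ωR G.αR θR (lastSite N) G.ωR_nonneg G.αR_pos hR
  refine ⟨_, add_nonneg n1 n2, fun i η => ?_⟩
  have hm : 0 ≤ 1 + mass η := by linarith [mass_nonneg η]
  have k1 := key G.ωL G.αL θL (firstSite N) G.ωL_nonneg G.αL_pos hL η
  have k2 := key G.ωR G.αR θR (lastSite N) G.ωR_nonneg G.αR_pos hR η
  have m1 := mul_nonneg n1 hm
  have m2 := mul_nonneg n2 hm
  rw [_root_.add_mul]
  fin_cases i
  · exact k1.1.trans (by linarith)
  · exact k1.2.trans (by linarith)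
  · exact k2.1.trans (by linarith)
  · exact k2.2.trans (by linarith)

omit [NeZero N] in
theorem bulkRate_le (p : Fin N × Fin N) (η : Config G σ) :
    bulkRate G σ p η ≤ G.ω p.1 p.2 * (mass η * ((∑ x, (G.α x : ℝ)) + mass η)) := by
  have h1 : (G.α p.2 : ℝ) ≤ ∑ x, (G.α x : ℝ) :=
    Finset.single_le_sum (f := fun x => (G.α x : ℝ)) (fun _ _ => Nat.cast_nonneg _)
      (Finset.mem_univ _)
  exact mul_le_mul_of_nonneg_left (mul_le_mul (le_mass η _)
    ((η.add_le _).trans (add_le_add h1 (le_mass η _))) (η.nonneg_add _) (mass_nonneg η))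
    (G.ω_nonneg _ _)

theorem drift_le_quadratic (n : ℕ) {ε B C Ω a K K0 s W : ℝ} (hε0 : 0 < ε) (hB : 0 ≤ B)
    (hC : 0 ≤ C) (hΩ0 : 0 ≤ Ω) (ha0 : 0 ≤ a) (hK00 : 0 ≤ K0) (h0 : 0 ≤ s) (h1 : s ≤ W)
    (h3 : W ≤ 3 + 3 * s) (hεB : ε * B ≤ 1) (hεC : ε * (C * (4 * B ^ 2 * Ω)) ≤ 1) :
    (n + 2) * (W * (K0 - ε * s)) +
      C * (4 * (ε * B) ^ 2 * Ω * (s * (a + s)) + 36 * K * (1 + s)) ≤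
      -ε * s ^ 2 + (3 * (n + 2) * K0 + 4 * C * Ω * a + 36 * C * K) * (1 + s) := by
  have f1 : W * (K0 - ε * s) ≤ K0 * (3 + 3 * s) - ε * s ^ 2 := by
    have g1 : K0 * W ≤ K0 * (3 + 3 * s) := mul_le_mul_of_nonneg_left (by linarith) hK00
    have g2 : ε * s * s ≤ ε * s * W := mul_le_mul_of_nonneg_left (by linarith) (by positivity)
    linear_combination g1 + g2
  have f2 : (ε * B) ^ 2 ≤ 1 := pow_le_one₀ (by positivity) hεB
  have f3 : C * (4 * (ε * B) ^ 2 * Ω * (s * (a + s)) + 36 * K * (1 + s)) ≤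
      ε * s ^ 2 + 4 * C * Ω * a * s + 36 * C * K * (1 + s) := by
    have g1 : ε * (C * (4 * B ^ 2 * Ω)) * (ε * s ^ 2) ≤ 1 * (ε * s ^ 2) :=
      mul_le_mul_of_nonneg_right hεC (by positivity)
    have g2 : (ε * B) ^ 2 * (4 * C * Ω * a * s) ≤ 1 * (4 * C * Ω * a * s) :=
      mul_le_mul_of_nonneg_right f2 (by positivity)
    linear_combination g1 + g2
  have f4 : (n + 2) * (W * (K0 - ε * s)) ≤
      3 * (n + 2) * K0 * (1 + s) - 2 * (ε * s ^ 2) := by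
    have g1 := mul_le_mul_of_nonneg_left f1 (by positivity : (0 : ℝ) ≤ n + 2)
    have g2 : 0 ≤ (n : ℝ) * (ε * s ^ 2) := by positivity
    linear_combination g1 + g2
  have f5 : 0 ≤ 4 * C * Ω * a := by positivity
  linear_combination f4 + f3 + f5

theorem pow_mul_quadratic_le (n : ℕ) {ε K3 s W : ℝ} (hε0 : 0 < ε) (hK30 : 0 ≤ K3) (h0 : 0 ≤ s)
    (h1 : s ≤ W) (h3 : W ≤ 3 + 3 * s) :
    W ^ n * (-ε * s ^ 2 + K3 * (1 + s)) ≤ (3 + 3 * ((2 * K3 + 1) / ε + 1)) ^ n *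
      (K3 * (1 + ((2 * K3 + 1) / ε + 1))) + ((2 * K3 + 1) / ε + 1) ^ n - s ^ n := by
  set s0 : ℝ := (2 * K3 + 1) / ε + 1 with hs0
  have hs00 : 0 ≤ s0 := by positivity
  have hW0 : 0 ≤ W := h0.trans h1
  rcases le_total s0 s with hcase | hcase
  · have g1 : 1 ≤ s := by
      have : 0 ≤ (2 * K3 + 1) / ε := by positivity
      linarith
    have g2 : 2 * K3 + 1 ≤ ε * s := by
      have : (2 * K3 + 1) / ε ≤ s := by linarith
      rw [div_le_iff₀ hε0] at this
      linarith
    have g3 : -ε * s ^ 2 + K3 * (1 + s) ≤ -1 := by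
      have g6 := mul_le_mul_of_nonneg_right g2 h0
      have g7 := mul_le_mul_of_nonneg_left g1 hK30
      linear_combination g6 + g7 + g1
    have g4 : s ^ n ≤ W ^ n := pow_le_pow_left₀ h0 (by linarith) n
    have g5 : 0 ≤ (3 + 3 * s0) ^ n * (K3 * (1 + s0)) + s0 ^ n := by positivity
    linear_combination mul_le_mul_of_nonneg_left g3 (pow_nonneg hW0 n) + g4 + g5
  · have g1 : W ^ n ≤ (3 + 3 * s0) ^ n := pow_le_pow_left₀ hW0 (by linarith) n
    have g2 : -ε * s ^ 2 + K3 * (1 + s) ≤ K3 * (1 + s0) := by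
      have : K3 * (1 + s) ≤ K3 * (1 + s0) := mul_le_mul_of_nonneg_left (by linarith) hK30
      have : 0 ≤ ε * s ^ 2 := by positivity
      linarith
    have g3 : s ^ n ≤ s0 ^ n := pow_le_pow_left₀ h0 hcase n
    have g4 : W ^ n * (-ε * s ^ 2 + K3 * (1 + s)) ≤ (3 + 3 * s0) ^ n * (K3 * (1 + s0)) :=
      (mul_le_mul_of_nonneg_left g2 (pow_nonneg hW0 n)).trans
        (mul_le_mul_of_nonneg_right g1 (by positivity))
    linarith

/-- Foster–Lyapunov functions controlling every moment of the number of particles. -/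
theorem exists_lyapunov (hres : 0 < max G.ωL G.ωR) {θL θR : ℝ} (hθL : θL ∈ scaleRange σ)
    (hθR : θR ∈ scaleRange σ) (n : ℕ) :
    ∃ (V : Config G σ → ℝ) (C : ℝ), (∀ η, mass η ≤ V η) ∧
      ∀ η, moveGenerator (particleRate G σ θL θR) (particleMove G σ) V η ≤ C - mass η ^ n := by
  obtain ⟨B, hB, hslow⟩ := exists_slow_superharmonic hres
  obtain ⟨C, hC, hpow⟩ := exists_pow_add_le n
  obtain ⟨K, hK, hbd⟩ := exists_boundaryRate_le (G := G) hθL hθR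
  set Ω : ℝ := ∑ p : Fin N × Fin N, G.ω p.1 p.2 with hΩ
  set a : ℝ := ∑ x, (G.α x : ℝ) with ha
  have hΩ0 : 0 ≤ Ω := Finset.sum_nonneg fun p _ => G.ω_nonneg _ _
  have ha0 : 0 ≤ a := Finset.sum_nonneg fun p _ => Nat.cast_nonneg _
  set ε : ℝ := 1 / (1 + B + C * (4 * B ^ 2 * Ω)) with hε
  have hden : 0 < 1 + B + C * (4 * B ^ 2 * Ω) := by positivity
  have hε0 : 0 < ε := by positivity
  have hε1 : ε * (1 + B + C * (4 * B ^ 2 * Ω)) = 1 := by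
    rw [hε]
    field_simp
  have hεB : ε * B ≤ 1 := by
    have : 0 ≤ ε * (C * (4 * B ^ 2 * Ω)) := by positivity
    nlinarith
  have hεC : ε * (C * (4 * B ^ 2 * Ω)) ≤ 1 := by
    have : 0 ≤ ε * B := by positivity
    nlinarith
  obtain ⟨v, hv1, hv3, hv4, hvL⟩ := hslow ε hε0 hεB
  have hL := scaleRange_nonneg hθL
  have hR := scaleRange_nonneg hθR
  have hcL : 0 ≤ G.ωL * G.αL * θL * G.α (firstSite N) := by
    have := G.ωL_nonneg; have := G.αL_pos; positivity
  have hcR : 0 ≤ G.ωR * G.αR * θR * G.α (lastSite N) := by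
    have := G.ωR_nonneg; have := G.αR_pos; positivity
  set K0 : ℝ := 3 * (G.ωL * G.αL * θL * G.α (firstSite N) +
    G.ωR * G.αR * θR * G.α (lastSite N)) with hK0
  have hK00 : 0 ≤ K0 := by positivity
  set K3 : ℝ := 3 * (n + 2) * K0 + 4 * C * Ω * a + 36 * C * K with hK3
  have hK30 : 0 ≤ K3 := by positivity
  set s0 : ℝ := (2 * K3 + 1) / ε + 1 with hs0
  have hU1 : ∀ η : Config G σ, mass η ≤ linearStat v η.1 := fun η =>
    Finset.sum_le_sum fun x _ => le_mul_of_one_le_left (Nat.cast_nonneg _) (hv1 x)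
  have hU3 : ∀ η : Config G σ, linearStat v η.1 ≤ 3 * mass η := fun η => by
    rw [mass, Finset.mul_sum]
    exact Finset.sum_le_sum fun x _ => mul_le_mul_of_nonneg_right (hv3 x) (Nat.cast_nonneg _)
  have hinc : ∀ i, |moveIncrement v i| ≤ 3 := by
    intro i
    have w : ∀ x, |v x| ≤ 3 := fun x => abs_le.2 ⟨by linarith [hv1 x], hv3 x⟩
    rcases i with p | i
    · exact abs_le.2 ⟨by simp only [moveIncrement, Sum.elim_inl]; linarith [hv1 p.2, hv3 p.1],
        by simp only [moveIncrement, Sum.elim_inl]; linarith [hv1 p.1, hv3 p.2]⟩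
    · fin_cases i
      · simpa [moveIncrement] using w _
      · simpa [moveIncrement] using w _
      · simpa [moveIncrement] using w _
      · simpa [moveIncrement] using w _
  refine ⟨fun η => (3 + linearStat v η.1) ^ (n + 2),
    (3 + 3 * s0) ^ n * (K3 * (1 + s0)) + s0 ^ n, fun η => ?_, fun η => ?_⟩
  · have h0 := mass_nonneg η
    have h1 := hU1 η
    calc mass η ≤ 3 + linearStat v η.1 := by linarith
      _ ≤ _ := le_self_pow₀ (by linarith) (by omega)
  · set s := mass η with hs
    have h0 : 0 ≤ s := mass_nonneg η
    have h1 : s ≤ linearStat v η.1 := hU1 η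
    have h3 : linearStat v η.1 ≤ 3 * s := hU3 η
    set W := 3 + linearStat v η.1 with hW
    have hW0 : 0 ≤ W := by linarith
    have hrate := fun i => particleRate_nonneg hθL hθR i η
    have step1 : moveGenerator (particleRate G σ θL θR) (particleMove G σ)
        (fun η => (3 + linearStat v η.1) ^ (n + 2)) η ≤
        (n + 2) * W ^ (n + 1) * ∑ i, particleRate G σ θL θR i η * moveIncrement v i +
        C * W ^ n * ∑ i, particleRate G σ θL θR i η * moveIncrement v i ^ 2 := by
      rw [moveGenerator, Finset.mul_sum, Finset.mul_sum, ← Finset.sum_add_distrib]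
      refine Finset.sum_le_sum fun i _ => ?_
      rw [_root_.mul_sub, particleRate_mul_linearStat θL θR v (fun u => (3 + u) ^ (n + 2)) i η]
      have := mul_le_mul_of_nonneg_left (hpow W (moveIncrement v i)
        ((hinc i).trans (by linarith))) (hrate i)
      rw [← add_assoc]
      linear_combination this
    have step2 : ∑ i, particleRate G σ θL θR i η * moveIncrement v i ≤ K0 - ε * s := by
      rw [sum_particleRate_mul_increment]
      have e1 : ∑ x, (η.1 x : ℝ) * killedGenerator G v x ≤ -ε * s := by
        rw [hs, mass, Finset.mul_sum]
        refine Finset.sum_le_sum fun x _ => ?_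
        rw [mul_comm (-ε)]
        exact mul_le_mul_of_nonneg_left (hvL x) (Nat.cast_nonneg _)
      have e2 := mul_le_mul_of_nonneg_left (hv3 (firstSite N)) hcL
      have e3 := mul_le_mul_of_nonneg_left (hv3 (lastSite N)) hcR
      rw [hK0]
      linarith
    have step3 : ∑ i, particleRate G σ θL θR i η * moveIncrement v i ^ 2 ≤
        4 * (ε * B) ^ 2 * Ω * (s * (a + s)) + 36 * K * (1 + s) := by
      rw [Fintype.sum_sum_type]
      refine add_le_add ?_ ?_
      · have e : 4 * (ε * B) ^ 2 * Ω * (s * (a + s)) =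
            ∑ p : Fin N × Fin N, G.ω p.1 p.2 * (s * (a + s)) * (4 * (ε * B) ^ 2) := by
          rw [hΩ, ← Finset.sum_mul, ← Finset.sum_mul]
          ring
        rw [e]
        refine Finset.sum_le_sum fun p _ => mul_le_mul (bulkRate_le p η) (hv4 _ _) (sq_nonneg _) ?_
        exact mul_nonneg (G.ω_nonneg _ _) (by positivity)
      · have e : 36 * K * (1 + s) = ∑ _i : Fin 4, K * (1 + s) * 9 := by
          rw [Finset.sum_const, Finset.card_univ, Fintype.card_fin, nsmul_eq_mul]
          push_cast
          ring
        rw [e]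
        refine Finset.sum_le_sum fun i _ => mul_le_mul (hbd i η) ?_ (sq_nonneg _) (by positivity)
        have := hinc (Sum.inr i)
        nlinarith [sq_abs (moveIncrement v (Sum.inr i)), abs_nonneg (moveIncrement v (Sum.inr i))]
    have step4 : (n + 2) * W ^ (n + 1) * ∑ i, particleRate G σ θL θR i η * moveIncrement v i +
        C * W ^ n * ∑ i, particleRate G σ θL θR i η * moveIncrement v i ^ 2 ≤
        W ^ n * (-ε * s ^ 2 + K3 * (1 + s)) := by
      have hWn : 0 ≤ W ^ n := pow_nonneg hW0 n
      calc _ ≤ (n + 2) * W ^ (n + 1) * (K0 - ε * s) + C * W ^ n *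
            (4 * (ε * B) ^ 2 * Ω * (s * (a + s)) + 36 * K * (1 + s)) :=
            add_le_add (mul_le_mul_of_nonneg_left step2 (by positivity))
              (mul_le_mul_of_nonneg_left step3 (by positivity))
        _ = W ^ n * ((n + 2) * (W * (K0 - ε * s)) +
            C * (4 * (ε * B) ^ 2 * Ω * (s * (a + s)) + 36 * K * (1 + s))) := by ring
        _ ≤ _ := by
            refine mul_le_mul_of_nonneg_left ?_ hWn
            exact drift_le_quadratic n hε0 hB hC hΩ0 ha0 hK00 h0 (by linarith) (by linarith)
              hεB hεC
    refine (step1.trans step4).trans ?_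
    exact pow_mul_quadratic_le n hε0 hK30 h0 (by linarith) (by linarith)

theorem integrable_mass_pow (hres : 0 < max G.ωL G.ωR) {θL θR : ℝ} (hθL : θL ∈ scaleRange σ)
    (hθR : θR ∈ scaleRange σ) {μ : Measure (Config G σ)} [IsProbabilityMeasure μ]
    (hμ : IsStationaryLaw (generator G σ θL θR) μ) (n : ℕ) :
    Integrable (fun η => mass η ^ n) μ := by
  obtain ⟨V, C, hV, hd⟩ := exists_lyapunov hres hθL hθR n
  rw [generator_eq_moveGenerator] at hμ
  exact hμ.integrable_of_drift (particleRate_nonneg hθL hθR) V _ C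
    (fun M => (finite_mass_lt M).subset fun η hη => (hV η).trans_lt hη)
    (fun η => pow_nonneg (mass_nonneg η) n) hd

end Lyapunov

section Duality

variable {N : ℕ} {G : Geometry N} {σ : SignType}

/-! ### Single-site duality functions -/

/-- `n (n - 1) ⋯ (n - k + 1) / (a (a + s) ⋯ (a + (k - 1) s))`. -/
noncomputable def factorialPoly (a s : ℝ) (n k : ℕ) : ℝ :=
  (n.descFactorial k : ℝ) / ∏ i ∈ Finset.range k, (a + s * i)

theorem mul_descFactorial (n k : ℕ) : (n : ℝ) * (n.descFactorial k : ℝ) =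
    (n.descFactorial (k + 1) : ℝ) + k * (n.descFactorial k : ℝ) := by
  rw [Nat.descFactorial_succ]
  rcases le_or_gt k n with h | h
  · push_cast [Nat.cast_sub h]
    ring
  · simp [Nat.descFactorial_eq_zero_iff_lt.2 h]

theorem mul_descFactorial_pred (n k : ℕ) : (n : ℝ) * ((n - 1).descFactorial k : ℝ) =
    (n.descFactorial (k + 1) : ℝ) := by
  rcases n with _ | n
  · simp
  · rw [Nat.succ_descFactorial_succ]
    simp

theorem succ_descFactorial (n k : ℕ) : ((n + 1).descFactorial k : ℝ) =
    (n.descFactorial k : ℝ) + k * (n.descFactorial (k - 1) : ℝ) := by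
  rcases k with _ | k
  · simp
  · rw [Nat.succ_descFactorial_succ, Nat.add_sub_cancel]
    have := mul_descFactorial n k
    push_cast
    linear_combination this

section FactorialPoly

variable {a s : ℝ} {n k : ℕ}

theorem descFactorial_div_prod (h : a + s * k = 0 → n.descFactorial (k + 1) = 0) :
    (n.descFactorial (k + 1) : ℝ) / ∏ i ∈ Finset.range k, (a + s * i) =
      (a + s * k) * factorialPoly a s n (k + 1) := by
  rw [factorialPoly, Finset.prod_range_succ]
  by_cases h0 : a + s * k = 0
  · rw [h h0, h0]
    simp
  · field_simp

theorem mul_factorialPoly_pred (h : a + s * k = 0 → n.descFactorial (k + 1) = 0) :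
    (n : ℝ) * factorialPoly a s (n - 1) k = (a + s * k) * factorialPoly a s n (k + 1) := by
  rw [← descFactorial_div_prod h, ← mul_descFactorial_pred, factorialPoly, mul_div_assoc]

theorem mul_factorialPoly (h : a + s * k = 0 → n.descFactorial (k + 1) = 0) :
    (n : ℝ) * factorialPoly a s n k =
      (a + s * k) * factorialPoly a s n (k + 1) + k * factorialPoly a s n k := by
  rw [← descFactorial_div_prod h, factorialPoly, ← mul_div_assoc, mul_descFactorial]
  ring

theorem mul_factorialPoly_succ (h : a + s * k = 0 → n.descFactorial (k + 1) = 0)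
    (h' : ∀ j < k, a + s * j ≠ 0) :
    (a + s * n) * factorialPoly a s (n + 1) k = (a + 2 * s * k) * factorialPoly a s n k +
      s * ((a + s * k) * factorialPoly a s n (k + 1)) + k * factorialPoly a s n (k - 1) := by
  rw [← descFactorial_div_prod h]
  rcases k with _ | k
  · simp [factorialPoly]
  have hw : ∏ i ∈ Finset.range (k + 1), (a + s * i) ≠ 0 :=
    Finset.prod_ne_zero_iff.2 fun i hi => h' i (Finset.mem_range.1 hi)
  have hw' : ∏ i ∈ Finset.range k, (a + s * i) ≠ 0 :=
    Finset.prod_ne_zero_iff.2 fun i hi => h' i ((Finset.mem_range.1 hi).trans (Nat.lt_succ_self k))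
  have e1 := mul_descFactorial n (k + 1)
  have e2 := mul_descFactorial n k
  simp only [factorialPoly, succ_descFactorial, Nat.add_sub_cancel]
  rw [Finset.prod_range_succ] at hw ⊢
  have hk := h' k (Nat.lt_succ_self k)
  field_simp
  push_cast at e1 ⊢
  linear_combination s * e1 + s * (k + 1) * e2

end FactorialPoly

/-- The binomial shift `∑ j ≤ k, k.choose j * (-θ) ^ (k - j) * f j`. -/
def binomialShift (θ : ℝ) (f : ℕ → ℝ) (k : ℕ) : ℝ :=
  ∑ j ∈ Finset.range (k + 1), (k.choose j : ℝ) * (-θ) ^ (k - j) * f j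

theorem binomialShift_add (θ : ℝ) (f g : ℕ → ℝ) (k : ℕ) :
    binomialShift θ (fun j => f j + g j) k = binomialShift θ f k + binomialShift θ g k := by
  simp only [binomialShift, _root_.mul_add, Finset.sum_add_distrib]

theorem binomialShift_const_mul (θ c : ℝ) (f : ℕ → ℝ) (k : ℕ) :
    binomialShift θ (fun j => c * f j) k = c * binomialShift θ f k := by
  simp only [binomialShift, Finset.mul_sum]
  exact Finset.sum_congr rfl fun j _ => by ring

theorem binomialShift_congr (θ : ℝ) {f g : ℕ → ℝ} {k : ℕ} (h : ∀ j ≤ k, f j = g j) :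
    binomialShift θ f k = binomialShift θ g k :=
  Finset.sum_congr rfl fun j hj => by rw [h j (Nat.lt_succ_iff.1 (Finset.mem_range.1 hj))]

theorem binomialShift_succ (θ : ℝ) (f : ℕ → ℝ) (k : ℕ) :
    binomialShift θ f (k + 1) =
      binomialShift θ (fun j => f (j + 1)) k - θ * binomialShift θ f k := by
  unfold binomialShift
  rw [Finset.sum_range_succ']
  have h1 : ∑ j ∈ Finset.range (k + 1), ((k + 1).choose (j + 1) : ℝ) *
      (-θ) ^ (k + 1 - (j + 1)) * f (j + 1) =
      ∑ j ∈ Finset.range (k + 1), (k.choose j : ℝ) * (-θ) ^ (k - j) * f (j + 1) +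
      ∑ j ∈ Finset.range (k + 1), (k.choose (j + 1) : ℝ) * (-θ) ^ (k - j) * f (j + 1) := by
    rw [← Finset.sum_add_distrib]
    refine Finset.sum_congr rfl fun j _ => ?_
    rw [Nat.choose_succ_succ, Nat.add_sub_add_right]
    push_cast
    ring
  have h2 : ∑ j ∈ Finset.range (k + 1), (k.choose (j + 1) : ℝ) * (-θ) ^ (k - j) * f (j + 1) =
      -θ * ∑ j ∈ Finset.range k, (k.choose (j + 1) : ℝ) * (-θ) ^ (k - (j + 1)) * f (j + 1) := by
    rw [Finset.sum_range_succ, Nat.choose_succ_self, Finset.mul_sum]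
    simp only [Nat.cast_zero, zero_mul, add_zero]
    refine Finset.sum_congr rfl fun j hj => ?_
    have : k - j = k - (j + 1) + 1 := by
      have := Finset.mem_range.1 hj
      omega
    rw [this, pow_succ]
    ring
  have h3 : ∑ j ∈ Finset.range (k + 1), (k.choose j : ℝ) * (-θ) ^ (k - j) * f j =
      ∑ j ∈ Finset.range k, (k.choose (j + 1) : ℝ) * (-θ) ^ (k - (j + 1)) * f (j + 1) +
        (-θ) ^ k * f 0 := by
    rw [Finset.sum_range_succ']
    simp
  rw [h1, h2, h3]
  simp only [Nat.choose_zero_right, Nat.sub_zero]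
  push_cast
  ring

theorem binomialShift_mul_pred (θ : ℝ) (f : ℕ → ℝ) (k : ℕ) :
    binomialShift θ (fun j => j * f (j - 1)) k = k * binomialShift θ f (k - 1) := by
  rcases k with _ | k
  · simp [binomialShift]
  · unfold binomialShift
    rw [Finset.sum_range_succ', Finset.mul_sum]
    simp only [Nat.cast_zero, zero_mul, mul_zero, add_zero, Nat.add_sub_cancel]
    refine Finset.sum_congr rfl fun j _ => ?_
    have h := congrArg (Nat.cast (R := ℝ)) (Nat.add_one_mul_choose_eq k j)
    rw [Nat.add_sub_add_right]
    push_cast at h ⊢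
    linear_combination -((-θ) ^ (k - j) * f j) * h

theorem binomialShift_mul (θ : ℝ) (f : ℕ → ℝ) (k : ℕ) :
    binomialShift θ (fun j => j * f j) k =
      k * binomialShift θ f k + θ * (k * binomialShift θ f (k - 1)) := by
  rcases k with _ | k
  · simp [binomialShift]
  · have h1 := binomialShift_mul_pred θ (fun j => f (j + 1)) (k + 1)
    have h2 := binomialShift_succ θ f k
    have h3 : binomialShift θ (fun j => (j : ℝ) * f (j - 1 + 1)) (k + 1) =
        binomialShift θ (fun j => j * f j) (k + 1) :=
      binomialShift_congr θ fun j _ => by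
        rcases j with _ | j <;> simp
    rw [h3] at h1
    rw [h1, Nat.add_sub_cancel]
    linear_combination -((k + 1 : ℕ) : ℝ) * h2

/-- The single-site shifted duality function. -/
noncomputable def siteDual (a s θ : ℝ) (k n : ℕ) : ℝ :=
  binomialShift θ (factorialPoly a s n) k

section SiteDual

variable {a s θ : ℝ} {n k : ℕ}

theorem siteDual_zero : siteDual a s θ 0 n = 1 := by
  simp [siteDual, binomialShift, factorialPoly]

theorem siteDual_one : siteDual a s θ 1 n = n / a - θ := by
  simp [siteDual, binomialShift, factorialPoly, Finset.sum_range_succ]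
  ring

/-- The terms produced by the lowering relation for `siteDual`. -/
theorem binomialShift_raise (θ : ℝ) (f : ℕ → ℝ) (k : ℕ) :
    binomialShift θ (fun j => (a + s * j) * f (j + 1)) k =
      (a + s * k) * binomialShift θ f (k + 1) + θ * (a + 2 * s * k) * binomialShift θ f k +
        s * θ ^ 2 * (k * binomialShift θ f (k - 1)) := by
  have h1 : binomialShift θ (fun j => (a + s * j) * f (j + 1)) k =
      a * binomialShift θ (fun j => f (j + 1)) k +
        s * binomialShift θ (fun j => j * f (j + 1)) k := by
    rw [← binomialShift_const_mul, ← binomialShift_const_mul, ← binomialShift_add]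
    exact binomialShift_congr θ fun j _ => by ring
  rw [h1, binomialShift_mul θ (fun j => f (j + 1))]
  have h2 := binomialShift_succ θ f k
  have h3 : (k : ℝ) * binomialShift θ (fun j => f (j + 1)) (k - 1) =
      k * (binomialShift θ f k + θ * binomialShift θ f (k - 1)) := by
    rcases k with _ | k
    · simp
    · rw [Nat.add_sub_cancel, binomialShift_succ θ f k]
      ring
  linear_combination s * θ * h3 - (a + s * k) * h2

theorem mul_siteDual_pred (h : ∀ j ≤ k, a + s * j = 0 → n.descFactorial (j + 1) = 0) :
    (n : ℝ) * siteDual a s θ k (n - 1) = (a + s * k) * siteDual a s θ (k + 1) n +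
      θ * (a + 2 * s * k) * siteDual a s θ k n + s * θ ^ 2 * (k * siteDual a s θ (k - 1) n) := by
  simp only [siteDual]
  rw [← binomialShift_raise, ← binomialShift_const_mul]
  exact binomialShift_congr θ fun j hj => mul_factorialPoly_pred (h j hj)

theorem mul_siteDual (h : ∀ j ≤ k, a + s * j = 0 → n.descFactorial (j + 1) = 0) :
    (n : ℝ) * siteDual a s θ k n = (n : ℝ) * siteDual a s θ k (n - 1) +
      k * siteDual a s θ k n + θ * (k * siteDual a s θ (k - 1) n) := by
  rw [add_assoc]
  simp only [siteDual]
  rw [← binomialShift_mul, ← binomialShift_const_mul, ← binomialShift_const_mul,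
    ← binomialShift_add]
  refine binomialShift_congr θ fun j hj => ?_
  rw [mul_factorialPoly_pred (h j hj), mul_factorialPoly (h j hj)]

theorem mul_siteDual_succ (h : ∀ j ≤ k, a + s * j = 0 → n.descFactorial (j + 1) = 0)
    (h' : ∀ j < k, a + s * j ≠ 0) :
    (a + s * n) * siteDual a s θ k (n + 1) = a * siteDual a s θ k n +
      2 * s * (k * siteDual a s θ k n + θ * (k * siteDual a s θ (k - 1) n)) +
      s * (n * siteDual a s θ k (n - 1)) + k * siteDual a s θ (k - 1) n := by
  simp only [siteDual]
  rw [← binomialShift_mul, ← binomialShift_mul_pred]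
  simp only [← binomialShift_const_mul]
  rw [← binomialShift_add, ← binomialShift_add, ← binomialShift_add]
  refine binomialShift_congr θ fun j hj => ?_
  rw [mul_factorialPoly_pred (h j hj),
    mul_factorialPoly_succ (h j hj) fun i hi => h' i (hi.trans_le hj)]
  ring

end SiteDual

theorem site_ne_zero (ξ : Config G σ) (x : Fin N) (j : ℕ) (hj : j < ξ.1 x) :
    (G.α x : ℝ) + (σ : ℝ) * j ≠ 0 := by
  have hα : (0 : ℝ) < G.α x := Nat.cast_pos.2 (G.α_pos x)
  have hj0 : (0 : ℝ) ≤ j := Nat.cast_nonneg j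
  rcases σ with _ | _ | _
  · change (G.α x : ℝ) + ((0 : SignType) : ℝ) * j ≠ 0
    simp [hα.ne']
  · change (G.α x : ℝ) + ((-1 : SignType) : ℝ) * j ≠ 0
    have : (j : ℝ) < G.α x := Nat.cast_lt.2 (hj.trans_le (ξ.2 rfl x))
    simp only [SignType.coe_neg, SignType.coe_one]
    intro h
    linarith
  · change (G.α x : ℝ) + ((1 : SignType) : ℝ) * j ≠ 0
    simp only [SignType.coe_one, one_mul]
    positivity

theorem site_vanish (η : Config G σ) (x : Fin N) (j : ℕ)
    (h : (G.α x : ℝ) + (σ : ℝ) * j = 0) : (η.1 x).descFactorial (j + 1) = 0 := by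
  have hα : (0 : ℝ) < G.α x := Nat.cast_pos.2 (G.α_pos x)
  have hj0 : (0 : ℝ) ≤ j := Nat.cast_nonneg j
  rcases σ with _ | _ | _
  · change (G.α x : ℝ) + ((0 : SignType) : ℝ) * j = 0 at h
    simp only [SignType.coe_zero, zero_mul, add_zero] at h
    exact absurd h hα.ne'
  · change (G.α x : ℝ) + ((-1 : SignType) : ℝ) * j = 0 at h
    simp only [SignType.coe_neg, SignType.coe_one] at h
    have h1 : (G.α x : ℝ) = (j : ℝ) := by linarith
    have h2 : G.α x = j := Nat.cast_injective h1
    rw [Nat.descFactorial_eq_zero_iff_lt, ← h2]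
    exact Nat.lt_succ_of_le (η.2 rfl x)
  · change (G.α x : ℝ) + ((1 : SignType) : ℝ) * j = 0 at h
    simp only [SignType.coe_one, one_mul] at h
    linarith

end Duality

section DualityRelation

variable {N : ℕ} {G : Geometry N} {σ : SignType}

/-- The shifted duality function of bulk configurations. -/
noncomputable def bulkDual (G : Geometry N) (σ : SignType) (θ : ℝ) (f g : Fin N → ℕ) : ℝ :=
  ∏ x, siteDual (G.α x) (σ : ℝ) θ (f x) (g x)

theorem bulkGenerator_val (φ : (Fin N → ℕ) → ℝ) (η : Config G σ) :
    bulkGenerator G σ (fun η => φ η.1) η =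
      ∑ x, ∑ y, G.ω x y * ((η.1 x : ℝ) * ((G.α y : ℝ) + (σ : ℝ) * (η.1 y : ℝ)) *
        (φ (η.1 - Pi.single x 1 + Pi.single y 1) - φ η.1)) := by
  refine Finset.sum_congr rfl fun x _ => Finset.sum_congr rfl fun y _ => ?_
  have := η.mul_hop x y φ
  linear_combination G.ω x y * this

theorem sum_symm_congr {A B : Fin N → Fin N → ℝ}
    (h : ∀ x y, x ≠ y → A x y + A y x = B x y + B y x) :
    ∑ x, ∑ y, G.ω x y * A x y = ∑ x, ∑ y, G.ω x y * B x y := by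
  have key : ∀ A : Fin N → Fin N → ℝ, 2 * ∑ x, ∑ y, G.ω x y * A x y =
      ∑ x, ∑ y, G.ω x y * (A x y + A y x) := by
    intro A
    have h1 : ∑ x, ∑ y, G.ω x y * A x y = ∑ x, ∑ y, G.ω x y * A y x := by
      rw [Finset.sum_comm]
      exact Finset.sum_congr rfl fun x _ => Finset.sum_congr rfl fun y _ => by rw [G.ω_symm]
    rw [two_mul]
    conv_lhs => rw [h1]
    conv_lhs => enter [1]; rw [← h1]
    simp only [← Finset.sum_add_distrib, _root_.mul_add]
  have h2 : ∑ x, ∑ y, G.ω x y * (A x y + A y x) = ∑ x, ∑ y, G.ω x y * (B x y + B y x) := by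
    refine Finset.sum_congr rfl fun x _ => Finset.sum_congr rfl fun y _ => ?_
    by_cases hxy : x = y
    · rw [hxy, G.ω_self]
      simp
    · rw [h x y hxy]
  have h3 := key A
  have h4 := key B
  linarith

theorem bulkDual_split (θ : ℝ) (f g : Fin N → ℕ) (x : Fin N) :
    bulkDual G σ θ f g = siteDual (G.α x) (σ : ℝ) θ (f x) (g x) *
      ∏ z ∈ Finset.univ.erase x, siteDual (G.α z) (σ : ℝ) θ (f z) (g z) :=
  (Finset.mul_prod_erase _ _ (Finset.mem_univ x)).symm

theorem bulkDual_split_pair (θ : ℝ) (f g f' g' : Fin N → ℕ) {x y : Fin N} (hxy : x ≠ y)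
    (hf : ∀ z, z ≠ x → z ≠ y → f' z = f z) (hg : ∀ z, z ≠ x → z ≠ y → g' z = g z) :
    bulkDual G σ θ f' g' = siteDual (G.α x) (σ : ℝ) θ (f' x) (g' x) *
      siteDual (G.α y) (σ : ℝ) θ (f' y) (g' y) *
      ∏ z ∈ (Finset.univ.erase x).erase y, siteDual (G.α z) (σ : ℝ) θ (f z) (g z) := by
  rw [bulkDual_split θ f' g' x, mul_assoc, ← Finset.mul_prod_erase _ _
    (Finset.mem_erase.2 ⟨hxy.symm, Finset.mem_univ y⟩)]
  congr 2
  refine Finset.prod_congr rfl fun z hz => ?_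
  have h1 := Finset.ne_of_mem_erase hz
  have h2 := Finset.ne_of_mem_erase (Finset.mem_of_mem_erase hz)
  rw [hf z h2 h1, hg z h2 h1]

theorem hop_apply_source {f : Fin N → ℕ} {x y : Fin N} (hxy : x ≠ y) :
    (f - Pi.single x 1 + Pi.single y 1 : Fin N → ℕ) x = f x - 1 := by
  simp [hxy]

theorem hop_apply_target {f : Fin N → ℕ} {x y : Fin N} (hxy : x ≠ y) :
    (f - Pi.single x 1 + Pi.single y 1 : Fin N → ℕ) y = f y + 1 := by
  simp [hxy.symm]

theorem hop_apply_of_ne (f : Fin N → ℕ) {x y : Fin N} (z : Fin N) (hx : z ≠ x) (hy : z ≠ y) :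
    (f - Pi.single x 1 + Pi.single y 1 : Fin N → ℕ) z = f z := by
  simp [hx, hy]

/-- The algebraic identity behind the duality for one bond. -/
theorem bond_duality_identity {s θ a₁ a₂ k₁ k₂ n₁ n₂ d₁ d₂ d₁m d₂m d₁p d₂p e₁m e₂m e₁p e₂p P : ℝ}
    (m₁ : n₁ * d₁m = (a₁ + s * k₁) * e₁p + θ * (a₁ + 2 * s * k₁) * d₁ + s * θ ^ 2 * (k₁ * e₁m))
    (m₂ : n₂ * d₂m = (a₂ + s * k₂) * e₂p + θ * (a₂ + 2 * s * k₂) * d₂ + s * θ ^ 2 * (k₂ * e₂m))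
    (c₁ : n₁ * d₁ = n₁ * d₁m + k₁ * d₁ + θ * (k₁ * e₁m))
    (c₂ : n₂ * d₂ = n₂ * d₂m + k₂ * d₂ + θ * (k₂ * e₂m))
    (p₁ : (a₁ + s * n₁) * d₁p = a₁ * d₁ + 2 * s * (k₁ * d₁ + θ * (k₁ * e₁m)) +
      s * (n₁ * d₁m) + k₁ * e₁m)
    (p₂ : (a₂ + s * n₂) * d₂p = a₂ * d₂ + 2 * s * (k₂ * d₂ + θ * (k₂ * e₂m)) +
      s * (n₂ * d₂m) + k₂ * e₂m) :
    n₁ * (a₂ + s * n₂) * (d₁m * d₂p * P - d₁ * d₂ * P) +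
      n₂ * (a₁ + s * n₁) * (d₂m * d₁p * P - d₂ * d₁ * P) =
    k₁ * (a₂ + s * k₂) * (e₁m * e₂p * P - d₁ * d₂ * P) +
      k₂ * (a₁ + s * k₁) * (e₂m * e₁p * P - d₂ * d₁ * P) := by
  calc _ = P * ((n₁ * d₁m) * ((a₂ + s * n₂) * d₂p) + (n₂ * d₂m) * ((a₁ + s * n₁) * d₁p) -
        ((n₁ * d₁) * (a₂ * d₂ + s * (n₂ * d₂)) + (n₂ * d₂) * (a₁ * d₁ + s * (n₁ * d₁)))) := by ring
    _ = _ := by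
      rw [p₁, p₂, c₁, c₂, m₁, m₂]
      ring

theorem bond_duality (θ : ℝ) (ξ η : Config G σ) {x y : Fin N} (hxy : x ≠ y) :
    (η.1 x : ℝ) * ((G.α y : ℝ) + (σ : ℝ) * (η.1 y : ℝ)) *
        (bulkDual G σ θ ξ.1 (η.1 - Pi.single x 1 + Pi.single y 1) - bulkDual G σ θ ξ.1 η.1) +
      (η.1 y : ℝ) * ((G.α x : ℝ) + (σ : ℝ) * (η.1 x : ℝ)) *
        (bulkDual G σ θ ξ.1 (η.1 - Pi.single y 1 + Pi.single x 1) - bulkDual G σ θ ξ.1 η.1) =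
    (ξ.1 x : ℝ) * ((G.α y : ℝ) + (σ : ℝ) * (ξ.1 y : ℝ)) *
        (bulkDual G σ θ (ξ.1 - Pi.single x 1 + Pi.single y 1) η.1 - bulkDual G σ θ ξ.1 η.1) +
      (ξ.1 y : ℝ) * ((G.α x : ℝ) + (σ : ℝ) * (ξ.1 x : ℝ)) *
        (bulkDual G σ θ (ξ.1 - Pi.single y 1 + Pi.single x 1) η.1 - bulkDual G σ θ ξ.1 η.1) := by
  have hv := fun z => fun j (_ : j ≤ ξ.1 z) => site_vanish η z j
  have hn := fun z => site_ne_zero ξ z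
  have s0 := bulkDual_split_pair (G := G) (σ := σ) θ ξ.1 η.1 ξ.1 η.1 hxy (fun _ _ _ => rfl)
    (fun _ _ _ => rfl)
  have s0' := bulkDual_split_pair (G := G) (σ := σ) θ ξ.1 η.1 ξ.1 η.1 hxy.symm (fun _ _ _ => rfl)
    (fun _ _ _ => rfl)
  rw [Finset.erase_right_comm] at s0'
  have s1 := bulkDual_split_pair (G := G) (σ := σ) θ ξ.1 η.1 ξ.1 _ hxy (fun _ _ _ => rfl)
    (hop_apply_of_ne η.1)
  have s2 := bulkDual_split_pair (G := G) (σ := σ) θ ξ.1 η.1 ξ.1 _ hxy.symm (fun _ _ _ => rfl)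
    (hop_apply_of_ne η.1)
  have s3 := bulkDual_split_pair (G := G) (σ := σ) θ ξ.1 η.1 _ η.1 hxy (hop_apply_of_ne ξ.1)
    (fun _ _ _ => rfl)
  have s4 := bulkDual_split_pair (G := G) (σ := σ) θ ξ.1 η.1 _ η.1 hxy.symm (hop_apply_of_ne ξ.1)
    (fun _ _ _ => rfl)
  rw [Finset.erase_right_comm] at s2 s4
  rw [hop_apply_source hxy, hop_apply_target hxy] at s1 s3
  rw [hop_apply_source hxy.symm, hop_apply_target hxy.symm] at s2 s4
  have key := bond_duality_identity
    (P := ∏ z ∈ (Finset.univ.erase x).erase y, siteDual (G.α z) (σ : ℝ) θ (ξ.1 z) (η.1 z))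
    (mul_siteDual_pred (θ := θ) (hv x)) (mul_siteDual_pred (θ := θ) (hv y))
    (mul_siteDual (θ := θ) (hv x)) (mul_siteDual (θ := θ) (hv y))
    (mul_siteDual_succ (θ := θ) (hv x) (hn x)) (mul_siteDual_succ (θ := θ) (hv y) (hn y))
  rw [← s0, ← s0', ← s1, ← s2, ← s3, ← s4] at key
  exact key

theorem bulk_duality (θ : ℝ) (ξ η : Config G σ) :
    bulkGenerator G σ (fun η => bulkDual G σ θ ξ.1 η.1) η =
      bulkGenerator G σ (fun ξ => bulkDual G σ θ ξ.1 η.1) ξ := by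
  rw [bulkGenerator_val (bulkDual G σ θ ξ.1),
    bulkGenerator_val (fun f => bulkDual G σ θ f η.1)]
  exact sum_symm_congr fun x y hxy => bond_duality θ ξ η hxy

theorem reservoir_duality (θ a θ' : ℝ) (ξ η : Config G σ) (x : Fin N) :
    reservoirGenerator G σ x a θ' (fun η => bulkDual G σ θ ξ.1 η.1) η =
      a * (ξ.1 x : ℝ) * ((θ' - θ) * bulkDual G σ θ (ξ.remove x).1 η.1 -
        bulkDual G σ θ ξ.1 η.1) := by
  have hv := fun j (_ : j ≤ ξ.1 x) => site_vanish η x j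
  have hn := site_ne_zero ξ x
  have m := mul_siteDual_pred (θ := θ) hv
  have c := mul_siteDual (θ := θ) hv
  have p := mul_siteDual_succ (θ := θ) hv hn
  have hadd := η.mul_add x (bulkDual G σ θ ξ.1)
  set P := ∏ z ∈ Finset.univ.erase x, siteDual (G.α z) (σ : ℝ) θ (ξ.1 z) (η.1 z) with hP
  have s0 : bulkDual G σ θ ξ.1 η.1 = siteDual (G.α x) (σ : ℝ) θ (ξ.1 x) (η.1 x) * P :=
    bulkDual_split θ _ _ x
  have s1 : bulkDual G σ θ ξ.1 (η.remove x).1 =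
      siteDual (G.α x) (σ : ℝ) θ (ξ.1 x) (η.1 x - 1) * P := by
    rw [η.remove_val, bulkDual_split θ _ _ x]
    congr 1
    · simp
    · exact Finset.prod_congr rfl fun z hz => by simp [Finset.ne_of_mem_erase hz]
  have s2 : bulkDual G σ θ ξ.1 (η.1 + Pi.single x 1) =
      siteDual (G.α x) (σ : ℝ) θ (ξ.1 x) (η.1 x + 1) * P := by
    rw [bulkDual_split θ _ _ x]
    congr 1
    · simp
    · exact Finset.prod_congr rfl fun z hz => by simp [Finset.ne_of_mem_erase hz]
  have s3 : bulkDual G σ θ (ξ.remove x).1 η.1 =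
      siteDual (G.α x) (σ : ℝ) θ (ξ.1 x - 1) (η.1 x) * P := by
    rw [ξ.remove_val, bulkDual_split θ _ _ x]
    congr 1
    · simp
    · exact Finset.prod_congr rfl fun z hz => by simp [Finset.ne_of_mem_erase hz]
  rw [s2] at hadd
  simp only [reservoirGenerator]
  rw [_root_.mul_sub (a * θ' * _), mul_assoc (a * θ') _ (bulkDual G σ θ ξ.1 (η.add x).1), hadd,
    s0, s1, s3]
  linear_combination (-a * (1 + σ * θ') * P - a * θ' * σ * P) * c + a * θ' * P * p

variable [NeZero N]

/-- The shifted duality function, with the boundary factors of the dual reservoirs. -/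
noncomputable def dualFunction (G : Geometry N) (σ : SignType) (θL θR θ : ℝ) (ξ : DualConfig G σ)
    (η : Config G σ) : ℝ :=
  bulkDual G σ θ ξ.1.1 η.1 * ((θL - θ) ^ ξ.2.1 * (θR - θ) ^ ξ.2.2)

theorem generator_dualFunction (θL θR θ : ℝ) (ξ : DualConfig G σ) (η : Config G σ) :
    generator G σ θL θR (dualFunction G σ θL θR θ ξ) η =
      dualGenerator G σ (fun ξ => dualFunction G σ θL θR θ ξ η) ξ := by
  have hb : ∀ (f : Config G σ → ℝ) (c : ℝ) (η : Config G σ),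
      bulkGenerator G σ (fun η => f η * c) η = bulkGenerator G σ f η * c := by
    intro f c η
    simp only [bulkGenerator, Finset.sum_mul]
    exact Finset.sum_congr rfl fun x _ => Finset.sum_congr rfl fun y _ => by ring
  have hr : ∀ (x : Fin N) (a θ' : ℝ) (f : Config G σ → ℝ) (c : ℝ) (η : Config G σ),
      reservoirGenerator G σ x a θ' (fun η => f η * c) η =
        reservoirGenerator G σ x a θ' f η * c := by
    intro x a θ' f c η
    simp only [reservoirGenerator]
    ring
  unfold dualFunction
  simp only [generator, dualGenerator]
  rw [hb, hr, hr, hb (fun ζ => bulkDual G σ θ ζ.1 η.1), bulk_duality, reservoir_duality,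
    reservoir_duality]
  ring

end DualityRelation

section PolyBounded

variable {N : ℕ} {G : Geometry N} {σ : SignType}

/-- Functions of at most polynomial growth in the number of particles. -/
def PolyBounded (f : Config G σ → ℝ) : Prop :=
  ∃ (C : ℝ) (n : ℕ), 0 ≤ C ∧ ∀ η, |f η| ≤ C * (1 + mass η) ^ n

namespace PolyBounded

variable {f g : Config G σ → ℝ}

theorem const (c : ℝ) : PolyBounded fun _ : Config G σ => c :=
  ⟨|c|, 0, abs_nonneg c, fun η => by simp⟩

theorem mul (hf : PolyBounded f) (hg : PolyBounded g) : PolyBounded fun η => f η * g η := by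
  obtain ⟨C, n, hC, h⟩ := hf
  obtain ⟨D, m, hD, h'⟩ := hg
  refine ⟨C * D, n + m, mul_nonneg hC hD, fun η => ?_⟩
  have h0 := mass_nonneg η
  calc |f η * g η| = |f η| * |g η| := abs_mul _ _
    _ ≤ (C * (1 + mass η) ^ n) * (D * (1 + mass η) ^ m) :=
      mul_le_mul (h η) (h' η) (abs_nonneg _) (by positivity)
    _ = _ := by ring

theorem add (hf : PolyBounded f) (hg : PolyBounded g) : PolyBounded fun η => f η + g η := by
  obtain ⟨C, n, hC, h⟩ := hf
  obtain ⟨D, m, hD, h'⟩ := hg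
  refine ⟨C + D, max n m, add_nonneg hC hD, fun η => ?_⟩
  have h0 : 1 ≤ 1 + mass η := by linarith [mass_nonneg η]
  rw [_root_.add_mul]
  exact (abs_add_le _ _).trans (add_le_add
    ((h η).trans (mul_le_mul_of_nonneg_left (pow_le_pow_right₀ h0 (le_max_left n m)) hC))
    ((h' η).trans (mul_le_mul_of_nonneg_left (pow_le_pow_right₀ h0 (le_max_right n m)) hD)))

theorem sub (hf : PolyBounded f) (hg : PolyBounded g) : PolyBounded fun η => f η - g η := by
  simpa [sub_eq_add_neg] using hf.add ((const (-1)).mul hg)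

theorem prod {κ : Type*} (A : Finset κ) {f : κ → Config G σ → ℝ} (hf : ∀ k, PolyBounded (f k)) :
    PolyBounded fun η => ∏ k ∈ A, f k η := by
  classical
  induction A using Finset.induction_on with
  | empty => simpa using const 1
  | insert k A hk ih => simpa [Finset.prod_insert hk] using (hf k).mul ih

theorem sum {κ : Type*} (A : Finset κ) {f : κ → Config G σ → ℝ} (hf : ∀ k, PolyBounded (f k)) :
    PolyBounded fun η => ∑ k ∈ A, f k η := by
  classical
  induction A using Finset.induction_on with
  | empty => simpa using const 0
  | insert k A hk ih => simpa [Finset.sum_insert hk] using (hf k).add ih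

theorem abs (hf : PolyBounded f) : PolyBounded fun η => |f η| := by
  obtain ⟨C, n, hC, h⟩ := hf
  exact ⟨C, n, hC, fun η => by simpa using h η⟩

theorem occupation (x : Fin N) : PolyBounded fun η : Config G σ => (η.1 x : ℝ) :=
  ⟨1, 1, zero_le_one, fun η => by
    rw [abs_of_nonneg (Nat.cast_nonneg _)]
    linarith [le_mass η x]⟩

theorem descFactorial (x : Fin N) (j : ℕ) :
    PolyBounded fun η : Config G σ => ((η.1 x).descFactorial j : ℝ) := by
  refine ⟨1, j, zero_le_one, fun η => ?_⟩
  rw [abs_of_nonneg (Nat.cast_nonneg _), one_mul]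
  calc ((η.1 x).descFactorial j : ℝ) ≤ (η.1 x : ℝ) ^ j := by
        exact_mod_cast Nat.descFactorial_le_pow _ _
    _ ≤ _ := pow_le_pow_left₀ (Nat.cast_nonneg _) (by linarith [le_mass η x]) j

theorem siteDual (a s θ : ℝ) (k : ℕ) (x : Fin N) :
    PolyBounded fun η : Config G σ => siteDual a s θ k (η.1 x) := by
  unfold BoundaryDriven.siteDual binomialShift factorialPoly
  refine sum _ fun j => (const _).mul ?_
  simp only [div_eq_mul_inv]
  exact (descFactorial x j).mul (const _)

theorem bulkDual (θ : ℝ) (ξ : Fin N → ℕ) :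
    PolyBounded fun η : Config G σ => bulkDual G σ θ ξ η.1 :=
  prod _ fun _ => siteDual _ _ _ _ _

theorem dualFunction [NeZero N] (θL θR θ : ℝ) (ξ : DualConfig G σ) :
    PolyBounded (dualFunction G σ θL θR θ ξ) :=
  (bulkDual θ ξ.1.1).mul (const _)

theorem particleRate [NeZero N] (θL θR : ℝ) (i : (Fin N × Fin N) ⊕ Fin 4) :
    PolyBounded (particleRate G σ θL θR i) := by
  have h : ∀ x, PolyBounded fun η : Config G σ => (G.α x : ℝ) + (σ : ℝ) * (η.1 x : ℝ) := fun x =>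
    (const _).add ((const _).mul (occupation x))
  rcases i with p | i
  · exact (const _).mul ((occupation _).mul (h _))
  · fin_cases i
    · exact (const _).mul ((occupation _).mul (const _))
    · exact (const _).mul ((const _).mul (h _))
    · exact (const _).mul ((occupation _).mul (const _))
    · exact (const _).mul ((const _).mul (h _))

theorem _root_.BoundaryDriven.mass_orElse_le (η : Config G σ) {f : Fin N → ℕ}
    (hf : ∑ x, (f x : ℝ) ≤ 1 + mass η) : mass (η.orElse f) ≤ 1 + mass η := by
  by_cases h : σ = -1 → ∀ x, f x ≤ G.α x
  · rwa [mass, η.orElse_val h]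
  · rw [Config.orElse, dif_neg h]
    linarith

theorem _root_.BoundaryDriven.mass_particleMove_le [NeZero N] (i : (Fin N × Fin N) ⊕ Fin 4)
    (η : Config G σ) : mass (particleMove G σ i η) ≤ 1 + mass η := by
  have hsub : ∀ x : Fin N, ∑ z, ((η.1 - Pi.single x 1 : Fin N → ℕ) z : ℝ) ≤ mass η := fun x =>
    Finset.sum_le_sum fun z _ => Nat.cast_le.2 (Nat.sub_le _ _)
  have hadd : ∀ (f : Fin N → ℕ) (x : Fin N),
      ∑ z, ((f + Pi.single x 1 : Fin N → ℕ) z : ℝ) = 1 + ∑ z, (f z : ℝ) := by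
    intro f x
    have h := linearStat_add_single (fun _ => 1) f x
    simp only [linearStat, one_mul] at h
    rw [h, add_comm]
  have hrem : ∀ x, mass (η.remove x) ≤ 1 + mass η := fun x =>
    mass_orElse_le η ((hsub x).trans (by linarith))
  have hadd' : ∀ x, mass (η.add x) ≤ 1 + mass η := fun x =>
    mass_orElse_le η (hadd _ x).le
  rcases i with p | i
  · change mass (η.hop p.1 p.2) ≤ _
    rw [Config.hop]
    split_ifs
    · linarith
    · refine mass_orElse_le η ?_
      rw [hadd]
      linarith [hsub p.1]
  · fin_cases i
    · exact hrem _
    · exact hadd' _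
    · exact hrem _
    · exact hadd' _

theorem comp_particleMove [NeZero N] (hf : PolyBounded f) (i : (Fin N × Fin N) ⊕ Fin 4) :
    PolyBounded fun η => f (particleMove G σ i η) := by
  obtain ⟨C, n, hC, h⟩ := hf
  refine ⟨C * 2 ^ n, n, by positivity, fun η => (h _).trans ?_⟩
  rw [mul_assoc, ← mul_pow]
  have h0 := mass_nonneg (particleMove G σ i η)
  exact mul_le_mul_of_nonneg_left (pow_le_pow_left₀ (by linarith)
    (by linarith [mass_particleMove_le i η, mass_nonneg η]) n) hC

theorem integrable [NeZero N] (hf : PolyBounded f) (hres : 0 < max G.ωL G.ωR) {θL θR : ℝ}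
    (hθL : θL ∈ scaleRange σ) (hθR : θR ∈ scaleRange σ) {μ : Measure (Config G σ)}
    [IsProbabilityMeasure μ] (hμ : IsStationaryLaw (generator G σ θL θR) μ) :
    Integrable f μ := by
  obtain ⟨C, n, hC, h⟩ := hf
  refine Integrable.mono' (g := fun η => C * (1 + mass η) ^ n) (Integrable.const_mul ?_ C)
    Measurable.of_discrete.aestronglyMeasurable (Eventually.of_forall h)
  simp only [add_pow, one_pow, one_mul]
  refine integrable_finsetSum _ fun k _ => Integrable.mul_const ?_ _
  exact integrable_mass_pow hres hθL hθR hμ _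

end PolyBounded

variable [NeZero N]

theorem integral_generator_eq_zero (hres : 0 < max G.ωL G.ωR) {θL θR : ℝ}
    (hθL : θL ∈ scaleRange σ) (hθR : θR ∈ scaleRange σ) {μ : Measure (Config G σ)}
    [IsProbabilityMeasure μ] (hμ : IsStationaryLaw (generator G σ θL θR) μ)
    {f : Config G σ → ℝ} (hf : PolyBounded f) : ∫ η, generator G σ θL θR f η ∂μ = 0 := by
  have hμ' := hμ
  rw [generator_eq_moveGenerator] at hμ' ⊢
  refine hμ'.integral_moveGenerator_eq_zero (particleRate_nonneg hθL hθR) (V := mass)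
    finite_mass_lt (fun i => (PolyBounded.particleRate θL θR i).integrable hres hθL hθR hμ) ?_
  exact (PolyBounded.sum _ fun i => (PolyBounded.particleRate θL θR i).mul
    ((hf.comp_particleMove i).abs.add hf.abs)).integrable hres hθL hθR hμ

/-- Stationary expectations of the duality functions are harmonic for the dual system. -/
theorem dualGenerator_integral_dualFunction (hres : 0 < max G.ωL G.ωR) {θL θR : ℝ}
    (hθL : θL ∈ scaleRange σ) (hθR : θR ∈ scaleRange σ) {μ : Measure (Config G σ)}
    [IsProbabilityMeasure μ] (hμ : IsStationaryLaw (generator G σ θL θR) μ) (θ : ℝ)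
    (ξ : DualConfig G σ) :
    dualGenerator G σ (fun ξ => ∫ η, dualFunction G σ θL θR θ ξ η ∂μ) ξ = 0 := by
  have hint : ∀ ξ, Integrable (dualFunction G σ θL θR θ ξ) μ := fun ξ =>
    (PolyBounded.dualFunction θL θR θ ξ).integrable hres hθL hθR hμ
  have h := integral_generator_eq_zero hres hθL hθR hμ (PolyBounded.dualFunction θL θR θ ξ)
  simp only [generator_dualFunction, dualGenerator_eq_moveGenerator, moveGenerator] at h ⊢
  rw [← h, integral_finsetSum (f := fun i η => dualRate G σ i ξ *
    (dualFunction G σ θL θR θ (dualMove G σ i ξ) η - dualFunction G σ θL θR θ ξ η)) _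
    fun i _ => ((hint _).sub (hint _)).const_mul _]
  refine Finset.sum_congr rfl fun i _ => ?_
  rw [integral_const_mul, integral_sub (hint _) (hint _)]

end PolyBounded

section DualSystem

variable {N : ℕ} [NeZero N] {G : Geometry N} {σ : SignType}

omit [NeZero N] in
theorem totalCard_cast (ξ : DualConfig G σ) :
    (totalCard ξ : ℝ) = ξ.2.1 + ξ.2.2 + linearStat (fun _ => 1) ξ.1.1 := by
  simp [totalCard, linearStat]

theorem totalCard_dualMove (i : (Fin N × Fin N) ⊕ Fin 2) (ξ : DualConfig G σ)
    (h : dualRate G σ i ξ ≠ 0) : totalCard (dualMove G σ i ξ) = totalCard ξ := by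
  have habs : ∀ x, ξ.1.1 x ≠ 0 → linearStat (fun _ => 1) (ξ.1.remove x).1 =
      linearStat (fun _ => 1) ξ.1.1 - 1 := fun x hx => by
    rw [ξ.1.remove_val, linearStat_sub_single _ hx]
  rw [← Nat.cast_inj (R := ℝ), totalCard_cast, totalCard_cast]
  rcases i with p | i
  · have h1 : ξ.1.1 p.1 ≠ 0 := fun h0 => h (by simp [dualRate, bulkRate, h0])
    have h2 : (G.α p.2 : ℝ) + (σ : ℝ) * (ξ.1.1 p.2 : ℝ) ≠ 0 := fun h0 =>
      h (by simp [dualRate, bulkRate, h0])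
    simp only [dualMove, Sum.elim_inl]
    rw [ξ.1.hop_val h1 h2, linearStat_add_single, linearStat_sub_single _ h1]
    ring
  · fin_cases i
    · have h1 : ξ.1.1 (firstSite N) ≠ 0 := fun h0 => h (by simp [dualRate, h0])
      simp only [dualMove, Sum.elim_inr, Fin.zero_eta, Matrix.cons_val]
      rw [habs _ h1]
      push_cast
      ring
    · have h1 : ξ.1.1 (lastSite N) ≠ 0 := fun h0 => h (by simp [dualRate, h0])
      simp only [dualMove, Sum.elim_inr, Fin.mk_one, Matrix.cons_val]
      rw [habs _ h1]
      push_cast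
      ring

omit [NeZero N] in
theorem finite_totalCard_eq (n : ℕ) : {ξ : DualConfig G σ | totalCard ξ = n}.Finite := by
  refine Set.Finite.subset ((finite_mass_lt (G := G) (σ := σ) (n + 1)).prod
    ((Set.finite_Iic n).prod (Set.finite_Iic n))) ?_
  rintro ⟨η, l, m⟩ (rfl : l + m + ∑ x, η.1 x = n)
  refine ⟨?_, ?_, ?_⟩
  · change ∑ x, (η.1 x : ℝ) < _
    have : (0 : ℝ) ≤ l := Nat.cast_nonneg _
    have : (0 : ℝ) ≤ m := Nat.cast_nonneg _
    push_cast
    linarith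
  · change l ≤ _
    omega
  · change m ≤ _
    omega

omit [NeZero N] in
theorem bulk_eq_zero_of_linearStat {v : Fin N → ℝ} (hv : ∀ x, 1 ≤ v x) {f : Fin N → ℕ}
    (h : linearStat v f = 0) : f = 0 := by
  ext x
  have h1 := (Finset.sum_eq_zero_iff_of_nonneg fun z _ =>
    mul_nonneg (zero_le_one.trans (hv z)) (Nat.cast_nonneg (f z))).1 h x (Finset.mem_univ x)
  have h2 : v x ≠ 0 := (zero_lt_one.trans_le (hv x)).ne'
  simpa [h2] using h1

/-- A Lyapunov function for the absorption of the dual system. -/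
theorem exists_dual_lyapunov (hres : 0 < max G.ωL G.ωR) : ∃ (v : Fin N → ℝ) (c : ℝ), 0 < c ∧
    (∀ x, 1 ≤ v x) ∧ ∀ (τ : SignType) (ξ : DualConfig G τ),
      moveGenerator (dualRate G τ) (dualMove G τ) (fun ξ => linearStat v ξ.1.1) ξ ≤
        -(c * linearStat v ξ.1.1) := by
  obtain ⟨B, hB, hslow⟩ := exists_slow_superharmonic hres
  have hε : 0 < 1 / (1 + B) := by positivity
  obtain ⟨v, hv1, hv3, -, hvL⟩ := hslow (1 / (1 + B)) hε (by
    rw [one_div, inv_mul_le_iff₀ (by positivity)]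
    linarith)
  refine ⟨v, 1 / (1 + B) / 3, by positivity, hv1, fun τ ξ => ?_⟩
  rw [← dualGenerator_eq_moveGenerator, dualGenerator_linearStat, linearStat, Finset.mul_sum,
    ← Finset.sum_neg_distrib]
  refine Finset.sum_le_sum fun x _ => ?_
  have h1 := mul_le_mul_of_nonneg_left (hvL x) (Nat.cast_nonneg (α := ℝ) (ξ.1.1 x))
  have h2 := mul_le_mul_of_nonneg_left (hv3 x)
    (mul_nonneg hε.le (Nat.cast_nonneg (α := ℝ) (ξ.1.1 x)))
  rw [killedGenerator_apply] at h1
  linear_combination h1 + h2 / 3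

omit [NeZero N] in
theorem linearStat_nonneg {v : Fin N → ℝ} (hv : ∀ x, 1 ≤ v x) (f : Fin N → ℕ) :
    0 ≤ linearStat v f :=
  Finset.sum_nonneg fun x _ => mul_nonneg (zero_le_one.trans (hv x)) (Nat.cast_nonneg _)

theorem exitRate_dual_eq_zero {ξ : DualConfig G σ} (h : ξ.1.1 = 0) :
    exitRate (moveGenerator (dualRate G σ) (dualMove G σ)) ξ = 0 := by
  classical
  rw [exitRate_moveGenerator]
  refine Finset.sum_eq_zero fun i _ => ?_
  have : dualRate G σ i ξ = 0 := by
    rcases i with p | i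
    · simp [dualRate, bulkRate, h]
    · fin_cases i <;> simp [dualRate, h]
  rw [this, ite_self]

theorem tendsto_dual_zero (hres : 0 < max G.ωL G.ωR) (ξ : DualConfig G σ) {ξ' : DualConfig G σ}
    (h : ξ'.1.1 ≠ 0) :
    Tendsto (fun t : ℝ => transProb (dualGenerator G σ) t ξ ξ') atTop (𝓝 0) := by
  obtain ⟨v, c, hc, hv, hL⟩ := exists_dual_lyapunov hres
  rw [dualGenerator_eq_moveGenerator]
  exact tendsto_transProb_zero dualRate_nonneg (fun ξ => linearStat_nonneg hv ξ.1.1) hc (hL σ) ξ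
    ((linearStat_nonneg hv _).lt_of_ne fun h' => h (bulk_eq_zero_of_linearStat hv h'.symm))

theorem tendsto_dual_limitProb (hres : 0 < max G.ωL G.ωR) (ξ ξ' : DualConfig G σ) :
    Tendsto (fun t : ℝ => transProb (dualGenerator G σ) t ξ ξ') atTop
      (𝓝 (limitProb (dualGenerator G σ) ξ ξ')) := by
  by_cases h : ξ'.1.1 = 0
  · rw [dualGenerator_eq_moveGenerator]
    exact tendsto_limitProb_of_exitRate_eq_zero dualRate_nonneg (exitRate_dual_eq_zero h) ξ
  · exact tendsto_nhds_limUnder ⟨0, tendsto_dual_zero hres ξ h⟩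

/-- Uniqueness in the Dirichlet problem for the dual system with `n` particles. -/
theorem dual_dirichlet_unique (hres : 0 < max G.ωL G.ωR) (n : ℕ) {u : DualConfig G σ → ℝ}
    (hu : ∀ ξ, totalCard ξ = n → dualGenerator G σ u ξ = 0)
    (hu0 : ∀ ξ, totalCard ξ = n → ξ.1.1 = 0 → u ξ = 0) {ξ : DualConfig G σ}
    (hξ : totalCard ξ = n) : u ξ = 0 := by
  classical
  obtain ⟨v, c, hc, hv, hL⟩ := exists_dual_lyapunov hres
  have h := eq_zero_of_harmonic dualRate_nonneg (fun ξ => linearStat_nonneg hv ξ.1.1) hc (hL σ)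
    totalCard_dualMove finite_totalCard_eq (u := fun ξ => if totalCard ξ = n then u ξ else 0)
    (fun ξ => ?_) (fun ξ hξ => ?_) ξ
  · simpa [hξ] using h
  · by_cases hn : totalCard ξ = n
    · rw [← hu ξ hn, dualGenerator_eq_moveGenerator]
      refine Finset.sum_congr rfl fun i _ => ?_
      by_cases hi : dualRate G σ i ξ = 0
      · simp [hi]
      · simp [totalCard_dualMove i ξ hi, hn]
    · refine Finset.sum_eq_zero fun i _ => ?_
      by_cases hi : dualRate G σ i ξ = 0
      · simp [hi]
      · simp [totalCard_dualMove i ξ hi, hn]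
  · split_ifs with hn
    · exact hu0 ξ hn (bulk_eq_zero_of_linearStat hv hξ)
    · rfl

/-- The dual configuration with `n` particles at `L` and no others. -/
def allAtL (G : Geometry N) (σ : SignType) (n : ℕ) : DualConfig G σ :=
  (⟨0, fun _ _ => Nat.zero_le _⟩, n, 0)

omit [NeZero N] in
theorem eq_allAtL {ξ : DualConfig G σ} (h1 : ξ.1.1 = 0) (h2 : ξ.2.2 = 0) :
    ξ = allAtL G σ (totalCard ξ) := by
  obtain ⟨⟨f, hf⟩, l, m⟩ := ξ
  simp only at h1 h2
  subst h1
  subst h2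
  simp [allAtL, totalCard]

omit [NeZero N] in
theorem totalCard_of_bulk_eq_zero {ξ : DualConfig G σ} (h : ξ.1.1 = 0) :
    totalCard ξ = ξ.2.1 + ξ.2.2 := by
  simp [totalCard, h]

theorem dualGenerator_toReal_limitProb {ξ' : DualConfig G σ} (h : ξ'.1.1 = 0)
    (ξ : DualConfig G σ) :
    dualGenerator G σ (fun ξ => (limitProb (dualGenerator G σ) ξ ξ').toReal) ξ = 0 := by
  rw [dualGenerator_eq_moveGenerator]
  exact moveGenerator_limitProb dualRate_nonneg (exitRate_dual_eq_zero h) ξ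

open Classical in
theorem limitProb_dual_of_bulk_eq_zero {ξ : DualConfig G σ} (h : ξ.1.1 = 0)
    (ξ' : DualConfig G σ) :
    limitProb (dualGenerator G σ) ξ ξ' = if ξ = ξ' then 1 else 0 := by
  rw [dualGenerator_eq_moveGenerator]
  exact limitProb_of_exitRate_eq_zero dualRate_nonneg (exitRate_dual_eq_zero h) ξ'

theorem limitProb_eq_zero_of_totalCard_ne (hres : 0 < max G.ωL G.ωR) {ξ ξ' : DualConfig G σ}
    (h : ξ'.1.1 = 0) (hne : totalCard ξ' ≠ totalCard ξ) :
    limitProb (dualGenerator G σ) ξ ξ' = 0 := by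
  classical
  have h1 := dual_dirichlet_unique hres (totalCard ξ)
    (u := fun ξ => (limitProb (dualGenerator G σ) ξ ξ').toReal)
    (fun ζ _ => dualGenerator_toReal_limitProb h ζ) (fun ζ hζ hζ0 => by
      rw [limitProb_dual_of_bulk_eq_zero hζ0, if_neg, ENNReal.toReal_zero]
      rintro rfl
      exact hne hζ) (ξ := ξ) rfl
  refine ((ENNReal.toReal_eq_zero_iff _).1 h1).resolve_right ?_
  rw [dualGenerator_eq_moveGenerator]
  exact ne_top_of_le_ne_top ENNReal.one_ne_top
    (limitProb_le_one dualRate_nonneg (exitRate_dual_eq_zero h) ξ)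

theorem absorbedAtL_eq (hres : 0 < max G.ωL G.ωR) (ξ : DualConfig G σ) :
    absorbedAtL G σ ξ =
      (limitProb (dualGenerator G σ) ξ (allAtL G σ (totalCard ξ))).toReal := by
  classical
  rw [absorbedAtL, tsum_eq_single (allAtL G σ (totalCard ξ))]
  · rw [if_pos (by rfl)]
  · intro ξ' hξ'
    split_ifs with h
    · by_cases h0 : ξ'.1.1 = 0
      · refine limitProb_eq_zero_of_totalCard_ne hres h0 fun hc => hξ' ?_
        have h2 := totalCard_of_bulk_eq_zero h0
        rw [← hc]
        exact eq_allAtL h0 (by omega)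
      · exact tendsto_nhds_unique (tendsto_dual_limitProb hres ξ ξ') (tendsto_dual_zero hres ξ h0)
    · rfl

/-- A harmonic function for the dual system with `n` particles which is `c` if all of them are at
`L` and vanishes at the other absorbed configurations. -/
theorem eq_mul_absorbedAtL (hres : 0 < max G.ωL G.ωR) (n : ℕ) (c : ℝ) {u : DualConfig G σ → ℝ}
    (hu : ∀ ξ, dualGenerator G σ u ξ = 0)
    (hu0 : ∀ ξ, totalCard ξ = n → ξ.1.1 = 0 → u ξ = if ξ.2.2 = 0 then c else 0)
    {ξ : DualConfig G σ} (hξ : totalCard ξ = n) : u ξ = c * absorbedAtL G σ ξ := by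
  classical
  have hb : (allAtL G σ n).1.1 = 0 := rfl
  have h := dual_dirichlet_unique hres n
    (u := fun ξ => u ξ - c * (limitProb (dualGenerator G σ) ξ (allAtL G σ n)).toReal)
    (fun ζ _ => ?_) (fun ζ hζ hζ0 => ?_) hξ
  · rw [absorbedAtL_eq hres, hξ]
    linarith
  · have h1 := hu ζ
    have h2 := dualGenerator_toReal_limitProb hb ζ
    rw [dualGenerator_eq_moveGenerator] at h1 h2 ⊢
    have h3 : ∀ f g : DualConfig G σ → ℝ, moveGenerator (dualRate G σ) (dualMove G σ)
        (fun ξ => f ξ - c * g ξ) ζ = moveGenerator (dualRate G σ) (dualMove G σ) f ζ -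
          c * moveGenerator (dualRate G σ) (dualMove G σ) g ζ := by
      intro f g
      simp only [moveGenerator, Finset.mul_sum, ← Finset.sum_sub_distrib]
      exact Finset.sum_congr rfl fun i _ => by ring
    rw [h3, h1, h2]
    ring
  · rw [hu0 ζ hζ hζ0, limitProb_dual_of_bulk_eq_zero hζ0]
    by_cases h2 : ζ.2.2 = 0
    · have h3 := eq_allAtL hζ0 h2
      rw [hζ] at h3
      simp [h2, ← h3]
    · have h3 : ζ ≠ allAtL G σ n := fun h => h2 (by rw [h]; rfl)
      simp [h2, h3]

/-- Absorption probabilities at `L` of a single dual particle. -/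
theorem exists_absorption_profile (hres : 0 < max G.ωL G.ωR) : ∃ p : Fin N → ℝ, ∀ x,
    killedGenerator G p x = -(if x = firstSite N then G.ωL * G.αL else 0) := by
  obtain ⟨p, hp⟩ := LinearMap.injective_iff_surjective.1 (killedGenerator_injective hres)
    (fun x => -(if x = firstSite N then G.ωL * G.αL else 0))
  exact ⟨p, congrFun hp⟩

section Profile

variable {p : Fin N → ℝ}
  (hp : ∀ x, killedGenerator G p x = -(if x = firstSite N then G.ωL * G.αL else 0))

include hp

theorem absorbedAtL_of_totalCard_eq_one (hres : 0 < max G.ωL G.ωR) {ξ : DualConfig G σ}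
    (hξ : totalCard ξ = 1) : absorbedAtL G σ ξ = linearStat p ξ.1.1 + ξ.2.1 := by
  have h := eq_mul_absorbedAtL hres 1 1 (u := fun ξ : DualConfig G σ =>
    linearStat p ξ.1.1 + ξ.2.1) (fun ζ => ?_) (fun ζ hζ hζ0 => ?_) hξ
  · rw [← one_mul (absorbedAtL G σ ξ), ← h]
  · have h1 := dualGenerator_linearStat p ζ
    simp only [← killedGenerator_apply, hp, mul_neg, mul_ite, mul_zero, Finset.sum_neg_distrib,
      Finset.sum_ite_eq', Finset.mem_univ, if_true] at h1
    simp only [dualGenerator, bulkGenerator, Nat.cast_add, Nat.cast_one,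
      add_sub_add_right_eq_sub] at h1 ⊢
    linear_combination h1
  · have h1 := totalCard_of_bulk_eq_zero hζ0
    rw [hζ0]
    split_ifs with h2
    · have : ζ.2.1 = 1 := by omega
      simp [linearStat, this]
    · have : ζ.2.1 = 0 := by omega
      simp [linearStat, this]

theorem absorbedAtL_independent (hres : 0 < max G.ωL G.ωR) (ξ : DualConfig G 0) :
    absorbedAtL G 0 ξ = (∏ x, p x ^ ξ.1.1 x) * 0 ^ ξ.2.2 := by
  have h := eq_mul_absorbedAtL hres (totalCard ξ) 1 (u := fun ξ : DualConfig G 0 =>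
    (∏ x, p x ^ ξ.1.1 x) * 0 ^ ξ.2.2) (fun ζ => ?_) (fun ζ hζ hζ0 => ?_) (ξ := ξ) rfl
  · rw [← one_mul (absorbedAtL G 0 ξ), ← h]
  · set Φ : (Fin N → ℕ) → ℝ := fun f => ∏ x, p x ^ f x with hΦ
    have hadd : ∀ f x, Φ (f + Pi.single x 1) = p x * Φ f := by
      intro f x
      simp only [hΦ, Pi.add_apply, pow_add, Finset.prod_mul_distrib]
      rw [mul_comm, Finset.prod_eq_single x]
      · simp
      · intro z _ hz
        simp [hz]
      · simp
    set Q : Fin N → ℝ := fun x => (ζ.1.1 x : ℝ) * Φ (ζ.1.1 - Pi.single x 1) with hQ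
    have hQp : ∀ x, (ζ.1.1 x : ℝ) * Φ ζ.1.1 = Q x * p x := by
      intro x
      by_cases hx : ζ.1.1 x = 0
      · simp [hQ, hx]
      · have : ζ.1.1 = ζ.1.1 - Pi.single x 1 + Pi.single x 1 := by
          ext z
          by_cases hz : z = x
          · subst hz
            simp only [Pi.add_apply, Pi.sub_apply, Pi.single_eq_same]
            omega
          · simp [hz]
        have h2 := hadd (ζ.1.1 - Pi.single x 1) x
        rw [← this] at h2
        simp only [hQ, h2]
        ring
    have hbulk : bulkGenerator G 0 (fun η => Φ η.1) ζ.1 =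
        ∑ x, Q x * ∑ y, G.ω x y * (G.α y : ℝ) * (p y - p x) := by
      rw [bulkGenerator_val]
      refine Finset.sum_congr rfl fun x _ => ?_
      rw [Finset.mul_sum]
      refine Finset.sum_congr rfl fun y _ => ?_
      rw [hadd]
      simp only [SignType.coe_zero, zero_mul, add_zero]
      have := hQp x
      simp only [hQ] at this ⊢
      linear_combination -(G.ω x y * (G.α y : ℝ)) * this
    have hsum : ∑ x, Q x * (∑ y, G.ω x y * (G.α y : ℝ) * (p y - p x)) =
        Q (firstSite N) * p (firstSite N) * (G.ωL * G.αL) +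
          Q (lastSite N) * p (lastSite N) * (G.ωR * G.αR) -
          Q (firstSite N) * (G.ωL * G.αL) := by
      have h1 : ∀ x, Q x * (∑ y, G.ω x y * (G.α y : ℝ) * (p y - p x)) =
          Q x * p x * killRate G x - Q x * (if x = firstSite N then G.ωL * G.αL else 0) := by
        intro x
        have := hp x
        rw [killedGenerator_apply] at this
        linear_combination Q x * this
      simp only [h1, Finset.sum_sub_distrib]
      rw [sum_mul_killRate (G := G) fun x => Q x * p x]
      simp
    have hb : bulkGenerator G 0 (fun η => Φ η.1 * 0 ^ ζ.2.2) ζ.1 =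
        bulkGenerator G 0 (fun η => Φ η.1) ζ.1 * 0 ^ ζ.2.2 := by
      simp only [bulkGenerator, Finset.sum_mul]
      exact Finset.sum_congr rfl fun x _ => Finset.sum_congr rfl fun y _ => by ring
    have hF := hQp (firstSite N)
    have hL := hQp (lastSite N)
    simp only [dualGenerator]
    change bulkGenerator G 0 (fun η => Φ η.1 * 0 ^ ζ.2.2) ζ.1 +
      (G.ωL * G.αL * (ζ.1.1 (firstSite N) : ℝ) * (Φ (ζ.1.remove (firstSite N)).1 * 0 ^ ζ.2.2 -
        Φ ζ.1.1 * 0 ^ ζ.2.2) + G.ωR * G.αR * (ζ.1.1 (lastSite N) : ℝ) *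
        (Φ (ζ.1.remove (lastSite N)).1 * 0 ^ (ζ.2.2 + 1) - Φ ζ.1.1 * 0 ^ ζ.2.2)) = 0
    rw [hb, hbulk, hsum, ζ.1.remove_val, ζ.1.remove_val, pow_succ]
    have hQF : Q (firstSite N) =
      (ζ.1.1 (firstSite N) : ℝ) * Φ (ζ.1.1 - Pi.single (firstSite N) 1) := rfl
    linear_combination -(G.ωL * G.αL * 0 ^ ζ.2.2) * hF - (G.ωR * G.αR * 0 ^ ζ.2.2) * hL -
      (G.ωL * G.αL * 0 ^ ζ.2.2) * hQF
  · rw [hζ0]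
    by_cases h2 : ζ.2.2 = 0 <;> simp [h2]

end Profile

end DualSystem

section Correlations

variable {N : ℕ} {G : Geometry N} {σ : SignType}

/-- The dual configuration with one particle at each site of `B`. -/
def setConfig (G : Geometry N) (σ : SignType) (B : Finset (Fin N)) : DualConfig G σ :=
  (⟨fun z => if z ∈ B then 1 else 0, fun _ y => by
    beta_reduce
    split_ifs
    · exact G.α_pos y
    · exact Nat.zero_le _⟩, 0, 0)

theorem setConfig_apply (B : Finset (Fin N)) (z : Fin N) :
    (setConfig G σ B).1.1 z = if z ∈ B then 1 else 0 := rfl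

theorem totalCard_setConfig (B : Finset (Fin N)) : totalCard (setConfig G σ B) = B.card := by
  simp [totalCard, setConfig]

theorem prod_setConfig (B : Finset (Fin N)) (p : Fin N → ℝ) :
    ∏ x, p x ^ (setConfig G σ B).1.1 x = ∏ x ∈ B, p x := by
  simp only [setConfig_apply, pow_ite, pow_one, pow_zero, Finset.prod_ite_mem, Finset.univ_inter]

theorem setConfig_injective : Function.Injective (setConfig G σ) := by
  intro A B h
  ext z
  have h1 : (setConfig G σ A).1.1 z = (setConfig G σ B).1.1 z := by rw [h]
  simp only [setConfig_apply] at h1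
  by_cases h2 : z ∈ A <;> by_cases h3 : z ∈ B <;> simp_all

theorem setConfig_le {A B : Finset (Fin N)} (h : B ⊆ A) : setConfig G σ B ≤ setConfig G σ A := by
  refine ⟨fun z => ?_, le_rfl⟩
  simp only [setConfig]
  by_cases hz : z ∈ B
  · simp [hz, h hz]
  · simp [hz]

theorem exists_eq_setConfig {A : Finset (Fin N)} {ζ : DualConfig G σ} (h : ζ ≤ setConfig G σ A) :
    ∃ B ⊆ A, setConfig G σ B = ζ := by
  classical
  have h1 : ∀ z, ζ.1.1 z ≤ if z ∈ A then 1 else 0 := h.1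
  have h2 : ζ.2.1 ≤ 0 := h.2.1
  have h3 : ζ.2.2 ≤ 0 := h.2.2
  refine ⟨Finset.univ.filter fun z => ζ.1.1 z ≠ 0, fun z hz => ?_, ?_⟩
  · have h4 : ζ.1.1 z ≠ 0 := by simpa using hz
    by_contra hzA
    have := h1 z
    rw [if_neg hzA] at this
    omega
  · refine Prod.ext (Subtype.ext (funext fun z => ?_)) (Prod.ext ?_ ?_)
    · have := h1 z
      simp only [setConfig_apply, Finset.mem_filter, Finset.mem_univ, true_and]
      split_ifs at this ⊢ <;> omega
    · exact (Nat.le_zero.1 h2).symm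
    · exact (Nat.le_zero.1 h3).symm

theorem diffIRW_setConfig {A B : Finset (Fin N)} (h : B ⊆ A) :
    diffIRW (setConfig G σ A) (setConfig G σ B) = setConfig G 0 (A \ B) := by
  refine Prod.ext (Subtype.ext (funext fun z => ?_)) rfl
  change (if z ∈ A then 1 else 0) - (if z ∈ B then 1 else 0) = if z ∈ A \ B then 1 else 0
  have := @h z
  by_cases h1 : z ∈ A <;> by_cases h2 : z ∈ B <;> simp_all

theorem pointConfig_eq_setConfig {n : ℕ} (x : Fin n → Fin N) (hx : Function.Injective x) :
    pointConfig G σ x hx = setConfig G σ (Finset.univ.image x) := by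
  refine Prod.ext (Subtype.ext (funext fun z => ?_)) rfl
  change (∑ i, (Pi.single (x i) 1 : Fin N → ℕ)) z = _
  rw [Finset.sum_apply, setConfig_apply]
  by_cases hz : ∃ j, x j = z
  · obtain ⟨j, rfl⟩ := hz
    rw [if_pos (Finset.mem_image_of_mem x (Finset.mem_univ j)), Finset.sum_eq_single j]
    · simp
    · intro i _ hij
      simp [hx.ne hij.symm]
    · simp
  · have hz' := hz
    push Not at hz
    rw [if_neg (by simpa using hz), Finset.sum_eq_zero]
    intro i _
    simp [(hz i).symm]

theorem bulkDual_setConfig (θ : ℝ) (B : Finset (Fin N)) (η : Config G σ) :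
    bulkDual G σ θ (setConfig G σ B).1.1 η.1 = ∏ y ∈ B, ((η.1 y : ℝ) / (G.α y : ℝ) - θ) := by
  rw [bulkDual, ← Finset.prod_subset (Finset.subset_univ B)]
  · refine Finset.prod_congr rfl fun y hy => ?_
    rw [setConfig_apply, if_pos hy, siteDual_one]
  · intro y _ hy
    rw [setConfig_apply, if_neg hy, siteDual_zero]

variable [NeZero N]

theorem psi_setConfig (hres : 0 < max G.ωL G.ωR) {p : Fin N → ℝ}
    (hp : ∀ x, killedGenerator G p x = -(if x = firstSite N then G.ωL * G.αL else 0))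
    (A : Finset (Fin N)) :
    psi G σ (setConfig G σ A) = ∑ B ∈ A.powerset,
      (-1) ^ (A \ B).card * (∏ x ∈ A \ B, p x) * absorbedAtL G σ (setConfig G σ B) := by
  rw [psi]
  refine (Finset.sum_nbij (setConfig G σ) (fun B hB => ?_) setConfig_injective.injOn
    (fun ζ hζ => ?_) (fun B hB => ?_)).symm
  · rw [Set.Finite.mem_toFinset]
    exact setConfig_le (Finset.mem_powerset.1 hB)
  · rw [Finset.mem_coe, Set.Finite.mem_toFinset] at hζ
    obtain ⟨B, hB, h⟩ := exists_eq_setConfig hζ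
    exact ⟨B, Finset.mem_coe.2 (Finset.mem_powerset.2 hB), h⟩
  · have hBA := Finset.mem_powerset.1 hB
    rw [diffIRW_setConfig hBA, totalCard_setConfig, totalCard_setConfig,
      absorbedAtL_independent hp hres, prod_setConfig, Finset.card_sdiff_of_subset hBA]
    change _ = _ * ((∏ x ∈ A \ B, p x) * 0 ^ 0) * _
    rw [pow_zero, mul_one]

section Stationary

variable {θL θR : ℝ} {μ : Measure (Config G σ)} [IsProbabilityMeasure μ]

/-- Stationary expectations of products of occupation numbers at distinct sites, centered at the
right scale parameter. -/
theorem integral_prod_sub_right (hres : 0 < max G.ωL G.ωR) (hθL : θL ∈ scaleRange σ)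
    (hθR : θR ∈ scaleRange σ) (hμ : IsStationaryLaw (generator G σ θL θR) μ)
    (B : Finset (Fin N)) :
    ∫ η, ∏ y ∈ B, ((η.1 y : ℝ) / (G.α y : ℝ) - θR) ∂μ =
      (θL - θR) ^ B.card * absorbedAtL G σ (setConfig G σ B) := by
  have h := eq_mul_absorbedAtL hres B.card ((θL - θR) ^ B.card)
    (dualGenerator_integral_dualFunction hres hθL hθR hμ θR)
    (fun ζ hζ hζ0 => ?_) (totalCard_setConfig (G := G) (σ := σ) B)
  · rw [← h]
    refine integral_congr_ae (Eventually.of_forall fun η => ?_)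
    simp only [dualFunction, bulkDual_setConfig]
    simp [setConfig]
  · have h1 := totalCard_of_bulk_eq_zero hζ0
    have h2 : ∀ η : Config G σ, dualFunction G σ θL θR θR ζ η =
        (θL - θR) ^ ζ.2.1 * 0 ^ ζ.2.2 := by
      intro η
      rw [dualFunction, sub_self, hζ0]
      simp [bulkDual, siteDual_zero]
    simp only [h2, integral_const, probReal_univ, one_smul]
    split_ifs with h3
    · rw [h3, pow_zero, mul_one, ← hζ, h1, h3, add_zero]
    · rw [zero_pow h3, mul_zero]

omit [NeZero N] in
theorem polyBounded_div (y : Fin N) :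
    PolyBounded fun η : Config G σ => (η.1 y : ℝ) / (G.α y : ℝ) := by
  simp only [div_eq_mul_inv]
  exact (PolyBounded.occupation y).mul (PolyBounded.const _)

theorem meanProfile_eq (hres : 0 < max G.ωL G.ωR) (hθL : θL ∈ scaleRange σ)
    (hθR : θR ∈ scaleRange σ) (hμ : IsStationaryLaw (generator G σ θL θR) μ) {p : Fin N → ℝ}
    (hp : ∀ x, killedGenerator G p x = -(if x = firstSite N then G.ωL * G.αL else 0))
    (y : Fin N) : meanProfile μ y = θR + (θL - θR) * p y := by
  have h := integral_prod_sub_right hres hθL hθR hμ {y}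
  simp only [Finset.prod_singleton, Finset.card_singleton, pow_one] at h
  rw [integral_sub ((polyBounded_div y).integrable hres hθL hθR hμ) (integrable_const _),
    absorbedAtL_of_totalCard_eq_one hp hres (by rw [totalCard_setConfig, Finset.card_singleton])]
    at h
  have h2 : linearStat p (setConfig G σ {y}).1.1 = p y := by
    simp [linearStat, setConfig_apply]
  have h3 : (setConfig G σ {y}).2.1 = 0 := rfl
  rw [h2, h3] at h
  simp only [integral_const, probReal_univ, one_smul, Nat.cast_zero, add_zero] at h
  rw [meanProfile]
  linarith

theorem integral_prod_sub_meanProfile (hres : 0 < max G.ωL G.ωR) (hθL : θL ∈ scaleRange σ)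
    (hθR : θR ∈ scaleRange σ) (hμ : IsStationaryLaw (generator G σ θL θR) μ)
    (A : Finset (Fin N)) :
    ∫ η, ∏ y ∈ A, ((η.1 y : ℝ) / (G.α y : ℝ) - meanProfile μ y) ∂μ =
      (θL - θR) ^ A.card * psi G σ (setConfig G σ A) := by
  obtain ⟨p, hp⟩ := exists_absorption_profile hres
  have h1 : ∀ η : Config G σ, ∏ y ∈ A, ((η.1 y : ℝ) / (G.α y : ℝ) - meanProfile μ y) =
      ∑ B ∈ A.powerset, (∏ y ∈ B, ((η.1 y : ℝ) / (G.α y : ℝ) - θR)) *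
        ∏ y ∈ A \ B, (-((θL - θR) * p y)) := by
    intro η
    rw [← Finset.prod_add]
    refine Finset.prod_congr rfl fun y _ => ?_
    rw [meanProfile_eq hres hθL hθR hμ hp]
    ring
  simp only [h1]
  rw [integral_finsetSum, psi_setConfig hres hp, Finset.mul_sum]
  · refine Finset.sum_congr rfl fun B hB => ?_
    have hBA := Finset.mem_powerset.1 hB
    rw [integral_mul_const, integral_prod_sub_right hres hθL hθR hμ]
    have h2 : ∏ y ∈ A \ B, (-((θL - θR) * p y)) =
        (-1) ^ (A \ B).card * (θL - θR) ^ (A \ B).card * ∏ y ∈ A \ B, p y := by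
      simp only [neg_mul_eq_neg_mul, Finset.prod_mul_distrib, Finset.prod_const]
      rw [← mul_pow]
      congr 2
      ring
    have h3 : A.card = B.card + (A \ B).card := by
      rw [Finset.card_sdiff_of_subset hBA]
      have := Finset.card_le_card hBA
      omega
    rw [h2, h3, pow_add]
    ring
  · intro B _
    refine (PolyBounded.integrable (PolyBounded.mul (PolyBounded.prod B fun y => ?_)
      (PolyBounded.const _)) hres hθL hθR hμ)
    exact (polyBounded_div y).sub (PolyBounded.const _)

end Stationary

end Correlations

end BoundaryDriven

open BoundaryDriven
theorem mainTheorem1 {N : ℕ} [NeZero N] (G : Geometry N) (hres : 0 < max G.ωL G.ωR)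
    (σ : SignType) (θL θR : ℝ) (hθL : θL ∈ scaleRange σ) (hθR : θR ∈ scaleRange σ)
    (μ : Measure (Config G σ)) [IsProbabilityMeasure μ]
    (hμ : IsStationaryLaw (generator G σ θL θR) μ)
    (n : ℕ) (x : Fin n → Fin N) (hx : Function.Injective x) :
    (∀ (τ : SignType) (ξ ξ' : DualConfig G τ),
      Tendsto (fun t : ℝ => transProb (dualGenerator G τ) t ξ ξ') atTop
        (𝓝 (limitProb (dualGenerator G τ) ξ ξ'))) ∧
    (∀ y : Fin N, Integrable (fun η : Config G σ => (η.1 y : ℝ) / (G.α y : ℝ)) μ) ∧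
    Integrable (fun η : Config G σ =>
      ∏ i, ((η.1 (x i) : ℝ) / (G.α (x i) : ℝ) - meanProfile μ (x i))) μ ∧
    ∫ η, ∏ i, ((η.1 (x i) : ℝ) / (G.α (x i) : ℝ) - meanProfile μ (x i)) ∂μ =
      (θL - θR) ^ n * psi G σ (pointConfig G σ x hx) := by
  refine ⟨fun τ ξ ξ' => tendsto_dual_limitProb hres ξ ξ',
    fun y => (polyBounded_div y).integrable hres hθL hθR hμ,
    (PolyBounded.prod _ fun i => (polyBounded_div (x i)).sub (PolyBounded.const _)).integrable
      hres hθL hθR hμ, ?_⟩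
  have h := integral_prod_sub_meanProfile hres hθL hθR hμ (Finset.univ.image x)
  rw [Finset.card_image_of_injective _ hx, Finset.card_univ, Fintype.card_fin] at h
  rw [pointConfig_eq_setConfig, ← h]
  refine integral_congr_ae (Eventually.of_forall fun η => ?_)
  exact (Finset.prod_image (f := fun y => (η.1 y : ℝ) / (G.α y : ℝ) - meanProfile μ y)
    fun i _ j _ hij => hx hij).symm
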